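/- Let $n\ge 1$, let $q$ be a power of a prime $p$ with $q\equiv 1 \pmod 4$, and let $G=\mathrm{Sp}_{2n}(q)$, written with respect to a symplectic basis $u_1,\dots,u_n,v_1,\dots,v_n$ of $V=\mathbb F_q^{2n}$, so $\langle u_i,v_j\rangle=\delta_{ij}$ and $\langle u_i,u_j\rangle=\langle v_i,v_j\rangle=0$. Let $B\le G$ be the Borel subgroup of the elements of the form $\begin{pmatrix}A&*\\0&{}^tA^{-1}\end{pmatrix}$ with $A$ upper triangular, $H\le B$ the diagonal subgroup, $W$ the Weyl group, with representatives $n_w$ modulo $H$, and $\ell$ its length function. Let $R\subset\mathbb C$ be a discrete valuation ring containing a primitive $p$-th root of unity, $F$ a field of characteristic $2$, and $\varphi:R\to F$ a ring homomorphism. Steinberg module and filtration. For a commutative ring $A$ put $e=\bigl(\sum_{w\in W}(-1)^{\ell(w)}n_w\bigr)\sum_{b\in B}b\in A[G]$ and $I_A=A[G]e$. On $I=I_R$ let $f(x,y)=|B|^{-1}\sum_{g\in G}x(g)y(g)$, a $G$-invariant symmetric bilinear form with values in $R$. For $k\ge 0$ let $I(k)=\{x\in I: f(x,I)\subseteq 2^kR\}$,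 and let $\overline{I(k)}$ be the submodule of the Steinberg module $I_F$ over $F$ spanned by the image of $I(k)$ under $\varphi$. Thus $I_F=\overline{I(0)}\supseteq\overline{I(1)}\supseteq\cdots$. Weil modules. Let $M$ and $N$ be the spans of the $u_i$ and of the $v_i$. For a nontrivial character $\psi:\mathbb F_q^+\to\mathbb C^*$ let $Y$ be the complex vector space with basis $(\epsilon_w)_{w\in N}$, and for $\alpha\in\mathbb F_q$, $u\in M$, $v\in N$ let $J(\alpha,u+v)\epsilon_w=\psi(\alpha+\langle u,v+2w\rangle)\epsilon_{w+v}$. A Weil representation of type $\psi$ is a representation $P$ of $G$ on $Y$ with $P(g)J(\alpha,x)P(g)^{-1}=J(\alpha,gx)$ for all $g\in G$, $\alpha\in\mathbb F_q$, $x\in V$. The complex Weil modules of degree $(q^n-1)/2$ are the restrictions of such $P$ to the span $Y^-$ of the vectors $\epsilon_v-\epsilon_{-v}$. A reduction over $F$ of a complex $G$-module $W$ is a module of the form $F\otimes_R\Lambda$ with $\Lambda$ an $R[G]$-module that is free of finite rank over $R$ and satisfies $\mathbb C\otimes_R\Lambda\cong W$. Theorem. Let $\kappa$ be the exponent of the highest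 power of $2$ dividing $|G:B|$. Up to isomorphism there are exactly two complex Weil modules $W_1\not\cong W_2$ of $G$ of degree $(q^n-1)/2$. Both have reductions over $F$. Whenever $N_1$, $N_2$ are reductions over $F$ of $W_1$, $W_2$, the modules $N_1$ and $N_2$ are irreducible and not isomorphic to each other, and each of them is isomorphic to a submodule of $\overline{I(\kappa-1)}/\overline{I(\kappa)}$. -/

import Mathlib

open Matrix

noncomputable section

namespace SpSteinberg

/-! ### The symplectic group, its Borel subgroup and its Weyl group -/

section Group

variable (n : ℕ) (K : Type*) [Field K]

/-- `Sp_{2n}(K)`, acting on column vectors. The standard basis vectors with index `inl i`, `inr i`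
are the members `u_i`, `v_i` of a symplectic basis. -/
abbrev Sp : Type _ := ↥(symplecticGroup (Fin n) K)

variable {n K}

theorem coe_inv_fromBlocks (g : Sp n K) :
    ((g⁻¹ : Sp n K) : Matrix (Fin n ⊕ Fin n) (Fin n ⊕ Fin n) K) =
      fromBlocks (g.1.toBlocks₂₂)ᵀ (-(g.1.toBlocks₁₂)ᵀ)
        (-(g.1.toBlocks₂₁)ᵀ) (g.1.toBlocks₁₁)ᵀ := by
  rw [SymplecticGroup.coe_inv]
  conv_lhs => rw [← fromBlocks_toBlocks g.1]
  rw [J, fromBlocks_transpose, fromBlocks_neg, fromBlocks_multiply, fromBlocks_multiply]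
  simp

variable (n K)

/-- The Borel subgroup `B`: the matrices with block form `(A, *; 0, ᵗA⁻¹)` with `A` upper
triangular (the shape of the lower right block is forced). -/
def borel : Subgroup (Sp n K) where
  carrier := {g | g.1.toBlocks₂₁ = 0 ∧ g.1.toBlocks₁₁.BlockTriangular id}
  one_mem' := by
    constructor
    · ext i j; simp [toBlocks₂₁]
    · intro i j h; simp [toBlocks₁₁, (ne_of_gt h : i ≠ j)]
  mul_mem' := by
    rintro a b ⟨ha, ha'⟩ ⟨hb, hb'⟩
    have h : (a * b).1 = fromBlocks a.1.toBlocks₁₁ a.1.toBlocks₁₂ a.1.toBlocks₂₁ a.1.toBlocks₂₂ *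
        fromBlocks b.1.toBlocks₁₁ b.1.toBlocks₁₂ b.1.toBlocks₂₁ b.1.toBlocks₂₂ := by
      simp [fromBlocks_toBlocks]
    rw [fromBlocks_multiply, ha, hb] at h
    constructor
    · rw [h, toBlocks_fromBlocks₂₁]; simp
    · rw [h, toBlocks_fromBlocks₁₁]; simpa using ha'.mul hb'
  inv_mem' := by
    rintro a ⟨ha, ha'⟩
    have h1 : (a * a⁻¹).1 = 1 := by simp
    have h : (a * a⁻¹).1 =
        fromBlocks a.1.toBlocks₁₁ a.1.toBlocks₁₂ a.1.toBlocks₂₁ a.1.toBlocks₂₂ *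
          (a⁻¹ : Sp n K).1 := by
      rw [fromBlocks_toBlocks]; rfl
    rw [coe_inv_fromBlocks, fromBlocks_multiply, h1, ← fromBlocks_one] at h
    have h2 : a.1.toBlocks₁₁ * (a.1.toBlocks₂₂)ᵀ = 1 := by
      have h12 := (fromBlocks_inj.1 h).2.2.2
      rw [ha] at h12
      have : (a.1.toBlocks₂₂ * (a.1.toBlocks₁₁)ᵀ)ᵀ = 1 := by
        have h13 : a.1.toBlocks₂₂ * (a.1.toBlocks₁₁)ᵀ = 1 := by simpa using h12.symm
        rw [h13, transpose_one]
      simpa [transpose_mul] using this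
    constructor
    · rw [coe_inv_fromBlocks, toBlocks_fromBlocks₂₁, ha]; simp
    · rw [coe_inv_fromBlocks, toBlocks_fromBlocks₁₁, ← inv_eq_right_inv h2]
      let _ := invertibleOfRightInverse _ _ h2
      exact blockTriangular_inv_of_blockTriangular ha'

/-- The torus `H` of diagonal matrices in `Sp_{2n}(K)`. -/
def torus : Subgroup (Sp n K) where
  carrier := {g | g.1.IsDiag}
  one_mem' := isDiag_one
  mul_mem' := by
    intro a b ha hb
    change (a.1 * b.1).IsDiag
    rw [← (isDiag_iff_diagonal_diag a.1).1 ha, ← (isDiag_iff_diagonal_diag b.1).1 hb,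
      diagonal_mul_diagonal]
    exact isDiag_diagonal _
  inv_mem' := by
    intro a ha
    change ((a⁻¹ : Sp n K).1).IsDiag
    rw [SymplecticGroup.coe_inv', ← (isDiag_iff_diagonal_diag a.1).1 ha, inv_diagonal]
    exact isDiag_diagonal _

variable {n}

/-- The element `w` of `Sp_{2n}(K)` that exchanges `u_i` with `u_j` and `v_i` with `v_j`. -/
def swapElt (i j : Fin n) : Sp n K :=
  ⟨fromBlocks ((Equiv.swap i j).permMatrix K) 0 0 ((Equiv.swap i j).permMatrix K), by
    have h : (Equiv.swap i j).permMatrix K * (Equiv.swap i j).permMatrix K = 1 := by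
      rw [← permMatrix_mul]; simp
    rw [SymplecticGroup.mem_iff, J, fromBlocks_transpose, fromBlocks_multiply,
      fromBlocks_multiply]
    simp [h]⟩

/-- The element `c_j` of `Sp_{2n}(K)`: `u_j ↦ v_j`, `v_j ↦ -u_j`, the other basis vectors being
fixed. -/
def flipElt (j : Fin n) : Sp n K :=
  ⟨fromBlocks (1 - single j j 1) (-single j j 1) (single j j 1) (1 - single j j 1), by
    rw [SymplecticGroup.mem_iff, J, fromBlocks_transpose, fromBlocks_multiply,
      fromBlocks_multiply]
    simp [sub_mul, mul_sub, transpose_single]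
    abel⟩

variable (n)

/-- The fundamental reflections `w_1, …, w_{n-1}, c_n`. -/
def simpleReflections : Set (Sp n K) :=
  {g | (∃ i j : Fin n, (i : ℕ) + 1 = j ∧ g = swapElt K i j) ∨
    ∃ j : Fin n, (j : ℕ) + 1 = n ∧ g = flipElt K j}

/-- The group `W_2` generated by `w_1, …, w_{n-1}, c_1, …, c_n`. -/
def monomialGroup : Subgroup (Sp n K) :=
  Subgroup.closure
    ({g | ∃ i j : Fin n, (i : ℕ) + 1 = j ∧ g = swapElt K i j} ∪ Set.range (flipElt K))

/-- The Weyl group `W = W_2 / (W_2 ∩ H)`. -/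
abbrev Weyl : Type _ := ↥(monomialGroup n K) ⧸ (torus n K).subgroupOf (monomialGroup n K)

variable {n K}

/-- The length of `gH`: the least length of a word in the cosets `w_1 H, …, w_{n-1} H, c_n H`
with product `gH`. -/
def weylLength (g : Sp n K) : ℕ :=
  sInf {k | ∃ L : List (Sp n K), L.length = k ∧ (∀ s ∈ L, s ∈ simpleReflections n K) ∧
    ∃ h ∈ torus n K, g = L.prod * h}

end Group

/-! ### The Steinberg lattice, its invariant form and its filtration -/

section Steinberg

variable (n : ℕ) (K : Type*) [Field K] (R : Type*) [CommRing R]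

/-- `e = (∑_{w ∈ W} (-1)^{ℓ(w)} n_w) ∑_{b ∈ B} b`, where `n_w ∈ W_2` represents `w`. -/
def steinbergElt : MonoidAlgebra R (Sp n K) :=
  (∑ᶠ w : Weyl n K, MonoidAlgebra.single (w.out : Sp n K)
      ((-1 : R) ^ weylLength (w.out : Sp n K))) *
    ∑ᶠ b : borel n K, MonoidAlgebra.single (b : Sp n K) (1 : R)

/-- The Steinberg module `I` over `R`: the left ideal `R Sp_{2n}(K) e` of the group algebra. -/
def steinberg : Submodule (MonoidAlgebra R (Sp n K)) (MonoidAlgebra R (Sp n K)) :=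
  Submodule.span _ {steinbergElt n K R}

variable {n K R}

/-- The bilinear form on a group algebra for which the group elements are orthonormal. -/
def pairing {G : Type*} (x y : MonoidAlgebra R G) : R :=
  x.coeff.sum fun g a => a * y.coeff g

theorem pairing_add_left {G : Type*} (x x' y : MonoidAlgebra R G) :
    pairing (x + x') y = pairing x y + pairing x' y := by
  classical
  unfold pairing
  rw [MonoidAlgebra.coeff_add, Finsupp.sum_add_index'] <;> simp [add_mul]

theorem pairing_single_mul {G : Type*} [Group G] (g : G) (r : R) (x y : MonoidAlgebra R G) :
    pairing (MonoidAlgebra.single g r * x) y =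
      r * pairing x (MonoidAlgebra.single g⁻¹ 1 * y) := by
  induction x using MonoidAlgebra.induction_linear with
  | zero => simp [pairing]
  | add a b ha hb => rw [mul_add, pairing_add_left, pairing_add_left, ha, hb, mul_add]
  | single h a =>
    rw [MonoidAlgebra.single_mul_single]
    unfold pairing
    rw [MonoidAlgebra.coeff_single, MonoidAlgebra.coeff_single, Finsupp.sum_single_index (by simp),
      Finsupp.sum_single_index (by simp)]
    simp [mul_assoc]

variable (n K R)

/-- `I(k) = {x ∈ I | f(x, I) ⊆ 2^k R}`, where `f = |B|⁻¹ ⟨·,·⟩` is the invariant form on the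
Steinberg lattice `I`. The elements of `I` are constant on the cosets `gB`, so `⟨x, y⟩` is `|B|`
times the sum of `x(g) y(g)` over representatives `g` of these cosets; thus `f` has values in `R`,
`f(e, e) = |W|`, and some value of `f` is `1`. -/
def gowLattice (k : ℕ) : Submodule (MonoidAlgebra R (Sp n K)) (MonoidAlgebra R (Sp n K)) where
  carrier := {x | x ∈ steinberg n K R ∧
    ∀ y ∈ steinberg n K R, (Nat.card (borel n K) : R) * 2 ^ k ∣ pairing x y}
  zero_mem' := ⟨zero_mem _, fun y _ => by simp [pairing]⟩
  add_mem' := fun {a b} ha hb => ⟨add_mem ha.1 hb.1, fun y hy => by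
    rw [pairing_add_left]; exact dvd_add (ha.2 y hy) (hb.2 y hy)⟩
  smul_mem' := fun c x hx => ⟨Submodule.smul_mem _ _ hx.1, by
    induction c using MonoidAlgebra.induction_linear with
    | zero => intro y _; simp [pairing]
    | add a b ha hb =>
      intro y hy
      rw [add_smul, pairing_add_left]
      exact dvd_add (ha y hy) (hb y hy)
    | single g r =>
      intro y hy
      rw [smul_eq_mul, pairing_single_mul]
      exact Dvd.dvd.mul_left (hx.2 _ (Submodule.smul_mem _ _ hy)) r⟩

variable {R} {F : Type*} [Field F]

/-- The submodule `\overline{I(k)}` of the Steinberg module over `F` spanned by the image of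
`I(k)` under reduction of the coefficients by `φ : R → F`. -/
def gowFiltration (φ : R →+* F) (k : ℕ) :
    Submodule (MonoidAlgebra F (Sp n K)) (MonoidAlgebra F (Sp n K)) :=
  Submodule.span _ (MonoidAlgebra.mapRingHom (Sp n K) φ '' (gowLattice n K R k : Set _))

end Steinberg

/-! ### Complex Weil modules -/

section Weil

variable {n : ℕ} {K : Type*} [Field K]

/-- The operator `J(α, x)` of the Schrödinger representation of type `ψ` of the Heisenberg group:
for `x = u + v`, `u` in the span of the `u_i` and `v` in the span `N` of the `v_i`, it maps the
basis vector `ε_w`, `w ∈ N`, to `ψ(α + ⟨u, v + 2w⟩) ε_{w+v}`. Here `N` is identified with `Kⁿ`. -/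
def schrodinger (ψ : AddChar K ℂ) (α : K) (x : Fin n ⊕ Fin n → K) :
    ((Fin n → K) →₀ ℂ) →ₗ[ℂ] ((Fin n → K) →₀ ℂ) :=
  Finsupp.linearCombination ℂ fun w : Fin n → K =>
    Finsupp.single (w + x ∘ Sum.inr)
      (ψ (α + (x ∘ Sum.inl) ⬝ᵥ (x ∘ Sum.inr + (2 : K) • w)))

/-- `P` is a Weil representation of type `ψ`: `P(g) J(α, x) P(g)⁻¹ = J(α, g x)`. -/
def IsWeilRep (ψ : AddChar K ℂ) (P : Representation ℂ (Sp n K) ((Fin n → K) →₀ ℂ)) : Prop :=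
  ∀ (g : Sp n K) (α : K) (x : Fin n ⊕ Fin n → K),
    P g ∘ₗ schrodinger ψ α x = schrodinger ψ α (g.1 *ᵥ x) ∘ₗ P g

variable (n K) in
/-- The span `Y⁻` of the vectors `ε_v - ε_{-v}`. -/
def oddPart : Submodule ℂ ((Fin n → K) →₀ ℂ) :=
  Submodule.span ℂ (Set.range fun v : Fin n → K => Finsupp.single v 1 - Finsupp.single (-v) 1)

/-- `W` is isomorphic to the subrepresentation on `Y⁻` (of degree `(qⁿ - 1) / 2`) of a Weil
representation of nontrivial type. -/
def IsSmallWeilModule {V : Type*} [AddCommGroup V] [Module ℂ V]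
    (W : Representation ℂ (Sp n K) V) : Prop :=
  ∃ ψ : AddChar K ℂ, ψ ≠ 1 ∧ ∃ P : Representation ℂ (Sp n K) ((Fin n → K) →₀ ℂ),
    IsWeilRep ψ P ∧ ∃ T : Representation.IntertwiningMap W P,
      Function.Injective T ∧ LinearMap.range T.toLinearMap = oddPart n K

end Weil

/-! ### Modular reduction -/

section Reduction

variable {G : Type*} [Group G]

/-- The representation over `E` obtained from a matrix representation over `R` by change of
scalars along `f : R → E`. -/
def baseChangeRep {R E : Type*} [CommRing R] [CommRing E] (f : R →+* E) {d : ℕ}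
    (ρ : G →* Matrix (Fin d) (Fin d) R) : Representation E G (Fin d → E) :=
  (Matrix.toLinAlgEquiv' : Matrix (Fin d) (Fin d) E ≃ₐ[E] _).toRingEquiv.toMonoidHom.comp
    ((f.mapMatrix : Matrix (Fin d) (Fin d) R →+* _).toMonoidHom.comp ρ)

/-- `N` is a reduction along `φ : R → F` of the complex representation `W`: there is an
`R`-free `RG`-lattice which becomes `W` over `ℂ` and `N` over `F`. -/
def IsReduction {R : Subring ℂ} {F : Type*} [Field F] (φ : R →+* F)
    {V V' : Type*} [AddCommGroup V] [Module ℂ V] [AddCommGroup V'] [Module F V']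
    (W : Representation ℂ G V) (N : Representation F G V') : Prop :=
  ∃ (d : ℕ) (ρ : G →* Matrix (Fin d) (Fin d) R),
    Nonempty (W.Equiv (baseChangeRep R.subtype ρ)) ∧ Nonempty (N.Equiv (baseChangeRep φ ρ))

/-- The representation `N` is isomorphic to a submodule of the module `A / (A ∩ A')`. -/
def EmbedsInLayer {F : Type*} [Field F] {V : Type*} [AddCommGroup V] [Module F V]
    (N : Representation F G V) (A A' : Submodule (MonoidAlgebra F G) (MonoidAlgebra F G)) :
    Prop :=
  ∃ f : N.asModule →ₗ[MonoidAlgebra F G] (A ⧸ A'.submoduleOf A), Function.Injective f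

end Reduction

end SpSteinberg

end

set_option linter.unusedSectionVars false

noncomputable section

namespace SpSteinberg

/-! ### Block matrices in the symplectic group -/

section Blocks

variable {n : ℕ} {K : Type*} [Field K]

/-! The lattice `I` consists of right `B`-invariant functions whose sum over every panel, that is
over the `q + 1` cosets of `B` in a coset of a minimal parabolic subgroup, is zero
(`isCycle_of_mem`). Let `U` be the unipotent radical of `B` and let `ψ` be a character of `U` that
factors through one simple root coordinate. Weighted summation of the translates of `e` over `U`
gives `whitElt`. For `y` in `I` the panel relations express the `ψ`-weighted `U`-sums of `y` at all
Weyl representatives by the single value `S(y)` at the longest element, and `f(whitElt, y) = ± c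
S(y)` with an integer `c` (`pairing_whitElt`). This `c` is `|G:B|` if `ψ = 1` and `|G:B| / (q + 1)`
otherwise (`whitIndex_one`, `whitIndex_mul`).

Since `q ≡ 1 mod 4`, the number `q + 1` is twice an odd number. So `whitElt` lies in `I(κ)` for `ψ =
1` and in `I(κ - 1)` for `ψ ≠ 1`, and for `ψ ≠ 1` the sum `S` is zero modulo `2` on `I(κ)`. On the
reduction of `whitElt` the sum for `ψ⁻¹` is `|U|`, which is odd; hence this reduction is not in the
next term (`ofFun_mem_gowFiltration`).

On the other side, the Weil representation is realized by matrices over `R` (`exists_isWeil`). After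
reduction to characteristic `2` its entry at `(0, 0)` is a linear character, hence `1` because `G`
is perfect (`hom_eq_one`). It follows that the matrix coefficients `g ↦ Q(g)_{w,0}` are right
`B`-invariant. The coefficient for the last basis vector `w` is the reduction of `whitElt` for the
long simple root, and the constant function `1` is that of `whitElt` for `ψ = 1`. The span of the
coefficients with `w ≠ 0` therefore lies in the upper term, and modulo constants, which lie in the
lower term, it receives an equivariant map from the odd part of the contragredient of `Q`
(`embedsInLayer_odd`).

The odd part is irreducible: the Siegel radical acts diagonally with distinct characters, which the
Levi subgroup permutes transitively. These characters also distinguish the two types, which differ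
by a nonsquare. Irreducibility makes reductions unique (`nonempty_equiv_of_complex`), and rescaling
`N` identifies Weil representations whose types differ by a square, so two modules remain. -/

theorem transpose_blocks_eq (g : Sp n K) :
    g.1.toBlocks₁₁ᵀ * g.1.toBlocks₂₁ = g.1.toBlocks₂₁ᵀ * g.1.toBlocks₁₁ ∧
    g.1.toBlocks₁₁ᵀ * g.1.toBlocks₂₂ - g.1.toBlocks₂₁ᵀ * g.1.toBlocks₁₂ = 1 ∧
    g.1.toBlocks₁₂ᵀ * g.1.toBlocks₂₂ = g.1.toBlocks₂₂ᵀ * g.1.toBlocks₁₂ := by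
  have h := SymplecticGroup.mem_iff'.1 g.2
  rw [← fromBlocks_toBlocks g.1, J, fromBlocks_transpose, fromBlocks_multiply,
    fromBlocks_multiply, fromBlocks_inj] at h
  simp only [Matrix.mul_zero, Matrix.mul_one, zero_add, Matrix.mul_neg, add_zero, Matrix.neg_mul] at h
  obtain ⟨h1, h2, -, h4⟩ := h
  rw [← sub_eq_add_neg, sub_eq_zero] at h1 h4
  refine ⟨h1.symm, ?_, h4.symm⟩
  rw [← neg_inj, ← h2]; abel

/-- The image of `GL_n` in `Sp_{2n}`, acting on the span of the `u_i` in the natural way. -/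
def levi : GL (Fin n) K →* Sp n K where
  toFun A := ⟨fromBlocks A.1 0 0 ((A⁻¹ : GL (Fin n) K).1)ᵀ, by
    have h : A.1 * (A⁻¹ : GL (Fin n) K).1 = 1 := A.mul_inv
    rw [SymplecticGroup.mem_iff, J, fromBlocks_transpose, fromBlocks_multiply,
      fromBlocks_multiply]
    simp only [transpose_transpose, Matrix.mul_zero, Matrix.mul_one, Matrix.mul_neg,
      Matrix.neg_mul, zero_add, add_zero, Matrix.zero_mul, transpose_zero, neg_zero, h]
    rw [← transpose_mul, h, transpose_one]⟩
  map_one' := by ext1; simp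
  map_mul' A B := by
    ext1
    simp [fromBlocks_multiply, transpose_mul]

/-- The element `(1, S; 0, 1)` of the unipotent radical of the Siegel parabolic subgroup. -/
def unip (S : Matrix (Fin n) (Fin n) K) (hS : Sᵀ = S) : Sp n K :=
  ⟨fromBlocks 1 S 0 1, by
    rw [SymplecticGroup.mem_iff, J, fromBlocks_transpose, fromBlocks_multiply,
      fromBlocks_multiply]
    simp [hS]⟩

@[simp] theorem coe_levi (A : GL (Fin n) K) :
    (levi A).1 = fromBlocks A.1 0 0 ((A⁻¹ : GL (Fin n) K).1)ᵀ := rfl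

@[simp] theorem coe_unip (S : Matrix (Fin n) (Fin n) K) (hS : Sᵀ = S) :
    (unip S hS).1 = fromBlocks 1 S 0 1 := rfl

theorem exists_levi_mul_unip (g : Sp n K) (hg : g.1.toBlocks₂₁ = 0) :
    ∃ A S hS, g = levi A * unip S hS := by
  obtain ⟨-, h2, h3⟩ := transpose_blocks_eq g
  rw [hg] at h2
  have h2' : g.1.toBlocks₂₂ᵀ * g.1.toBlocks₁₁ = 1 := by
    have := congrArg transpose h2
    simpa [transpose_mul] using this
  have h2'' := mul_eq_one_comm.1 h2'
  set A := g.1.toBlocks₁₁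
  set D := g.1.toBlocks₂₂
  set X := g.1.toBlocks₁₂
  refine ⟨⟨A, Dᵀ, h2'', h2'⟩, Dᵀ * X, ?_, ?_⟩
  · rw [transpose_mul, transpose_transpose, h3]
  · ext1
    rw [← fromBlocks_toBlocks g.1]
    simp only [Submonoid.coe_mul, coe_levi, coe_unip, fromBlocks_multiply, hg, Units.inv_mk]
    simp [A, D, X, ← Matrix.mul_assoc, h2'']

/-- The product of the groups `SL_2` acting on the planes spanned by `u_i` and `v_i`. -/
def diagElt : (Fin n → SpecialLinearGroup (Fin 2) K) →* Sp n K where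
  toFun M := ⟨fromBlocks (diagonal fun i => (M i).1 0 0) (diagonal fun i => (M i).1 0 1)
      (diagonal fun i => (M i).1 1 0) (diagonal fun i => (M i).1 1 1), by
    have h : ∀ i, (M i).1 0 0 * (M i).1 1 1 - (M i).1 0 1 * (M i).1 1 0 = 1 := fun i => by
      rw [← det_fin_two]; exact (M i).2
    rw [SymplecticGroup.mem_iff, J, fromBlocks_transpose, fromBlocks_multiply,
      fromBlocks_multiply, fromBlocks_inj]
    simp only [diagonal_transpose, Matrix.mul_zero, Matrix.mul_one, Matrix.mul_neg, zero_add,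
      add_zero, Matrix.neg_mul, diagonal_mul_diagonal]
    refine ⟨?_, ?_, ?_, ?_⟩ <;> ext i j <;> rcases eq_or_ne i j with rfl | hij <;>
      simp [*] <;> first | linear_combination h i | linear_combination -h i | ring⟩
  map_one' := by
    ext1
    simp
  map_mul' M M' := by
    have h : ∀ i, (M i * M' i).1 = (M i).1 * (M' i).1 := fun _ => rfl
    ext1
    simp only [Submonoid.coe_mul, fromBlocks_multiply, diagonal_mul_diagonal, diagonal_add,
      Pi.mul_apply, h, Matrix.mul_apply, Fin.sum_univ_two]

theorem coe_diagElt (M : Fin n → SpecialLinearGroup (Fin 2) K) :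
    (diagElt M).1 = fromBlocks (diagonal fun i => (M i).1 0 0) (diagonal fun i => (M i).1 0 1)
      (diagonal fun i => (M i).1 1 0) (diagonal fun i => (M i).1 1 1) := rfl

/-- The matrix `(0, -1; 1, 0)`. -/
def sl2Flip (K : Type*) [Field K] : SpecialLinearGroup (Fin 2) K :=
  ⟨!![0, -1; 1, 0], by simp⟩

theorem coe_sl2Flip : (sl2Flip K).1 = !![0, -1; 1, 0] := rfl

theorem diagElt_mulSingle_flip (j : Fin n) :
    diagElt (Pi.mulSingle j (sl2Flip K)) = flipElt K j := by
  ext1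
  rw [coe_diagElt]
  simp only [flipElt]
  rw [fromBlocks_inj]
  refine ⟨?_, ?_, ?_, ?_⟩ <;> ext i k <;> rcases eq_or_ne i j with rfl | h <;>
    rcases eq_or_ne i k with rfl | h' <;> simp [coe_sl2Flip, single_apply, *] <;> simp_all [eq_comm]

/-- The product of the `flipElt K j` for `j ∈ s`. -/
def flipSet (K : Type*) [Field K] (s : Finset (Fin n)) : Sp n K :=
  diagElt fun i => if i ∈ s then sl2Flip K else 1

theorem coe_flipSet (s : Finset (Fin n)) : (flipSet K s).1 =
    fromBlocks (diagonal fun i => if i ∈ s then 0 else 1) (diagonal fun i => if i ∈ s then -1 else 0)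
    (diagonal fun i => if i ∈ s then 1 else 0) (diagonal fun i => if i ∈ s then 0 else 1) := by
  rw [flipSet, coe_diagElt]
  congr 2 <;> funext i <;> by_cases h : i ∈ s <;> simp [coe_sl2Flip, h]

theorem flipSet_mem {S : Subgroup (Sp n K)} (hf : ∀ j, flipElt K j ∈ S) (s : Finset (Fin n)) :
    flipSet K s ∈ S := by
  refine Subgroup.mem_comap.1 (Subgroup.pi_mem_of_mulSingle_mem (H := S.comap diagElt) _ fun j => ?_)
  rw [Subgroup.mem_comap]
  split_ifs
  · rw [diagElt_mulSingle_flip]; exact hf j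
  · simp

theorem coe_flipSet_univ : (flipSet K (Finset.univ : Finset (Fin n))).1 = fromBlocks 0 (-1) 1 0 := by
  rw [coe_flipSet]
  simp [← diagonal_one, ← diagonal_neg]

/-- Flip the coordinates outside a set `b` of rows of the upper left block `A` that form a basis of
its row space. For `x` in the kernel of the new block, `A x` vanishes on `b`, hence everywhere, and
`C x` vanishes off `b`. Symmetry of `Aᵀ C` gives `Aᵀ C x = 0`, a relation between the independent
rows in `b`, so `C x = 0` and `g` kills `(x, 0)`. -/
theorem exists_flipSet_mul_det_ne_zero (g : Sp n K) :
    ∃ s : Finset (Fin n), ((flipSet K s * g).1.toBlocks₁₁).det ≠ 0 := by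
  classical
  obtain ⟨h1, -, -⟩ := transpose_blocks_eq g
  set A := g.1.toBlocks₁₁ with hA
  set C := g.1.toBlocks₂₁ with hC
  obtain ⟨b, -, -, hspan, hli⟩ := exists_linearIndepOn_extension (K := K) (v := A.row)
    (linearIndepOn_empty K A.row) (Set.empty_subset Set.univ)
  refine ⟨Finset.univ.filter (· ∉ b), fun hdet => ?_⟩
  obtain ⟨x, hx0, hx⟩ := exists_mulVec_eq_zero_iff.2 hdet
  have hblock : ((flipSet K (Finset.univ.filter (· ∉ b)) * g).1.toBlocks₁₁) =
      diagonal (fun i => if i ∈ b then 1 else 0) * A - diagonal (fun i => if i ∈ b then 0 else 1) * C := by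
    have : (flipSet K (Finset.univ.filter (· ∉ b)) * g).1 =
      (flipSet K (Finset.univ.filter (· ∉ b))).1 * fromBlocks A g.1.toBlocks₁₂ C g.1.toBlocks₂₂ := by
      rw [hA, hC, fromBlocks_toBlocks]; rfl
    rw [this, coe_flipSet, fromBlocks_multiply, toBlocks_fromBlocks₁₁]
    ext i j
    by_cases hi : i ∈ b <;> simp [hi, diagonal_mul]
  rw [hblock] at hx
  have hrow : ∀ i, (if i ∈ b then (1 : K) else 0) * (A *ᵥ x) i -
      (if i ∈ b then 0 else 1) * (C *ᵥ x) i = 0 := by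
    intro i
    have := congrFun hx i
    simpa [sub_mulVec, ← mulVec_mulVec, mulVec_diagonal] using this
  have hAb : ∀ i ∈ b, (A *ᵥ x) i = 0 := fun i hi => by simpa [hi] using hrow i
  have hCb : ∀ i ∉ b, (C *ᵥ x) i = 0 := fun i hi => by simpa [hi] using hrow i
  have hAx : A *ᵥ x = 0 := by
    funext i
    have hi : A.row i ∈ Submodule.span K (A.row '' b) := hspan ⟨i, trivial, rfl⟩
    have : ∀ y ∈ Submodule.span K (A.row '' b), y ⬝ᵥ x = 0 := by
      intro y hy
      induction hy using Submodule.span_induction with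
      | mem y hy => obtain ⟨k, hk, rfl⟩ := hy; exact hAb k hk
      | zero => simp
      | add y z _ _ hy hz => rw [add_dotProduct, hy, hz, add_zero]
      | smul c y _ hy => rw [smul_dotProduct, hy, smul_zero]
    exact this _ hi
  have hAC : Aᵀ *ᵥ (C *ᵥ x) = 0 := by
    rw [mulVec_mulVec, h1, ← mulVec_mulVec, hAx, mulVec_zero]
  have hCx : C *ᵥ x = 0 := by
    have hsum : ∑ i ∈ Finset.univ.filter (· ∈ b), (C *ᵥ x) i • A.row i = 0 := by
      rw [Finset.sum_filter_of_ne (p := (· ∈ b))]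
      · funext j
        have := congrFun hAC j
        simp only [mulVec, dotProduct, transpose_apply, Pi.zero_apply] at this
        simp only [Finset.sum_apply, Pi.smul_apply, smul_eq_mul, Pi.zero_apply]
        rw [← this]
        exact Finset.sum_congr rfl fun i _ => by rw [mul_comm]; rfl
      · intro i _ hne
        by_contra hi
        exact hne (by rw [hCb i hi, zero_smul])
    have hli' := linearIndepOn_iff'.1 hli (Finset.univ.filter (· ∈ b)) (fun i => (C *ᵥ x) i)
      (by intro i; simp) hsum
    funext i
    by_cases hi : i ∈ b
    · exact hli' i (by simp [hi])
    · exact hCb i hi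
  have hgx : g.1 *ᵥ Sum.elim x 0 = 0 := by
    conv_lhs => rw [← fromBlocks_toBlocks g.1]
    rw [fromBlocks_mulVec]
    simp [← hA, ← hC, hAx, hCx]
  have : Sum.elim x (0 : Fin n → K) = 0 := by
    have hinv : (g⁻¹ : Sp n K).1 * g.1 = 1 := by
      have : (g⁻¹ * g : Sp n K).1 = 1 := by simp
      exact this
    rw [← one_mulVec (Sum.elim x (0 : Fin n → K)), ← hinv, ← mulVec_mulVec, hgx, mulVec_zero]
  exact hx0 (funext fun i => congrFun this (Sum.inl i))

/-- The transvection `1 + c E_{ij}` as an element of `GL_n`. -/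
def glTransv (i j : Fin n) (h : i ≠ j) (c : K) : GL (Fin n) K :=
  ⟨transvection i j c, transvection i j (-c), by rw [transvection_mul_transvection_same _ _ h]; simp,
    by rw [transvection_mul_transvection_same _ _ h]; simp⟩

/-- An invertible diagonal matrix as an element of `GL_n`. -/
def glDiag : (Fin n → Kˣ) →* GL (Fin n) K where
  toFun d := ⟨diagonal fun i => (d i : K), diagonal fun i => ((d i)⁻¹ : Kˣ), by simp, by simp⟩
  map_one' := by ext1; simp
  map_mul' d d' := by ext1; simp

@[simp] theorem coe_glTransv (i j : Fin n) (h : i ≠ j) (c : K) :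
    (glTransv i j h c).1 = transvection i j c := rfl

@[simp] theorem coe_glDiag (d : Fin n → Kˣ) : (glDiag d).1 = diagonal fun i => (d i : K) := rfl

/-- The longest element of the Weyl group. -/
abbrev longElt (n : ℕ) (K : Type*) [Field K] : Sp n K := flipSet K Finset.univ

theorem coe_longElt_inv : ((longElt n K)⁻¹).1 = fromBlocks 0 1 (-1) 0 := by
  rw [coe_inv_fromBlocks, coe_flipSet_univ]
  simp

/-- Conjugation by the longest element turns upper transvections into lower ones, which yields the
whole Levi subgroup, and the Siegel radical into its opposite. Once flips have made the upper left
block invertible, the opposite radical clears the lower left block. -/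
theorem mem_of_forall_generators (S : Subgroup (Sp n K)) (hQ : ∀ X hX, unip X hX ∈ S)
    (hT : ∀ i j (h : i < j) c, levi (glTransv i j h.ne c) ∈ S)
    (hD : ∀ d : Fin n → Kˣ, levi (glDiag d) ∈ S) (hf : ∀ j, flipElt K j ∈ S) (g : Sp n K) :
    g ∈ S := by
  have hw : longElt n K ∈ S := flipSet_mem hf _
  have hlow : ∀ i j (h : i ≠ j) c, levi (glTransv i j h c) ∈ S := by
    intro i j h c
    rcases lt_or_gt_of_ne h with h' | h'
    · exact hT i j h' c
    · have : levi (glTransv i j h c) =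
          longElt n K * levi (glTransv j i h.symm (-c)) * (longElt n K)⁻¹ := by
        ext1
        simp only [Submonoid.coe_mul]
        rw [coe_longElt_inv, coe_flipSet_univ, coe_levi, coe_levi, fromBlocks_multiply,
          fromBlocks_multiply]
        simp [glTransv, transvection]
      rw [this]
      exact mul_mem (mul_mem hw (hT _ _ h' _)) (inv_mem hw)
  have hL : ∀ A : GL (Fin n) K, levi A ∈ S := by
    intro A
    have key : ∀ h : IsUnit A.1, levi h.unit ∈ S := by
      refine diagonal_transvection_induction_of_det_ne_zero
        (fun M => ∀ h : IsUnit M, levi h.unit ∈ S) A.1 ?_ ?_ ?_ ?_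
      · exact ((isUnit_iff_isUnit_det _).1 A.isUnit).ne_zero
      · intro D hD0 h
        rw [det_diagonal, Finset.prod_ne_zero_iff] at hD0
        have : h.unit = glDiag fun i => Units.mk0 (D i) (hD0 i (Finset.mem_univ i)) := by
          ext1; simp
        rw [this]; exact hD _
      · intro t h
        have : h.unit = glTransv t.i t.j t.hij t.c := by
          ext1; simp [TransvectionStruct.toMatrix]
        rw [this]; exact hlow _ _ _ _
      · intro A B hA hB ihA ihB h
        have hA' : IsUnit A := (isUnit_iff_isUnit_det _).2 (isUnit_iff_ne_zero.2 hA)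
        have hB' : IsUnit B := (isUnit_iff_isUnit_det _).2 (isUnit_iff_ne_zero.2 hB)
        have : h.unit = hA'.unit * hB'.unit := by ext1; simp
        rw [this, map_mul]
        exact mul_mem (ihA _) (ihB _)
    have : A.isUnit.unit = A := by ext1; rfl
    rw [← this]
    exact key _
  obtain ⟨s, hs⟩ := exists_flipSet_mul_det_ne_zero g
  refine (Subgroup.mul_mem_cancel_left S (flipSet_mem hf s)).1 ?_
  generalize flipSet K s * g = g at hs
  set A := g.1.toBlocks₁₁ with hA
  set C := g.1.toBlocks₂₁ with hC
  have hAu : IsUnit A.det := isUnit_iff_ne_zero.2 hs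
  have hsym : (C * A⁻¹)ᵀ = C * A⁻¹ := by
    have h1 : Aᵀ * C = Cᵀ * A := (transpose_blocks_eq g).1
    rw [transpose_mul, transpose_nonsing_inv]
    have hAt : IsUnit Aᵀ.det := by rwa [det_transpose]
    calc Aᵀ⁻¹ * Cᵀ = Aᵀ⁻¹ * (Cᵀ * A) * A⁻¹ := by
          rw [Matrix.mul_assoc, Matrix.mul_assoc, mul_nonsing_inv _ hAu, Matrix.mul_one]
      _ = C * A⁻¹ := by rw [← h1, ← Matrix.mul_assoc, nonsing_inv_mul _ hAt, Matrix.one_mul]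
  -- This conjugate is `(1, 0; -C A⁻¹, 1)`.
  have hl : longElt n K * unip (C * A⁻¹) hsym * (longElt n K)⁻¹ ∈ S :=
    mul_mem (mul_mem hw (hQ _ _)) (inv_mem hw)
  refine (Subgroup.mul_mem_cancel_left S hl).1 ?_
  obtain ⟨A', X, hX, h⟩ := exists_levi_mul_unip
    (longElt n K * unip (C * A⁻¹) hsym * (longElt n K)⁻¹ * g) (by
      have : (longElt n K * unip (C * A⁻¹) hsym * (longElt n K)⁻¹ * g).1 =
          (longElt n K).1 * (unip (C * A⁻¹) hsym).1 * ((longElt n K)⁻¹).1 *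
            fromBlocks A g.1.toBlocks₁₂ C g.1.toBlocks₂₂ := by
        rw [show fromBlocks A g.1.toBlocks₁₂ C g.1.toBlocks₂₂ = g.1 from fromBlocks_toBlocks _]; rfl
      rw [this, coe_longElt_inv, coe_flipSet_univ, coe_unip, fromBlocks_multiply,
        fromBlocks_multiply, fromBlocks_multiply, toBlocks_fromBlocks₂₁]
      simp [Matrix.mul_assoc, nonsing_inv_mul _ hAu])
  rw [h]
  exact mul_mem (hL _) (hQ _ _)

/-! ### The symplectic group is perfect -/

theorem exists_unit_sq_ne_one [Finite K] (hq : 3 < Nat.card K) : ∃ c : Kˣ, (c : K) ^ 2 ≠ 1 := by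
  by_contra! h
  have hf : Fintype K := Fintype.ofFinite K
  classical
  have hsub : (Finset.univ : Finset K) ⊆ {0, 1, -1} := by
    intro x _
    by_cases hx : x = 0
    · simp [hx]
    · have := h (Units.mk0 x hx)
      have h2 : (x - 1) * (x + 1) = 0 := by
        simp only [Units.val_mk0] at this
        linear_combination this
      rcases mul_eq_zero.1 h2 with h | h
      · simp [sub_eq_zero.1 h]
      · simp [eq_neg_of_add_eq_zero_left h]
  have := (Finset.card_le_card hsub).trans Finset.card_le_three
  rw [Finset.card_univ, ← Nat.card_eq_fintype_card] at this
  omega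

/-- Upper unipotent elements of `SL_2`. -/
def sl2Up (t : K) : SpecialLinearGroup (Fin 2) K := ⟨!![1, t; 0, 1], by simp⟩

/-- Lower unipotent elements of `SL_2`. -/
def sl2Low (t : K) : SpecialLinearGroup (Fin 2) K := ⟨!![1, 0; t, 1], by simp⟩

/-- Diagonal elements of `SL_2`. -/
def sl2Diag (c : Kˣ) : SpecialLinearGroup (Fin 2) K := ⟨!![(c : K), 0; 0, (c⁻¹ : Kˣ)], by simp⟩

theorem coe_sl2Up (t : K) : (sl2Up t).1 = !![1, t; 0, 1] := rfl

theorem coe_sl2Low (t : K) : (sl2Low t).1 = !![1, 0; t, 1] := rfl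

theorem coe_sl2Diag (c : Kˣ) : (sl2Diag c).1 = !![(c : K), 0; 0, (c⁻¹ : Kˣ)] := rfl

theorem sl2Low_eq (t : K) : sl2Low t = sl2Flip K * sl2Up (-t) * (sl2Flip K)⁻¹ := by
  rw [eq_mul_inv_iff_mul_eq]
  apply Subtype.ext
  change (sl2Low t).1 * (sl2Flip K).1 = (sl2Flip K).1 * (sl2Up (-t)).1
  simp [coe_sl2Flip, coe_sl2Up, coe_sl2Low]

theorem sl2Flip_eq : sl2Flip K = sl2Up (-1) * sl2Low 1 * sl2Up (-1) := by
  apply Subtype.ext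
  change (sl2Flip K).1 = (sl2Up (-1)).1 * (sl2Low 1).1 * (sl2Up (-1)).1
  simp [coe_sl2Flip, coe_sl2Up, coe_sl2Low]

theorem sl2Diag_eq (c : Kˣ) :
    sl2Diag c = sl2Up (c : K) * sl2Low (-(c⁻¹ : Kˣ) : K) * sl2Up (c : K) * sl2Flip K := by
  apply Subtype.ext
  change (sl2Diag c).1 = (sl2Up (c : K)).1 * (sl2Low (-(c⁻¹ : Kˣ) : K)).1 * (sl2Up (c : K)).1 *
    (sl2Flip K).1
  simp [coe_sl2Flip, coe_sl2Up, coe_sl2Low, coe_sl2Diag]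

theorem diagElt_sl2Diag (d : Fin n → Kˣ) :
    diagElt (fun i => sl2Diag (d i)) = levi (glDiag d) := by
  ext1
  rw [coe_levi, ← map_inv, coe_diagElt, coe_glDiag, coe_glDiag]
  simp [coe_sl2Diag]

theorem glDiag_mul_glTransv (i j : Fin n) (h : i ≠ j) (c : Kˣ) (t : K) :
    glDiag (Pi.mulSingle i c) * glTransv i j h t * (glDiag (Pi.mulSingle i c))⁻¹ =
      glTransv i j h (((c : K) - 1) * t) * glTransv i j h t := by
  rw [mul_inv_eq_iff_eq_mul]
  ext1
  simp only [Units.val_mul, coe_glTransv, coe_glDiag, transvection_mul_transvection_same _ _ h]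
  ext k l
  rcases eq_or_ne k i with rfl | hk <;> rcases eq_or_ne l j with rfl | hl <;>
    simp [transvection, single_apply, diagonal_mul, mul_diagonal, one_apply, *, h.symm, add_mul, mul_add]
  · ring
  · rcases eq_or_ne k l with rfl | hkl <;> simp [*, hl.symm]
  · simp [hk.symm]
  · rcases eq_or_ne k l with rfl | hkl <;> simp [*, hl.symm]

/-- Torus elements built from a unit `c` with `c² ≠ 1` make the elements of the Siegel radical and
the transvections commutators; inside the copies of `SL₂` the flips and the torus are products of
root elements. Such a unit exists only if `q > 3`. -/
theorem hom_eq_one [Finite K] (hq : 3 < Nat.card K) {A : Type*} [CommGroup A]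
    (χ : Sp n K →* A) (g : Sp n K) : χ g = 1 := by
  have conj : ∀ x y : Sp n K, χ (x * y * x⁻¹) = χ y := fun x y => by simp
  obtain ⟨c, hc⟩ := exists_unit_sq_ne_one hq
  have hQ : ∀ X hX, χ (unip X hX) = 1 := by
    intro X hX
    have hc' : (c : K) ^ 2 - 1 ≠ 0 := sub_ne_zero.2 hc
    have hY : (((c : K) ^ 2 - 1)⁻¹ • X)ᵀ = ((c : K) ^ 2 - 1)⁻¹ • X := by rw [transpose_smul, hX]
    -- Conjugation by the scalar `c` multiplies the symmetric matrix by `c²`, whence the factor `(c²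
    -- - 1)⁻¹`.
    have : unip X hX = levi (glDiag fun _ => c) * unip (((c : K) ^ 2 - 1)⁻¹ • X) hY *
        (levi (glDiag fun _ => c))⁻¹ * (unip (((c : K) ^ 2 - 1)⁻¹ • X) hY)⁻¹ := by
      rw [eq_mul_inv_iff_mul_eq, eq_mul_inv_iff_mul_eq]
      ext1
      have hcc : c • c • X = ((c : K) ^ 2) • X := by rw [smul_smul, sq]; rfl
      simp only [Submonoid.coe_mul, coe_levi, coe_unip, fromBlocks_multiply, ← map_inv, coe_glDiag]
      rw [fromBlocks_inj]
      refine ⟨by simp, ?_, by simp, by simp⟩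
      ext i j
      simp [diagonal_mul]
      field_simp
      ring
    rw [this, map_mul, conj, map_inv, mul_inv_cancel]
  have hup : ∀ (j : Fin n) (t : K), χ (diagElt (Pi.mulSingle j (sl2Up t))) = 1 := by
    intro j t
    rw [← hQ (diagonal (Pi.single j t)) (diagonal_transpose _)]
    congr 1
    ext1
    rw [coe_diagElt, coe_unip]
    rw [fromBlocks_inj]
    refine ⟨?_, ?_, ?_, ?_⟩ <;> ext i k <;> rcases eq_or_ne i j with rfl | h <;>
      rcases eq_or_ne i k with rfl | h' <;> simp [coe_sl2Up, *]
  have hlow : ∀ (j : Fin n) (t : K), χ (diagElt (Pi.mulSingle j (sl2Low t))) = 1 := by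
    intro j t
    rw [sl2Low_eq, Pi.mulSingle_mul, Pi.mulSingle_mul, Pi.mulSingle_inv, map_mul diagElt,
      map_mul diagElt, map_inv diagElt, conj, hup]
  have hf : ∀ j : Fin n, χ (diagElt (Pi.mulSingle j (sl2Flip K))) = 1 := by
    intro j
    rw [sl2Flip_eq, Pi.mulSingle_mul, Pi.mulSingle_mul, map_mul, map_mul,
      map_mul, map_mul, hlow, hup, one_mul, one_mul]
  refine mem_of_forall_generators χ.ker hQ ?_ ?_ (fun j => ?_) g
  · intro i j h t
    have hc' : (c : K) - 1 ≠ 0 := fun h0 => hc (by rw [sub_eq_zero.1 h0, one_pow])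
    have := congrArg (fun A => χ (levi A))
      (glDiag_mul_glTransv i j h.ne c (((c : K) - 1)⁻¹ * t))
    simp only [map_mul, map_inv, mul_inv_cancel_comm, mul_inv_cancel_left₀ hc'] at this
    exact (mul_eq_right.1 this.symm)
  · intro d
    rw [← diagElt_sl2Diag]
    refine Subgroup.mem_comap.1
      (Subgroup.pi_mem_of_mulSingle_mem (H := χ.ker.comap diagElt) _ fun j => ?_)
    rw [Subgroup.mem_comap, MonoidHom.mem_ker, sl2Diag_eq, Pi.mulSingle_mul, Pi.mulSingle_mul,
      Pi.mulSingle_mul]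
    simp only [map_mul, hup, hlow, hf, one_mul]
  · rw [MonoidHom.mem_ker, ← diagElt_mulSingle_flip, hf]

end Blocks

/-! ### Triangular matrices and monomial matrices -/

section Tri

variable {n : ℕ}

/-- The position of an index in the order `u_1, …, u_n, v_n, …, v_1`. -/
def rk (x : Fin n ⊕ Fin n) : ℕ := Sum.elim (fun i : Fin n => (i : ℕ)) (fun i => 2 * n - 1 - i) x

@[simp] theorem rk_inl (i : Fin n) : rk (Sum.inl i : Fin n ⊕ Fin n) = i := rfl

@[simp] theorem rk_inr (i : Fin n) : rk (Sum.inr i : Fin n ⊕ Fin n) = 2 * n - 1 - i := rfl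

theorem rk_lt (x : Fin n ⊕ Fin n) : rk x < 2 * n := by
  rcases x with i | i <;> simp <;> omega

theorem rk_swap (x : Fin n ⊕ Fin n) : rk x.swap = 2 * n - 1 - rk x := by
  rcases x with i | i <;> simp; omega

theorem rk_injective : Function.Injective (rk : Fin n ⊕ Fin n → ℕ) := by
  rintro (i | i) (j | j) h <;> simp only [rk_inl, rk_inr] at h
  · exact congrArg _ (Fin.ext h)
  · omega
  · omega
  · exact congrArg _ (Fin.ext (by omega))

variable {K : Type*} [Field K]

theorem inv_apply_swap (g : Sp n K) (x y : Fin n ⊕ Fin n) :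
    (g⁻¹).1 x y = g.1 y.swap x.swap ∨ (g⁻¹).1 x y = -g.1 y.swap x.swap := by
  rw [coe_inv_fromBlocks]
  rcases x with i | i <;> rcases y with j | j <;> simp [toBlocks₁₁, toBlocks₁₂, toBlocks₂₁, toBlocks₂₂]

/-- The lower right block `ᵗA⁻¹` is lower triangular, so it becomes upper triangular once the `v_i`
are listed in reverse order. -/
theorem mem_borel_iff (g : Sp n K) : g ∈ borel n K ↔ g.1.BlockTriangular rk := by
  constructor
  · intro hg
    have h1 : g.1.toBlocks₂₁ = 0 := hg.1
    have h2 : g.1.toBlocks₁₁.BlockTriangular id := hg.2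
    have h3 : ((g⁻¹).1.toBlocks₁₁).BlockTriangular id := ((borel n K).inv_mem hg).2
    rw [coe_inv_fromBlocks, toBlocks_fromBlocks₁₁] at h3
    rintro (i | i) (j | j) h <;> simp only [rk_inl, rk_inr] at h
    · exact h2 (show id j < id i from h)
    · omega
    · exact congrFun (congrFun h1 i) j
    · exact h3 (i := j) (j := i) (show i < j from Fin.lt_def.2 (by omega))
  · intro hg
    refine ⟨?_, ?_⟩
    · ext i j
      exact hg (i := Sum.inr i) (j := Sum.inl j) (by simp; omega)
    · intro i j h
      exact hg (i := Sum.inl i) (j := Sum.inl j) h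

theorem mul_inv_apply (g : Sp n K) : g.1 * (g⁻¹).1 = 1 := by
  have : (g * g⁻¹ : Sp n K).1 = 1 := by simp
  exact this

theorem borel_apply_self_ne_zero {g : Sp n K} (hg : g ∈ borel n K) (x : Fin n ⊕ Fin n) :
    g.1 x x ≠ 0 := by
  have h1 := (mem_borel_iff g).1 hg
  have h2 := (mem_borel_iff _).1 (inv_mem hg)
  have h := congrFun (congrFun (mul_inv_apply g) x) x
  rw [Matrix.mul_apply, Fintype.sum_eq_single x, one_apply_eq] at h
  · intro h0; rw [h0, zero_mul] at h; exact zero_ne_one h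
  · intro y hy
    rcases lt_or_gt_of_ne (fun e => hy (rk_injective e)) with h' | h'
    · rw [h1 h', zero_mul]
    · rw [h2 h', mul_zero]

/-- `g` is a monomial matrix with underlying permutation `σ`. -/
def Mono (g : Sp n K) (σ : Equiv.Perm (Fin n ⊕ Fin n)) : Prop := ∀ x y, x ≠ σ y → g.1 x y = 0

variable {g h : Sp n K} {σ τ : Equiv.Perm (Fin n ⊕ Fin n)}

theorem Mono.mul_apply (hg : Mono g σ) (M : Matrix (Fin n ⊕ Fin n) (Fin n ⊕ Fin n) K)
    (x y : Fin n ⊕ Fin n) : (g.1 * M) (σ x) y = g.1 (σ x) x * M x y := by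
  rw [Matrix.mul_apply, Fintype.sum_eq_single x]
  intro z hz
  rw [hg _ _ (fun e => hz (σ.injective e).symm), zero_mul]

theorem Mono.apply_mul (hg : Mono g σ) (M : Matrix (Fin n ⊕ Fin n) (Fin n ⊕ Fin n) K)
    (x y : Fin n ⊕ Fin n) : (M * g.1) x y = M x (σ y) * g.1 (σ y) y := by
  rw [Matrix.mul_apply, Fintype.sum_eq_single (σ y)]
  intro z hz
  rw [hg _ _ hz, mul_zero]

theorem Mono.apply_mul_inv_apply (hg : Mono g σ) (x : Fin n ⊕ Fin n) :
    g.1 (σ x) x * (g⁻¹).1 x (σ x) = 1 := by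
  rw [← hg.mul_apply, mul_inv_apply, one_apply_eq]

theorem Mono.ne_zero (hg : Mono g σ) (x : Fin n ⊕ Fin n) : g.1 (σ x) x ≠ 0 :=
  left_ne_zero_of_mul_eq_one (hg.apply_mul_inv_apply x)

theorem Mono.inv (hg : Mono g σ) : Mono g⁻¹ σ⁻¹ := by
  intro x y hxy
  have h := hg.mul_apply (g⁻¹).1 x y
  rw [mul_inv_apply, one_apply_ne (fun e => hxy (by rw [← e]; simp))] at h
  exact (mul_eq_zero.1 h.symm).resolve_left (hg.ne_zero x)

theorem Mono.mul (hg : Mono g σ) (hh : Mono h τ) : Mono (g * h) (σ * τ) := by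
  intro x y hxy
  rw [Submonoid.coe_mul, hh.apply_mul, hg _ _ (by simpa using hxy), zero_mul]

theorem Mono.one : Mono (1 : Sp n K) 1 := fun _ _ h => one_apply_ne h

theorem Mono.unique (hg : Mono g σ) (hg' : Mono g τ) : σ = τ := by
  ext1 x
  by_contra hne
  exact hg.ne_zero x (hg' _ _ hne)

theorem mono_one_iff : Mono g 1 ↔ g ∈ torus n K :=
  ⟨fun hg _ _ h => hg _ _ h, fun hg _ _ h => hg h⟩

theorem torus_le_borel : torus n K ≤ borel n K := fun g hg => (mem_borel_iff g).2
  fun x y h => hg (fun e => by rw [e] at h; exact lt_irrefl _ h)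

theorem Mono.conj_apply (hg : Mono g σ) (u : Sp n K) (x y : Fin n ⊕ Fin n) :
    (g * u * g⁻¹).1 (σ x) (σ y) = g.1 (σ x) x * u.1 x y * (g⁻¹).1 y (σ y) := by
  have := hg.inv.apply_mul (g.1 * u.1) (σ x) (σ y)
  rw [show σ⁻¹ (σ y) = y by simp, hg.mul_apply] at this
  exact this

/-- Triangularity shows that `σ⁻¹ τ` never raises the rank of an index; since a permutation
preserves the sum of the ranks, it is the identity. This is the disjointness of the Bruhat cells. -/
theorem Mono.eq_of_inv_mul_mem_borel (hg : Mono g σ) (hh : Mono h τ) {u : Sp n K}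
    (hu : u ∈ borel n K) (hm : g⁻¹ * u * h ∈ borel n K) : σ = τ := by
  have hle : ∀ y, rk ((σ⁻¹ * τ) y) ≤ rk y := by
    intro y
    by_contra! hlt
    have h0 := (mem_borel_iff _).1 hm hlt
    have e : (g⁻¹ * u * h).1 ((σ⁻¹ * τ) y) y =
        (g⁻¹).1 (σ⁻¹ (τ y)) (τ y) * u.1 (τ y) (τ y) * h.1 (τ y) y := by
      rw [Submonoid.coe_mul, hh.apply_mul, Submonoid.coe_mul]
      congr 1
      exact hg.inv.mul_apply u.1 (τ y) (τ y)
    rw [e] at h0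
    exact mul_ne_zero (mul_ne_zero (hg.inv.ne_zero _) (borel_apply_self_ne_zero hu _))
      (hh.ne_zero y) h0
  have hsum : ∑ y, rk ((σ⁻¹ * τ) y) = ∑ y : Fin n ⊕ Fin n, rk y := Equiv.sum_comp (σ⁻¹ * τ) rk
  have heq := (Finset.sum_eq_sum_iff_of_le (fun y _ => hle y)).1 hsum
  have : σ⁻¹ * τ = 1 := by
    ext1 y
    exact rk_injective (heq y (Finset.mem_univ y))
  rw [← mul_one σ, ← this, mul_inv_cancel_left]

end Tri

/-! ### Unitriangular subgroups for varying orders of the indices -/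

section TriUni

variable {n : ℕ} {K : Type*} [Field K]

/-- The symplectic matrices which are triangular for `ρ` with diagonal blocks equal to `1`. -/
def triUni (K : Type*) [Field K] [Finite K] (ρ : Fin n ⊕ Fin n → ℕ) : Subgroup (Sp n K) :=
  let S : Submonoid (Sp n K) :=
    { carrier := {g | g.1.BlockTriangular ρ ∧ ∀ x y, ρ x = ρ y → g.1 x y = (1 : Matrix _ _ K) x y}
      one_mem' := ⟨blockTriangular_one, fun _ _ _ => rfl⟩
      mul_mem' := by
        rintro g h ⟨hg, hg'⟩ ⟨hh, hh'⟩
        refine ⟨hg.mul hh, fun x y hxy => ?_⟩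
        have : (1 : Matrix (Fin n ⊕ Fin n) (Fin n ⊕ Fin n) K) x y = (1 * 1 : Matrix _ _ K) x y := by
          rw [Matrix.one_mul]
        rw [this, Submonoid.coe_mul, Matrix.mul_apply, Matrix.mul_apply]
        refine Finset.sum_congr rfl fun z _ => ?_
        rcases lt_trichotomy (ρ z) (ρ x) with h | h | h
        · rw [hg h, one_apply_ne (fun e => h.ne (congrArg ρ e).symm), zero_mul, zero_mul]
        · rw [hg' x z h.symm, hh' z y (h.trans hxy)]
        · rw [hh (hxy ▸ h), one_apply_ne (fun e => h.ne (congrArg ρ e)), mul_zero, zero_mul] }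
  { S with
    inv_mem' := by
      intro g hg
      -- In a finite group inverses are powers, so closure under products suffices.
      have : g⁻¹ = g ^ (orderOf g - 1) := by
        rw [inv_eq_iff_mul_eq_one, ← pow_succ', Nat.sub_add_cancel (orderOf_pos g), pow_orderOf_eq_one]
      rw [this]
      exact S.pow_mem hg _ }

variable [Finite K]

theorem triUni_rk_le : triUni K (rk (n := n)) ≤ borel n K := fun g hg => (mem_borel_iff g).2 hg.1

/-- No index lies strictly between consecutive positions, so only the two ends contribute to the
product. This additivity is the source of the characters of `U` attached to simple roots. -/
theorem mul_apply_of_succ {ρ : Fin n ⊕ Fin n → ℕ} (hρ : Function.Injective ρ) {c d : Fin n ⊕ Fin n}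
    (hcd : ρ d = ρ c + 1) {u v : Sp n K} (hu : u ∈ triUni K ρ) (hv : v ∈ triUni K ρ) :
    (u * v).1 c d = u.1 c d + v.1 c d := by
  have hne : c ≠ d := fun e => by rw [e] at hcd; omega
  rw [Submonoid.coe_mul, Matrix.mul_apply, Fintype.sum_eq_add c d hne]
  · rw [hu.2 c c rfl, hv.2 d d rfl, one_apply_eq, one_apply_eq]; ring
  · rintro z ⟨hzc, hzd⟩
    have h1 : ρ z ≠ ρ c := fun e => hzc (hρ e)
    have h2 : ρ z ≠ ρ d := fun e => hzd (hρ e)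
    rcases lt_or_ge (ρ z) (ρ c) with h | h
    · rw [hu.1 h, zero_mul]
    · rw [hv.1 (show ρ d < ρ z by omega), mul_zero]

variable {g : Sp n K} {σ : Equiv.Perm (Fin n ⊕ Fin n)}

theorem Mono.conj_mem_triUni (hg : Mono g σ) {ρ : Fin n ⊕ Fin n → ℕ} {u : Sp n K}
    (hu : u ∈ triUni K (ρ ∘ σ)) : g * u * g⁻¹ ∈ triUni K ρ := by
  constructor
  · intro x y hxy
    obtain ⟨x, rfl⟩ := σ.surjective x
    obtain ⟨y, rfl⟩ := σ.surjective y
    rw [hg.conj_apply, hu.1 hxy, mul_zero, zero_mul]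
  · intro x y hxy
    obtain ⟨x, rfl⟩ := σ.surjective x
    obtain ⟨y, rfl⟩ := σ.surjective y
    rw [hg.conj_apply, hu.2 _ _ hxy]
    rcases eq_or_ne x y with rfl | hne
    · rw [one_apply_eq, one_apply_eq, mul_one, hg.apply_mul_inv_apply]
    · rw [one_apply_ne hne, one_apply_ne (fun e => hne (σ.injective e)), mul_zero, zero_mul]

theorem Mono.inv_conj_mem_triUni (hg : Mono g σ) {ρ : Fin n ⊕ Fin n → ℕ} {u : Sp n K}
    (hu : u ∈ triUni K ρ) : g⁻¹ * u * g ∈ triUni K (ρ ∘ σ) := by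
  have := hg.inv.conj_mem_triUni (ρ := ρ ∘ σ) (u := u) (by
    convert hu using 2; funext x; simp)
  simpa using this

theorem Mono.mem_triUni_of_inv_conj_mem_borel (hg : Mono g σ) {u : Sp n K}
    (hu : u ∈ triUni K (rk (n := n))) (h : g⁻¹ * u * g ∈ borel n K) :
    u ∈ triUni K (rk ∘ σ.symm) := by
  have h1 := (mem_borel_iff _).1 h
  have key : g⁻¹ * u * g ∈ triUni K rk := by
    refine ⟨h1, fun x y hxy => ?_⟩
    obtain rfl := rk_injective hxy
    exact (hg.inv_conj_mem_triUni hu).2 x x rfl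
  have := hg.conj_mem_triUni (ρ := rk ∘ σ.symm) (u := g⁻¹ * u * g) (by
    convert key using 2; funext x; simp)
  simpa [mul_assoc] using this

end TriUni

/-! ### Simple reflections and root elements -/

section Simple

variable {n : ℕ}

/-- The smaller index moved by the `i`-th simple reflection. -/
def lowIdx (i : Fin n) : Fin n ⊕ Fin n := Sum.inl i

/-- The successor of `lowIdx i` in the order of the indices. -/
def highIdx (i : Fin n) : Fin n ⊕ Fin n := if h : (i : ℕ) + 1 < n then Sum.inl ⟨i + 1, h⟩ else Sum.inr i

/-- The permutation of the indices underlying the `i`-th simple reflection. -/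
def simplePerm (i : Fin n) : Equiv.Perm (Fin n ⊕ Fin n) :=
  if h : (i : ℕ) + 1 < n then
    Equiv.sumCongr (Equiv.swap i ⟨i + 1, h⟩) (Equiv.swap i ⟨i + 1, h⟩)
  else Equiv.swap (Sum.inl i) (Sum.inr i)

@[simp] theorem rk_lowIdx (i : Fin n) : rk (lowIdx i) = i := rfl

@[simp] theorem rk_highIdx (i : Fin n) : rk (highIdx i) = i + 1 := by
  unfold highIdx
  split_ifs with h
  · rfl
  · rw [rk_inr]; omega

theorem rk_simplePerm (i : Fin n) (x : Fin n ⊕ Fin n) : rk (simplePerm i x) =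
    if rk x = i then (i : ℕ) + 1 else if rk x = i + 1 then (i : ℕ) else
    if rk x = 2 * n - 2 - i then 2 * n - 1 - i else
    if rk x = 2 * n - 1 - i then 2 * n - 2 - i else rk x := by
  unfold simplePerm
  have hi := i.2
  split_ifs with h
  all_goals rcases x with j | j
  all_goals
    have hj := j.2
    simp only [Equiv.sumCongr_apply, Sum.map_inl, Sum.map_inr, rk_inl, rk_inr,
      Equiv.swap_apply_def, Fin.ext_iff, Sum.inl.injEq, Sum.inr.injEq, reduceCtorEq, if_false] at *
  all_goals
    try split_ifs
  all_goals
    first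
      | omega
      | (simp only [rk_inl, rk_inr] at * <;> omega)

@[simp] theorem simplePerm_simplePerm (i : Fin n) (x : Fin n ⊕ Fin n) :
    simplePerm i (simplePerm i x) = x := by
  unfold simplePerm
  split_ifs with h
  · rcases x with j | j <;> simp
  · simp

@[simp] theorem simplePerm_mul_self (i : Fin n) : simplePerm i * simplePerm i = 1 := by
  ext1 x; simp

@[simp] theorem simplePerm_inv (i : Fin n) : (simplePerm i)⁻¹ = simplePerm i :=
  inv_eq_of_mul_eq_one_right (simplePerm_mul_self i)

@[simp] theorem simplePerm_lowIdx (i : Fin n) : simplePerm i (lowIdx i) = highIdx i :=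
  rk_injective (by rw [rk_simplePerm]; simp)

@[simp] theorem simplePerm_highIdx (i : Fin n) : simplePerm i (highIdx i) = lowIdx i := by
  rw [← simplePerm_lowIdx, simplePerm_simplePerm]

theorem lowIdx_ne_highIdx (i : Fin n) : lowIdx i ≠ highIdx i := fun h => by
  have := congrArg rk h
  simp at this

theorem simplePerm_swap (i : Fin n) (x : Fin n ⊕ Fin n) :
    simplePerm i x.swap = (simplePerm i x).swap := by
  apply rk_injective
  have hi := i.2
  have hx := rk_lt x
  rw [rk_swap, rk_simplePerm, rk_simplePerm, rk_swap]
  split_ifs <;> omega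

/-- A simple reflection reverses the order of only two pairs of indices. -/
theorem eq_of_rk_simplePerm_lt {i : Fin n} {x y : Fin n ⊕ Fin n} (h : rk x < rk y)
    (h' : rk (simplePerm i y) < rk (simplePerm i x)) :
    x = lowIdx i ∧ y = highIdx i ∨ x = (highIdx i).swap ∧ y = (lowIdx i).swap := by
  have hi := i.2
  have hx := rk_lt x
  have hy := rk_lt y
  rw [rk_simplePerm, rk_simplePerm] at h'
  have : rk x = rk (lowIdx i) ∧ rk y = rk (highIdx i) ∨
      rk x = rk (highIdx i).swap ∧ rk y = rk (lowIdx i).swap := by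
    rw [rk_swap, rk_swap, rk_lowIdx, rk_highIdx]
    split_ifs at h' <;> omega
  rcases this with ⟨h1, h2⟩ | ⟨h1, h2⟩
  · exact Or.inl ⟨rk_injective h1, rk_injective h2⟩
  · exact Or.inr ⟨rk_injective h1, rk_injective h2⟩

variable (K : Type*) [Field K]

/-- The `i`-th simple reflection. -/
def simpleElt (i : Fin n) : Sp n K :=
  if h : (i : ℕ) + 1 < n then swapElt K i ⟨i + 1, h⟩ else flipElt K i

variable {K}

/-- The root elements for the `i`-th simple root. -/
def rootElt (i : Fin n) (t : K) : Sp n K :=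
  if h : (i : ℕ) + 1 < n then levi (glTransv i ⟨i + 1, h⟩ (fun e => by simpa using congrArg Fin.val e) t)
  else unip (single i i t) (by simp)

theorem mono_simpleElt (i : Fin n) : Mono (simpleElt K i) (simplePerm i) := by
  unfold simpleElt simplePerm
  intro x y hxy
  split_ifs at hxy ⊢ with h
  · rcases x with j | j <;> rcases y with k | k <;> simp [swapElt, PEquiv.toMatrix_apply] at hxy ⊢ <;> 
      grind
  · rcases x with j | j <;> rcases y with k | k <;>
      simp [flipElt, single_apply, one_apply, Equiv.swap_apply_def] at hxy ⊢ <;> grind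

theorem rootElt_apply (i : Fin n) (t : K) (x y : Fin n ⊕ Fin n) : (rootElt i t).1 x y =
    if x = y then 1 else if x = lowIdx i ∧ y = highIdx i then t else
    if x = (highIdx i).swap ∧ y = (lowIdx i).swap then -t else 0 := by
  unfold rootElt lowIdx highIdx
  by_cases h : (i : ℕ) + 1 < n
  · simp only [h, dite_true, coe_levi, coe_glTransv]
    rcases x with j | j <;> rcases y with k | k <;>
      simp [transvection, glTransv, single_apply, one_apply]
    all_goals grind
  · simp only [h, dite_false, coe_unip]
    rcases x with j | j <;> rcases y with k | k <;>
      simp [single_apply, one_apply]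
    all_goals grind

theorem rootElt_mul_lowIdx (i : Fin n) (t : K) (h : Sp n K) (y : Fin n ⊕ Fin n) :
    (rootElt i t * h).1 (lowIdx i) y = h.1 (lowIdx i) y + t * h.1 (highIdx i) y := by
  have hne := lowIdx_ne_highIdx i
  rw [Submonoid.coe_mul, Matrix.mul_apply, Fintype.sum_eq_add _ _ hne]
  · rw [rootElt_apply, rootElt_apply, if_pos rfl, if_neg hne, if_pos ⟨rfl, rfl⟩, one_mul]
  · rintro z ⟨h1, h2⟩
    rw [rootElt_apply, if_neg h1.symm, if_neg (fun e => h2 e.2), if_neg, zero_mul]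
    rintro ⟨h3, h4⟩
    apply h2
    rw [h4, h3, Sum.swap_swap]

theorem rootElt_mul_highIdx (i : Fin n) (t : K) (h : Sp n K) (y : Fin n ⊕ Fin n) :
    (rootElt i t * h).1 (highIdx i) y = h.1 (highIdx i) y := by
  rw [Submonoid.coe_mul, Matrix.mul_apply, Fintype.sum_eq_single (highIdx i)]
  · rw [rootElt_apply, if_pos rfl, one_mul]
  · intro z hz
    rw [rootElt_apply, if_neg hz.symm, if_neg (fun e => lowIdx_ne_highIdx i e.1.symm), if_neg, zero_mul]
    rintro ⟨h3, -⟩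
    have := congrArg rk h3
    rw [rk_swap, rk_highIdx] at this
    omega

/-- The parabolic subgroup generated by the Borel subgroup and the `i`-th simple reflection. -/
def Para (i : Fin n) (g : Sp n K) : Prop := g.1.BlockTriangular fun x =>
  if rk x = i + 1 then (i : ℕ) else if rk x = 2 * n - 1 - i then 2 * n - 2 - i else rk x

theorem Para.mul {i : Fin n} {g h : Sp n K} (hg : Para i g) (hh : Para i h) : Para i (g * h) :=
  BlockTriangular.mul hg hh

theorem para_of_mem_borel (i : Fin n) {g : Sp n K} (hg : g ∈ borel n K) : Para i g := by
  intro x y h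
  have hi := i.2
  refine (mem_borel_iff g).1 hg ?_
  simp only at h
  split_ifs at h <;> omega

theorem para_of_mono (i : Fin n) {g : Sp n K} (hg : Mono g (simplePerm i)) : Para i g := by
  intro x y h
  refine hg _ _ ?_
  rintro rfl
  have hi := i.2
  simp only [rk_simplePerm] at h
  split_ifs at h <;> omega

theorem mono_simpleElt_inv (i : Fin n) : Mono (simpleElt K i)⁻¹ (simplePerm i) := by
  simpa using (mono_simpleElt (K := K) i).inv

/-- Only the columns of rank below `n` need to be tested, the lower right block being forced. In
these columns `highIdx i`, `lowIdx i` is the one position below the diagonal that `Para i` leaves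
free. -/
theorem mem_borel_of_para {i : Fin n} {g : Sp n K} (hg : Para i g)
    (h0 : g.1 (highIdx i) (lowIdx i) = 0) : g ∈ borel n K := by
  have key : ∀ x y : Fin n ⊕ Fin n, rk y < rk x → (rk y < n) → g.1 x y = 0 := by
    intro x y hlt hy
    have hi := i.2
    have hx := rk_lt x
    by_cases h : rk x = i + 1 ∧ rk y = i
    · obtain rfl : x = highIdx i := rk_injective (by rw [h.1, rk_highIdx])
      obtain rfl : y = lowIdx i := rk_injective (by rw [h.2, rk_lowIdx])
      exact h0
    · refine hg ?_
      simp only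
      split_ifs <;> omega
  refine ⟨?_, ?_⟩
  · ext j k
    exact key (Sum.inr j) (Sum.inl k) (by simp; omega) (by simp)
  · intro j k h
    exact key (Sum.inl j) (Sum.inl k) h (by simp)

variable [Finite K]

theorem rootElt_mem_triUni {ρ : Fin n ⊕ Fin n → ℕ} (hρ : Function.Injective ρ) {i : Fin n}
    (h : ρ (lowIdx i) < ρ (highIdx i)) (h' : ρ (highIdx i).swap < ρ (lowIdx i).swap) (t : K) :
    rootElt i t ∈ triUni K ρ := by
  constructor
  · intro x y hxy
    rw [rootElt_apply, if_neg (by rintro rfl; omega), if_neg (by rintro ⟨rfl, rfl⟩; omega),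
      if_neg (by rintro ⟨rfl, rfl⟩; omega)]
  · intro x y hxy
    obtain rfl := hρ hxy
    rw [rootElt_apply, if_pos rfl, one_apply_eq]

theorem rootElt_mem_rk (i : Fin n) (t : K) : rootElt i t ∈ triUni K (rk (n := n)) := by
  have hi := i.2
  refine rootElt_mem_triUni rk_injective (by simp) ?_ t
  rw [rk_swap, rk_swap]; simp; omega

theorem rootElt_mem_borel (i : Fin n) (t : K) : rootElt i t ∈ borel n K :=
  triUni_rk_le (rootElt_mem_rk i t)

theorem para_of_mem_cell {i : Fin n} {t : K} {h : Sp n K}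
    (hm : (simpleElt K i)⁻¹ * (rootElt i t)⁻¹ * h ∈ borel n K) : Para i h := by
  have := ((para_of_mem_borel i (rootElt_mem_borel i t)).mul
    (para_of_mono i (mono_simpleElt (K := K) i))).mul (para_of_mem_borel i hm)
  simpa [mul_assoc] using this

/-- The big cell of `Para i` consists of the elements with nonzero entry at
`(highIdx i, lowIdx i)`, and this entry and the one above it determine the root element. -/
theorem mem_cell_iff {i : Fin n} {t : K} {h : Sp n K} (hp : Para i h) :
    (simpleElt K i)⁻¹ * (rootElt i t)⁻¹ * h ∈ borel n K ↔
      h.1 (highIdx i) (lowIdx i) ≠ 0 ∧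
        h.1 (lowIdx i) (lowIdx i) = t * h.1 (highIdx i) (lowIdx i) := by
  set k := (simpleElt K i)⁻¹ * (rootElt i t)⁻¹ * h with hk
  have hkp : Para i k := ((para_of_mono i (mono_simpleElt_inv i)).mul
    (para_of_mem_borel i (inv_mem (rootElt_mem_borel i t)))).mul hp
  have hh : h = rootElt i t * (simpleElt K i * k) := by rw [hk]; group
  have e1 : h.1 (highIdx i) (lowIdx i) =
      (simpleElt K i).1 (highIdx i) (lowIdx i) * k.1 (lowIdx i) (lowIdx i) := by
    rw [hh, rootElt_mul_highIdx]
    have := (mono_simpleElt (K := K) i).mul_apply k.1 (lowIdx i) (lowIdx i)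
    rwa [simplePerm_lowIdx] at this
  have e2 : h.1 (lowIdx i) (lowIdx i) =
      (simpleElt K i).1 (lowIdx i) (highIdx i) * k.1 (highIdx i) (lowIdx i) +
        t * h.1 (highIdx i) (lowIdx i) := by
    conv_lhs => rw [hh]
    rw [rootElt_mul_lowIdx]
    have := (mono_simpleElt (K := K) i).mul_apply k.1 (highIdx i) (lowIdx i)
    rw [simplePerm_highIdx] at this
    rw [Submonoid.coe_mul, this]
    congr 2
    rw [e1]
    have := (mono_simpleElt (K := K) i).mul_apply k.1 (lowIdx i) (lowIdx i)
    rwa [simplePerm_lowIdx] at this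
  have n1 : (simpleElt K i).1 (highIdx i) (lowIdx i) ≠ 0 := by
    simpa using (mono_simpleElt (K := K) i).ne_zero (lowIdx i)
  have n2 : (simpleElt K i).1 (lowIdx i) (highIdx i) ≠ 0 := by
    simpa using (mono_simpleElt (K := K) i).ne_zero (highIdx i)
  constructor
  · intro hb
    have h0 : k.1 (highIdx i) (lowIdx i) = 0 := (mem_borel_iff k).1 hb (by simp)
    refine ⟨?_, ?_⟩
    · rw [e1]; exact mul_ne_zero n1 (borel_apply_self_ne_zero hb _)
    · rw [e2, h0]; ring
  · rintro ⟨-, h2⟩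
    refine mem_borel_of_para hkp ?_
    rw [h2] at e2
    have : (simpleElt K i).1 (lowIdx i) (highIdx i) * k.1 (highIdx i) (lowIdx i) = 0 := by
      linear_combination -e2
    exact (mul_eq_zero.1 this).resolve_left n2

theorem Para.mem_borel_or_exists {i : Fin n} {h : Sp n K} (hp : Para i h) :
    h ∈ borel n K ∨ ∃ t, (simpleElt K i)⁻¹ * (rootElt i t)⁻¹ * h ∈ borel n K := by
  by_cases h0 : h.1 (highIdx i) (lowIdx i) = 0
  · exact Or.inl (mem_borel_of_para hp h0)
  · exact Or.inr ⟨h.1 (lowIdx i) (lowIdx i) / h.1 (highIdx i) (lowIdx i),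
      (mem_cell_iff hp).2 ⟨h0, by field_simp⟩⟩

open Classical in
-- The cosets of `B` in the parabolic form a projective line: one point is `B`, the other `q` are
-- the cosets of `rootElt i t * simpleElt K i`. So exactly one indicator is nonzero on the
-- parabolic.
theorem panel_indicator (i : Fin n) (R : Type*) [CommRing R] [Fintype K] (h : Sp n K) :
    (if h ∈ borel n K then (1 : R) else 0) +
      ∑ t : K, (if (simpleElt K i)⁻¹ * (rootElt i t)⁻¹ * h ∈ borel n K then (1 : R) else 0) =
    if Para i h then 1 else 0 := by
  by_cases hp : Para i h
  · simp only [mem_cell_iff hp, if_pos hp]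
    by_cases h0 : h.1 (highIdx i) (lowIdx i) = 0
    · simp [h0, mem_borel_of_para hp h0]
    · have hb : h ∉ borel n K := fun hb => h0 ((mem_borel_iff h).1 hb (by simp))
      rw [if_neg hb, zero_add, Finset.sum_eq_single (h.1 (lowIdx i) (lowIdx i) / h.1 (highIdx i) (lowIdx i))]
      · rw [if_pos ⟨h0, by field_simp⟩]
      · intro t _ ht
        rw [if_neg]
        rintro ⟨-, h2⟩
        exact ht (by rw [h2]; field_simp)
      · simp
  · rw [if_neg hp, if_neg (fun hb => hp (para_of_mem_borel i hb)), zero_add]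
    refine Finset.sum_eq_zero fun t _ => if_neg fun hm => hp (para_of_mem_cell hm)

end Simple

/-! ### The Weyl group as a group of permutations -/

section WeylPerm

variable {n : ℕ} {K : Type*} [Field K]

theorem mono_flipElt (j : Fin n) : Mono (flipElt K j) (Equiv.swap (Sum.inl j) (Sum.inr j)) := by
  intro x y hxy
  rcases x with i | i <;> rcases y with k | k <;>
    simp [flipElt, single_apply, one_apply, Equiv.swap_apply_def] at hxy ⊢ <;> grind

theorem simpleElt_mem (i : Fin n) : simpleElt K i ∈ monomialGroup n K := by
  unfold simpleElt
  split_ifs with h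
  · exact Subgroup.subset_closure (Or.inl ⟨i, ⟨i + 1, h⟩, rfl, rfl⟩)
  · exact Subgroup.subset_closure (Or.inr ⟨i, rfl⟩)

theorem mem_simpleReflections {g : Sp n K} :
    g ∈ simpleReflections n K ↔ ∃ i, g = simpleElt K i := by
  constructor
  · rintro (⟨i, j, hij, rfl⟩ | ⟨j, hj, rfl⟩)
    · refine ⟨i, ?_⟩
      have h : (i : ℕ) + 1 < n := by omega
      obtain rfl : j = ⟨i + 1, h⟩ := Fin.ext hij.symm
      simp [simpleElt, h]
    · exact ⟨j, by simp [simpleElt, hj]⟩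
  · rintro ⟨i, rfl⟩
    have hi := i.2
    by_cases h : (i : ℕ) + 1 < n
    · exact Or.inl ⟨i, ⟨i + 1, h⟩, rfl, by simp [simpleElt, h]⟩
    · exact Or.inr ⟨i, by omega, by simp [simpleElt, h]⟩

theorem exists_mono {g : Sp n K} (hg : g ∈ monomialGroup n K) :
    ∃ σ, Mono g σ ∧ ∀ x : Fin n ⊕ Fin n, σ x.swap = (σ x).swap := by
  induction hg using Subgroup.closure_induction with
  | mem g hg =>
    rcases hg with ⟨i, j, hij, rfl⟩ | ⟨j, rfl⟩
    · obtain ⟨k, hk⟩ := mem_simpleReflections.1 (Or.inl ⟨i, j, hij, rfl⟩ : swapElt K i j ∈ _)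
      rw [hk]
      exact ⟨_, mono_simpleElt k, simplePerm_swap k⟩
    · refine ⟨_, mono_flipElt j, ?_⟩
      rintro (k | k) <;> simp [Equiv.swap_apply_def] <;> split_ifs <;> simp
  | one => exact ⟨1, Mono.one, fun _ => rfl⟩
  | mul g h _ _ hg hh =>
    obtain ⟨σ, h1, h2⟩ := hg
    obtain ⟨τ, h3, h4⟩ := hh
    exact ⟨σ * τ, h1.mul h3, fun x => by simp [h2, h4]⟩
  | inv g _ hg =>
    obtain ⟨σ, h1, h2⟩ := hg
    refine ⟨σ⁻¹, h1.inv, fun x => σ.injective ?_⟩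
    rw [h2]; simp

variable (n K) in
/-- The permutations underlying the elements of the monomial group. -/
def weylPerm : Subgroup (Equiv.Perm (Fin n ⊕ Fin n)) where
  carrier := {σ | ∃ g ∈ monomialGroup n K, Mono g σ}
  one_mem' := ⟨1, one_mem _, Mono.one⟩
  mul_mem' := by
    rintro σ τ ⟨g, hg, h1⟩ ⟨h, hh, h2⟩
    exact ⟨g * h, mul_mem hg hh, h1.mul h2⟩
  inv_mem' := by
    rintro σ ⟨g, hg, h1⟩
    exact ⟨g⁻¹, inv_mem hg, h1.inv⟩

theorem weylPerm_swap {σ : Equiv.Perm (Fin n ⊕ Fin n)} (hσ : σ ∈ weylPerm n K) (x : Fin n ⊕ Fin n) :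
    σ x.swap = (σ x).swap := by
  obtain ⟨g, hg, h⟩ := hσ
  obtain ⟨τ, h1, h2⟩ := exists_mono hg
  rw [h.unique h1, h2]

theorem simplePerm_mem (i : Fin n) : simplePerm i ∈ weylPerm n K :=
  ⟨_, simpleElt_mem i, mono_simpleElt i⟩

theorem longElt_mem : longElt n K ∈ monomialGroup n K :=
  flipSet_mem (fun j => Subgroup.subset_closure (Or.inr ⟨j, rfl⟩)) _

theorem mono_longElt : Mono (longElt n K) (Equiv.sumComm _ _) := by
  intro x y hxy
  rw [coe_flipSet_univ]
  rcases x with i | i <;> rcases y with k | k <;> simp [one_apply] at hxy ⊢ <;> assumption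

theorem sumComm_mem : (Equiv.sumComm (Fin n) (Fin n) : Equiv.Perm (Fin n ⊕ Fin n)) ∈ weylPerm n K :=
  ⟨_, longElt_mem, mono_longElt⟩

/-- Right multiplication of `σ` by the `i`-th simple reflection increases the length. -/
def Asc (σ : Equiv.Perm (Fin n ⊕ Fin n)) (i : Fin n) : Prop := rk (σ (lowIdx i)) < rk (σ (highIdx i))

theorem Asc.of_not {σ : Equiv.Perm (Fin n ⊕ Fin n)} {i : Fin n} (h : ¬ Asc σ i) :
    Asc (σ * simplePerm i) i := by
  have : rk (σ (lowIdx i)) ≠ rk (σ (highIdx i)) := fun e =>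
    lowIdx_ne_highIdx i (σ.injective (rk_injective e))
  unfold Asc at *
  simp only [Equiv.Perm.mul_apply, simplePerm_lowIdx, simplePerm_highIdx]
  omega

theorem Asc.swap_lt {σ : Equiv.Perm (Fin n ⊕ Fin n)} {i : Fin n} (h : Asc σ i) :
    rk (σ (highIdx i)).swap < rk (σ (lowIdx i)).swap := by
  have := rk_lt (σ (highIdx i))
  unfold Asc at h
  rw [rk_swap, rk_swap]; omega

/-- The ranks of the images of `u_1, …, u_n` increase, so the `k`-th is at least its original rank.
The last ascent compares the image of `u_n` with its mirror `σ v_n` and bounds its rank by `n - 1`;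
descending from there gives the opposite inequalities. -/
theorem eq_one_of_forall_asc {σ : Equiv.Perm (Fin n ⊕ Fin n)} (hσ : σ ∈ weylPerm n K)
    (h : ∀ i, Asc σ i) : σ = 1 := by
  have hlow : ∀ (k : ℕ) (hk : k < n), k ≤ rk (σ (Sum.inl ⟨k, hk⟩)) := by
    intro k
    induction k with
    | zero => intro _; exact Nat.zero_le _
    | succ k ih =>
      intro hk
      have h1 := ih (by omega)
      have h2 := h ⟨k, by omega⟩
      simp only [Asc, lowIdx, highIdx, hk, dite_true] at h2
      omega
  have hhigh : ∀ (k : ℕ) (hk : k < n), rk (σ (Sum.inl ⟨n - 1 - k, by omega⟩)) ≤ n - 1 - k := by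
    intro k
    induction k with
    | zero =>
      intro hk
      have h2 := h ⟨n - 1, by omega⟩
      have h3 : ¬ (n - 1 + 1 < n) := by omega
      simp only [Asc, lowIdx, highIdx, h3, dite_false] at h2
      have h4 := weylPerm_swap hσ (Sum.inl ⟨n - 1, by omega⟩)
      have h5 := rk_lt (σ (Sum.inl ⟨n - 1, by omega⟩))
      simp only [Sum.swap_inl] at h4
      rw [h4, rk_swap] at h2
      simp only [Nat.sub_zero]
      omega
    | succ k ih =>
      intro hk
      have h1 := ih (by omega)
      have h2 := h ⟨n - 1 - (k + 1), by omega⟩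
      have h3 : n - 1 - (k + 1) + 1 < n := by omega
      simp only [Asc, lowIdx, highIdx, h3, dite_true] at h2
      have h4 : (⟨n - 1 - (k + 1) + 1, h3⟩ : Fin n) = ⟨n - 1 - k, by omega⟩ := Fin.ext (by simp; omega)
      rw [h4] at h2
      omega
  have hinl : ∀ i : Fin n, σ (Sum.inl i) = Sum.inl i := by
    intro i
    have h1 := hlow i i.2
    have h2 := hhigh (n - 1 - i) (by omega)
    have h4 : (⟨n - 1 - (n - 1 - i), by omega⟩ : Fin n) = i := Fin.ext (by simp; omega)
    rw [h4] at h2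
    refine rk_injective ?_
    rw [rk_inl]
    change (i : ℕ) ≤ rk (σ (Sum.inl i)) at h1
    omega
  ext1 x
  rcases x with i | i
  · exact hinl i
  · have := weylPerm_swap hσ (Sum.inl i)
    rw [hinl] at this
    exact this

theorem Mono.inv_mul_mem_torus {g h : Sp n K} {σ : Equiv.Perm (Fin n ⊕ Fin n)} (hg : Mono g σ)
    (hh : Mono h σ) : g⁻¹ * h ∈ torus n K := by
  rw [← mono_one_iff, ← inv_mul_cancel σ]
  exact hg.inv.mul hh

/-- A representative in the monomial group of an element of the Weyl group. -/
def repElt (σ : weylPerm n K) : Sp n K := σ.2.choose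

theorem repElt_mem (σ : weylPerm n K) : repElt σ ∈ monomialGroup n K := σ.2.choose_spec.1

theorem mono_repElt (σ : weylPerm n K) : Mono (repElt σ) σ.1 := σ.2.choose_spec.2

variable [Finite K]

variable (K) in
/-- The order of the intersection of `U` with its conjugate by an element of the Weyl group. -/
def cellCard (σ : Equiv.Perm (Fin n ⊕ Fin n)) : ℕ :=
  Nat.card ↥(triUni K (rk (n := n)) ⊓ triUni K (rk ∘ σ.symm))

theorem cellCard_pos (σ : Equiv.Perm (Fin n ⊕ Fin n)) : 0 < cellCard K σ := Nat.card_pos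

theorem cellCard_one : cellCard K (1 : Equiv.Perm (Fin n ⊕ Fin n)) = Nat.card (triUni K (rk (n := n))) := by
  have : (rk ∘ (1 : Equiv.Perm (Fin n ⊕ Fin n)).symm) = rk := rfl
  rw [cellCard, this, inf_idem]

theorem cellCard_le (σ : Equiv.Perm (Fin n ⊕ Fin n)) :
    cellCard K σ ≤ Nat.card (triUni K (rk (n := n))) :=
  Subgroup.card_le_of_le inf_le_left

theorem mem_triUni_rk_comp {σ : Equiv.Perm (Fin n ⊕ Fin n)} {u : Sp n K}
    (hu : u ∈ triUni K (rk (n := n))) :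
    u ∈ triUni K (rk ∘ σ) ↔ u.1.BlockTriangular (rk ∘ σ) := by
  refine ⟨fun h => h.1, fun h => ⟨h, fun x y hxy => hu.2 x y ?_⟩⟩
  rw [σ.injective (rk_injective hxy)]

/-- On an ascent, `simplePerm i` reverses the order of one pair of indices and of its mirror pair,
so a single root is lost from the intersection. -/
theorem mem_cell_mul_simplePerm_iff {σ : Equiv.Perm (Fin n ⊕ Fin n)} (hσ : σ ∈ weylPerm n K) {i : Fin n}
    (h : Asc σ i) (u : Sp n K) :
    u ∈ triUni K (rk (n := n)) ⊓ triUni K (rk ∘ (σ * simplePerm i).symm) ↔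
      u ∈ triUni K (rk (n := n)) ⊓ triUni K (rk ∘ σ.symm) ∧ u.1 (σ (lowIdx i)) (σ (highIdx i)) = 0 := by
  have hcomp : ∀ x, (σ * simplePerm i).symm x = simplePerm i (σ.symm x) := by
    intro x
    rw [Equiv.symm_apply_eq]
    simp
  constructor
  · rintro ⟨h1, h2⟩
    refine ⟨⟨h1, (mem_triUni_rk_comp h1).2 fun x y hxy => ?_⟩, h2.1 ?_⟩
    · simp only [Function.comp_apply] at hxy
      rcases lt_trichotomy (rk (simplePerm i (σ.symm y))) (rk (simplePerm i (σ.symm x))) with h' | h' | h'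
      · exact h2.1 (by simpa [hcomp] using h')
      · have := (simplePerm i).injective (rk_injective h')
        rw [this] at hxy
        omega
      · rcases eq_of_rk_simplePerm_lt hxy h' with ⟨e1, e2⟩ | ⟨e1, e2⟩
        · rw [Equiv.symm_apply_eq] at e1 e2
          rw [e1, e2]
          exact h1.1 h
        · rw [Equiv.symm_apply_eq, weylPerm_swap hσ] at e1 e2
          rw [e1, e2]
          exact h1.1 h.swap_lt
    · simp [hcomp]
  · rintro ⟨⟨h1, h2⟩, h3⟩
    refine ⟨h1, (mem_triUni_rk_comp h1).2 fun x y hxy => ?_⟩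
    simp only [Function.comp_apply, hcomp] at hxy
    rcases lt_trichotomy (rk (σ.symm y)) (rk (σ.symm x)) with h' | h' | h'
    · exact h2.1 h'
    · rw [rk_injective h'] at hxy
      omega
    · rcases eq_of_rk_simplePerm_lt h' hxy with ⟨e1, e2⟩ | ⟨e1, e2⟩
      · rw [Equiv.symm_apply_eq] at e1 e2
        rw [e1, e2]
        exact h3
      · rw [Equiv.symm_apply_eq, weylPerm_swap hσ] at e1 e2
        -- The mirror entry of `u` is, up to sign, this entry of `u⁻¹`, which vanishes with that of
        -- `u` by additivity.
        have hinv : (u⁻¹).1 (σ (lowIdx i)) (σ (highIdx i)) = 0 := by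
          have hm := mul_apply_of_succ (rk_injective.comp σ.symm.injective)
            (c := σ (lowIdx i)) (d := σ (highIdx i)) (by simp) h2 (inv_mem h2)
          rw [h3, zero_add, Submonoid.coe_mul, mul_inv_apply, one_apply_ne] at hm
          · exact hm.symm
          · exact fun e => lowIdx_ne_highIdx i (σ.injective e)
        rw [e1, e2]
        rcases inv_apply_swap u (σ (lowIdx i)) (σ (highIdx i)) with h' | h'
        · rw [← h', hinv]
        · rw [hinv] at h'
          exact neg_eq_zero.1 h'.symm

theorem conj_rootElt_mem {σ : Equiv.Perm (Fin n ⊕ Fin n)} (hσ : σ ∈ weylPerm n K) {i : Fin n}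
    (h : Asc σ i) {g : Sp n K} (hg : Mono g σ) (t : K) :
    g * rootElt i t * g⁻¹ ∈ triUni K (rk (n := n)) := by
  refine hg.conj_mem_triUni (rootElt_mem_triUni (rk_injective.comp σ.injective) h ?_ t)
  simp only [Function.comp_apply, weylPerm_swap hσ]
  exact h.swap_lt

/-- The entry at the lost root is a homomorphism onto `K`, by conjugates of root elements, and its
kernel is the smaller intersection. Thus `cellCard` is `q ^ (N - ℓ(σ))` with `q ^ N = |U|`, and it
replaces the length function in what follows. -/
theorem cellCard_eq_mul {σ : Equiv.Perm (Fin n ⊕ Fin n)} (hσ : σ ∈ weylPerm n K) {i : Fin n}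
    (h : Asc σ i) : cellCard K σ = Nat.card K * cellCard K (σ * simplePerm i) := by
  set A := triUni K (rk (n := n)) ⊓ triUni K (rk ∘ σ.symm) with hA
  set A' := triUni K (rk (n := n)) ⊓ triUni K (rk ∘ (σ * simplePerm i).symm) with hA'
  let f : A →* Multiplicative K :=
    { toFun := fun u => Multiplicative.ofAdd (u.1.1 (σ (lowIdx i)) (σ (highIdx i)))
      map_one' := by
        change Multiplicative.ofAdd ((1 : Matrix _ _ K) _ _) = 1
        rw [one_apply_ne (fun e => lowIdx_ne_highIdx i (σ.injective e))]; rfl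
      map_mul' := fun u v => by
        change Multiplicative.ofAdd ((u.1 * v.1 : Sp n K).1 _ _) = _
        rw [mul_apply_of_succ (rk_injective.comp σ.symm.injective) (by simp) u.2.2 v.2.2]; rfl }
  have hle : A' ≤ A := fun u hu => ((mem_cell_mul_simplePerm_iff hσ h u).1 hu).1
  have hker : f.ker = A'.subgroupOf A := by
    ext u
    rw [MonoidHom.mem_ker, Subgroup.mem_subgroupOf, hA', mem_cell_mul_simplePerm_iff hσ h]
    exact ⟨fun e => ⟨u.2, e⟩, fun e => e.2⟩
  have hsurj : Function.Surjective f := by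
    intro t
    obtain ⟨g, hg, hgσ⟩ := hσ
    have h1 := hgσ.ne_zero (lowIdx i)
    have h2 : (g⁻¹).1 (highIdx i) (σ (highIdx i)) ≠ 0 :=
      right_ne_zero_of_mul_eq_one (hgσ.apply_mul_inv_apply (highIdx i))
    set c := g.1 (σ (lowIdx i)) (lowIdx i) with hc
    set d := (g⁻¹).1 (highIdx i) (σ (highIdx i)) with hd
    refine ⟨⟨g * rootElt i (c⁻¹ * t.toAdd * d⁻¹) * g⁻¹,
      conj_rootElt_mem ⟨g, hg, hgσ⟩ h hgσ _, hgσ.conj_mem_triUni ?_⟩, ?_⟩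
    · convert rootElt_mem_rk i _ using 2
      funext x
      simp
    · change Multiplicative.ofAdd ((g * rootElt i (c⁻¹ * t.toAdd * d⁻¹) * g⁻¹).1 _ _) = t
      rw [hgσ.conj_apply, ← hc, ← hd, rootElt_apply, if_neg (lowIdx_ne_highIdx i), if_pos ⟨rfl, rfl⟩]
      have : c * (c⁻¹ * Multiplicative.toAdd t * d⁻¹) * d = Multiplicative.toAdd t := by field_simp
      rw [this]; rfl
  have hcard := f.ker.card_mul_index
  rw [Subgroup.index_ker, f.range_eq_top.2 hsurj, Subgroup.card_top, hker,
    Nat.card_congr (Subgroup.subgroupOfEquivOfLe hle).toEquiv, mul_comm] at hcard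
  exact hcard.symm

/-- Induction on the length, measured by how far `cellCard` has dropped below `|U|`: a nontrivial
element has a descent, and undoing it multiplies `cellCard` by `q`. -/
theorem weyl_induction {P : Equiv.Perm (Fin n ⊕ Fin n) → Prop} (h1 : P 1)
    (hs : ∀ σ ∈ weylPerm n K, ∀ i, Asc σ i → P σ → P (σ * simplePerm i)) :
    ∀ σ ∈ weylPerm n K, P σ := by
  intro σ hσ
  induction hk : Nat.card (triUni K (rk (n := n))) - cellCard K σ using Nat.strong_induction_on
    generalizing σ with
  | _ k ih =>
    by_cases hall : ∀ i, Asc σ i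
    · rw [eq_one_of_forall_asc hσ hall]; exact h1
    · push Not at hall
      obtain ⟨i, hi⟩ := hall
      have hasc := Asc.of_not hi
      have hmem := mul_mem hσ (simplePerm_mem (K := K) i)
      have hcard := cellCard_eq_mul hmem hasc
      rw [mul_assoc, simplePerm_mul_self, mul_one] at hcard
      have hpos := cellCard_pos (K := K) σ
      have hq : 1 < Nat.card K := Finite.one_lt_card
      have hle := cellCard_le (K := K) (σ * simplePerm i)
      have hlt : cellCard K σ < cellCard K (σ * simplePerm i) := by rw [hcard]; nlinarith
      have := hs _ hmem i hasc (ih _ (by omega) _ hmem rfl)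
      rwa [mul_assoc, simplePerm_mul_self, mul_one] at this

theorem Asc.sumComm_mul {σ : Equiv.Perm (Fin n ⊕ Fin n)} {i : Fin n} (h : Asc σ i) :
    ¬ Asc (Equiv.sumComm (Fin n) (Fin n) * σ) i := by
  have := h.swap_lt
  unfold Asc
  simp only [Equiv.Perm.mul_apply, Equiv.sumComm_apply]
  omega

/-- Left multiplication by the longest element exchanges ascents and descents, so upward induction
becomes downward induction. -/
theorem weyl_induction_desc {P : Equiv.Perm (Fin n ⊕ Fin n) → Prop}
    (h1 : P (Equiv.sumComm (Fin n) (Fin n)))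
    (hs : ∀ σ ∈ weylPerm n K, ∀ i, Asc σ i → P (σ * simplePerm i) → P σ) :
    ∀ σ ∈ weylPerm n K, P σ := by
  have key : ∀ σ ∈ weylPerm n K, P (Equiv.sumComm (Fin n) (Fin n) * σ) := by
    refine weyl_induction (by simpa using h1) fun σ hσ i hi hP => ?_
    have h2 := Asc.of_not hi.sumComm_mul
    rw [mul_assoc] at h2
    refine hs _ (mul_mem sumComm_mem (mul_mem hσ (simplePerm_mem i))) i h2 ?_
    rw [mul_assoc, mul_assoc, simplePerm_mul_self, mul_one]
    exact hP
  intro σ hσ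
  have := key _ (mul_mem (inv_mem sumComm_mem) hσ)
  rwa [mul_inv_cancel_left] at this

theorem cellCard_sumComm : cellCard K (Equiv.sumComm (Fin n) (Fin n)) = 1 := by
  rw [cellCard, Subgroup.card_eq_one, Subgroup.eq_bot_iff_forall]
  rintro u ⟨h1, h2⟩
  ext x y
  change u.1 x y = (1 : Matrix _ _ K) x y
  rcases lt_trichotomy (rk x) (rk y) with h | h | h
  · rw [one_apply_ne (by rintro rfl; omega)]
    refine h2.1 ?_
    have := rk_lt y
    simp only [Function.comp_apply, Equiv.sumComm_symm, Equiv.sumComm_apply, rk_swap]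
    omega
  · exact h1.2 x y h
  · rw [one_apply_ne (by rintro rfl; omega)]
    exact h1.1 h

/-- A step that divides one factor by `q` multiplies the other by `q`. -/
theorem cellCard_mul_cellCard {σ : Equiv.Perm (Fin n ⊕ Fin n)} (hσ : σ ∈ weylPerm n K) :
    cellCard K σ * cellCard K (Equiv.sumComm (Fin n) (Fin n) * σ) =
      Nat.card (triUni K (rk (n := n))) := by
  refine weyl_induction (P := fun σ => cellCard K σ * cellCard K (Equiv.sumComm (Fin n) (Fin n) * σ) =
      Nat.card (triUni K (rk (n := n)))) (by rw [mul_one, cellCard_sumComm, cellCard_one, mul_one])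
    (fun σ hσ i hi hP => ?_) σ hσ
  have h2 := Asc.of_not hi.sumComm_mul
  have h3 := cellCard_eq_mul hσ hi
  have h4 := cellCard_eq_mul (mul_mem (mul_mem (sumComm_mem (K := K)) hσ) (simplePerm_mem i)) h2
  simp only [mul_assoc, simplePerm_mul_self, mul_one] at h4
  rw [← hP, h3, h4]
  ring

end WeylPerm

/-! ### The sign character and the Bruhat decomposition -/

section Bruhat

variable {n : ℕ} {K : Type*} [Field K] [Finite K]

/-- The sign of an element of the Weyl group. -/
def weylSign (K : Type*) [Field K] [Finite K] (σ : Equiv.Perm (Fin n ⊕ Fin n)) : ℤˣ :=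
  (-1) ^ (Nat.log (Nat.card K) (cellCard K σ) +
    Nat.log (Nat.card K) (cellCard K (1 : Equiv.Perm (Fin n ⊕ Fin n))))

/-- With `cellCard K σ = q ^ (N - ℓ(σ))` the exponent in `weylSign` is `2N - ℓ(σ)`; the second
logarithm is there to make the sign of the identity `1`. -/
theorem weylSign_one : weylSign K (1 : Equiv.Perm (Fin n ⊕ Fin n)) = 1 := by
  rw [weylSign, ← two_mul, pow_mul]; simp

theorem weylSign_mul_of_asc {σ : Equiv.Perm (Fin n ⊕ Fin n)} (hσ : σ ∈ weylPerm n K) {i : Fin n}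
    (h : Asc σ i) : weylSign K (σ * simplePerm i) = -weylSign K σ := by
  have hlog : Nat.log (Nat.card K) (cellCard K σ) =
      Nat.log (Nat.card K) (cellCard K (σ * simplePerm i)) + 1 := by
    rw [cellCard_eq_mul hσ h, mul_comm, Nat.log_mul_base Finite.one_lt_card (cellCard_pos _).ne']
  rw [weylSign, weylSign, hlog, add_right_comm, pow_succ]
  simp

theorem weylSign_mul {σ : Equiv.Perm (Fin n ⊕ Fin n)} (hσ : σ ∈ weylPerm n K) (i : Fin n) :
    weylSign K (σ * simplePerm i) = -weylSign K σ := by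
  by_cases h : Asc σ i
  · exact weylSign_mul_of_asc hσ h
  · have := weylSign_mul_of_asc (mul_mem hσ (simplePerm_mem i)) (Asc.of_not h)
    rw [mul_assoc, simplePerm_mul_self, mul_one] at this
    rw [this, neg_neg]

theorem mono_list_prod (L : List (Sp n K)) (hL : ∀ s ∈ L, s ∈ simpleReflections n K) :
    ∃ σ ∈ weylPerm n K, Mono L.prod σ ∧ weylSign K σ = (-1) ^ L.length := by
  induction L using List.reverseRecOn with
  | nil => exact ⟨1, one_mem _, Mono.one, by simp [weylSign_one]⟩
  | append_singleton L s ih =>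
    obtain ⟨σ, hσ, h1, h2⟩ := ih fun t ht => hL t (by simp [ht])
    obtain ⟨i, rfl⟩ := mem_simpleReflections.1 (hL s (by simp))
    refine ⟨σ * simplePerm i, mul_mem hσ (simplePerm_mem i), ?_, ?_⟩
    · simpa using h1.mul (mono_simpleElt i)
    · rw [weylSign_mul hσ, h2, List.length_append, List.length_singleton, pow_succ]; simp

theorem exists_list_prod {σ : Equiv.Perm (Fin n ⊕ Fin n)} (hσ : σ ∈ weylPerm n K) :
    ∃ L : List (Sp n K), (∀ s ∈ L, s ∈ simpleReflections n K) ∧ Mono L.prod σ := by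
  refine weyl_induction (K := K) (P := fun σ => ∃ L : List (Sp n K),
    (∀ s ∈ L, s ∈ simpleReflections n K) ∧ Mono L.prod σ) ⟨[], by simp, Mono.one⟩ ?_ σ hσ
  rintro σ _ i _ ⟨L, h1, h2⟩
  refine ⟨L ++ [simpleElt K i], fun s hs => ?_, by simpa using h2.mul (mono_simpleElt i)⟩
  rcases List.mem_append.1 hs with h | h
  · exact h1 s h
  · exact mem_simpleReflections.2 ⟨i, by simpa using h⟩

theorem neg_one_pow_weylLength {g : Sp n K} {σ : Equiv.Perm (Fin n ⊕ Fin n)} (hσ : σ ∈ weylPerm n K)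
    (hg : Mono g σ) : (-1 : ℤˣ) ^ weylLength g = weylSign K σ := by
  -- Nonemptiness matters: the infimum of the empty set would be the default value `0`, attained by
  -- no word.
  have hne : {k | ∃ L : List (Sp n K), L.length = k ∧ (∀ s ∈ L, s ∈ simpleReflections n K) ∧
      ∃ h ∈ torus n K, g = L.prod * h}.Nonempty := by
    obtain ⟨L, h1, h2⟩ := exists_list_prod hσ
    exact ⟨_, L, rfl, h1, _, h2.inv_mul_mem_torus hg, by rw [mul_inv_cancel_left]⟩
  obtain ⟨L, h1, h2, t, ht, h3⟩ := Nat.sInf_mem hne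
  obtain ⟨τ, -, h4, h5⟩ := mono_list_prod L h2
  have h6 : Mono g τ := by
    have := h4.mul (mono_one_iff.2 ht)
    rwa [mul_one, ← h3] at this
  rw [hg.unique h6, h5]
  exact congrArg _ h1.symm

/-- The union of the Bruhat cells. -/
def InCell (g : Sp n K) : Prop :=
  ∃ u ∈ triUni K (rk (n := n)), ∃ σ ∈ weylPerm n K, ∃ m, Mono m σ ∧ ∃ b ∈ borel n K, g = u * m * b

theorem InCell.mul_borel {g b : Sp n K} (hg : InCell g) (hb : b ∈ borel n K) : InCell (g * b) := by
  obtain ⟨u, hu, σ, hσ, m, hm, c, hc, rfl⟩ := hg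
  exact ⟨u, hu, σ, hσ, m, hm, c * b, mul_mem hc hb, by group⟩

/-- Replacing `σ` by `σ * simplePerm i` if necessary makes `i` an ascent. Then the root element in
the decomposition of `Para i` can be moved to the left of the monomial matrix, where it is absorbed
by `U`. -/
theorem InCell.mul_simpleElt {g : Sp n K} (hg : InCell g) (i : Fin n) :
    InCell (g * simpleElt K i) := by
  obtain ⟨u, hu, σ, hσ, m, hm, c, hc, rfl⟩ := hg
  -- multiplying an element of `U m` by the big cell of `Para i`, for an ascent
  have key : ∀ (τ : Equiv.Perm (Fin n ⊕ Fin n)) (k : Sp n K), τ ∈ weylPerm n K → Mono k τ → Asc τ i →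
      ∀ h : Sp n K, Para i h → InCell (u * k * h) := by
    intro τ k hτ hk hasc h hp
    rcases hp.mem_borel_or_exists with hb | ⟨t, ht⟩
    · exact ⟨u, hu, τ, hτ, k, hk, h, hb, rfl⟩
    · refine ⟨u * (k * rootElt i t * k⁻¹), mul_mem hu (conj_rootElt_mem hτ hasc hk t),
        τ * simplePerm i, mul_mem hτ (simplePerm_mem i), k * simpleElt K i,
        hk.mul (mono_simpleElt i), _, ht, ?_⟩
      group
  have hp : Para i (c * simpleElt K i) :=
    (para_of_mem_borel i hc).mul (para_of_mono i (mono_simpleElt i))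
  by_cases hasc : Asc σ i
  · have := key σ m hσ hm hasc _ hp
    rwa [← mul_assoc] at this
  · have := key (σ * simplePerm i) (m * simpleElt K i) (mul_mem hσ (simplePerm_mem i))
      (hm.mul (mono_simpleElt i)) (Asc.of_not hasc) ((simpleElt K i)⁻¹ * (c * simpleElt K i))
      ((para_of_mono i (mono_simpleElt_inv i)).mul hp)
    have e : u * (m * simpleElt K i) * ((simpleElt K i)⁻¹ * (c * simpleElt K i)) =
      u * m * c * simpleElt K i := by group
    rwa [e] at this

theorem inCell (g : Sp n K) : InCell g := by
  have hmul : ∀ m ∈ monomialGroup n K, ∀ g : Sp n K, InCell g → InCell (g * m) := by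
    intro m hm
    obtain ⟨σ, hσ, -⟩ := exists_mono hm
    obtain ⟨L, h1, h2⟩ := exists_list_prod ⟨m, hm, hσ⟩
    have h3 : ∀ g : Sp n K, InCell g → InCell (g * L.prod) := by
      clear h2
      induction L with
      | nil => intro g hg; simpa using hg
      | cons s L ih =>
        intro g hg
        obtain ⟨i, rfl⟩ := mem_simpleReflections.1 (h1 s (by simp))
        rw [List.prod_cons, ← mul_assoc]
        exact ih (fun t ht => h1 t (by simp [ht])) _ (hg.mul_simpleElt i)
    intro g hg
    have := (h3 g hg).mul_borel (torus_le_borel (h2.inv_mul_mem_torus hσ))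
    rwa [mul_assoc, mul_inv_cancel_left] at this
  -- The equivalence, instead of one implication, makes the stabilizer of the union of the cells a
  -- subgroup, so that checking generators is enough.
  let S : Subgroup (Sp n K) :=
    { carrier := {h | ∀ g : Sp n K, InCell g ↔ InCell (g * h)}
      one_mem' := fun g => by simp
      mul_mem' := fun {a b} ha hb g => by rw [ha g, hb (g * a), mul_assoc]
      inv_mem' := fun {a} ha g => by rw [ha (g * a⁻¹)]; simp }
  have hB : ∀ b ∈ borel n K, b ∈ S := fun b hb g => ⟨fun h => h.mul_borel hb, fun h => by
    have := h.mul_borel (inv_mem hb)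
    rwa [mul_inv_cancel_right] at this⟩
  have hN : ∀ m ∈ monomialGroup n K, m ∈ S := fun m hm g => ⟨hmul m hm g, fun h => by
    have := hmul _ (inv_mem hm) _ h
    rwa [mul_inv_cancel_right] at this⟩
  have hg : g ∈ S := by
    refine mem_of_forall_generators S (fun X hX => hB _ ⟨?_, ?_⟩) (fun i j h c => hB _ ⟨?_, ?_⟩)
      (fun d => hB _ ⟨?_, ?_⟩) (fun j => hN _ (Subgroup.subset_closure (Or.inr ⟨j, rfl⟩))) g
    · rw [coe_unip, toBlocks_fromBlocks₂₁]
    · rw [coe_unip, toBlocks_fromBlocks₁₁]; exact blockTriangular_one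
    · rw [coe_levi, toBlocks_fromBlocks₂₁]
    · rw [coe_levi, toBlocks_fromBlocks₁₁, coe_glTransv]
      exact blockTriangular_transvection (b := id) h.le c
    · rw [coe_levi, toBlocks_fromBlocks₂₁]
    · rw [coe_levi, toBlocks_fromBlocks₁₁, coe_glDiag]; exact blockTriangular_diagonal _
  have h1 : InCell (1 : Sp n K) :=
    ⟨1, one_mem _, 1, one_mem _, 1, Mono.one, 1, one_mem _, by simp⟩
  have := (hg 1).1 h1
  rwa [one_mul] at this

theorem bruhat (g : Sp n K) : ∃ u ∈ triUni K (rk (n := n)), ∃ σ : weylPerm n K, ∃ b ∈ borel n K,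
    g = u * repElt σ * b := by
  obtain ⟨u, hu, σ, hσ, m, hm, b, hb, rfl⟩ := inCell g
  refine ⟨u, hu, ⟨σ, hσ⟩, (repElt ⟨σ, hσ⟩)⁻¹ * m * b,
    mul_mem (torus_le_borel ((mono_repElt ⟨σ, hσ⟩).inv_mul_mem_torus hm)) hb, by group⟩

theorem inv_repElt_mul_mem_borel_iff (σ : weylPerm n K) {u : Sp n K} (hu : u ∈ triUni K (rk (n := n))) :
    (repElt σ)⁻¹ * u * repElt σ ∈ borel n K ↔
      u ∈ triUni K (rk (n := n)) ⊓ triUni K (rk ∘ σ.1.symm) := by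
  refine ⟨fun h => ⟨hu, (mono_repElt σ).mem_triUni_of_inv_conj_mem_borel hu h⟩, fun h => ?_⟩
  have := (mono_repElt σ).inv_conj_mem_triUni h.2
  refine triUni_rk_le ?_
  convert this using 2
  funext x
  simp

/-- The stabilizer in `U` of the coset of `n_σ` is `U ∩ σ U σ⁻¹`. -/
theorem card_orbit_mul_cellCard (σ : weylPerm n K) :
    Nat.card (MulAction.orbit (triUni K (rk (n := n))) (repElt σ : Sp n K ⧸ borel n K)) *
      cellCard K σ.1 = Nat.card (triUni K (rk (n := n))) := by
  classical
  have := Fintype.ofFinite (triUni K (rk (n := n)))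
  have := Fintype.ofFinite (MulAction.orbit (triUni K (rk (n := n))) (repElt σ : Sp n K ⧸ borel n K))
  have := Fintype.ofFinite (MulAction.stabilizer (triUni K (rk (n := n)))
    (repElt σ : Sp n K ⧸ borel n K))
  have h := MulAction.card_orbit_mul_card_stabilizer_eq_card_group (triUni K (rk (n := n)))
    (repElt σ : Sp n K ⧸ borel n K)
  rw [← Nat.card_eq_fintype_card, ← Nat.card_eq_fintype_card, ← Nat.card_eq_fintype_card] at h
  rw [← h, cellCard]
  congr 1
  have hs : MulAction.stabilizer (triUni K (rk (n := n))) (repElt σ : Sp n K ⧸ borel n K) =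
      (triUni K (rk (n := n)) ⊓ triUni K (rk ∘ σ.1.symm)).subgroupOf (triUni K (rk (n := n))) := by
    ext u
    rw [MulAction.mem_stabilizer_iff, Subgroup.mem_subgroupOf, ← inv_repElt_mul_mem_borel_iff σ u.2,
      eq_comm]
    change ((repElt σ : Sp n K) : Sp n K ⧸ borel n K) = ((u.1 * repElt σ : Sp n K) : Sp n K ⧸ borel n K) ↔ _
    rw [QuotientGroup.eq, mul_assoc]
  rw [hs]
  exact (Nat.card_congr (Subgroup.subgroupOfEquivOfLe inf_le_left).toEquiv).symm

/-- The cell of `σ` contains `|U| / cellCard σ` cosets, which is `cellCard` of the product of the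
longest element with `σ`; reindexing removes that factor. -/
theorem index_borel [Fintype (weylPerm n K)] :
    (borel n K).index = ∑ σ : weylPerm n K, cellCard K σ.1 := by
  let w : weylPerm n K := ⟨Equiv.sumComm (Fin n) (Fin n), sumComm_mem⟩
  have horb : ∀ σ : weylPerm n K, Nat.card (MulAction.orbit (triUni K (rk (n := n)))
      (repElt σ : Sp n K ⧸ borel n K)) = cellCard K (w * σ).1 := by
    intro σ
    refine Nat.eq_of_mul_eq_mul_right (cellCard_pos (K := K) σ.1) ?_
    rw [card_orbit_mul_cellCard, mul_comm, ← cellCard_mul_cellCard σ.2]; rfl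
  have hbij : Function.Bijective (fun x : (Σ σ : weylPerm n K, MulAction.orbit (triUni K (rk (n := n)))
      (repElt σ : Sp n K ⧸ borel n K)) => (x.2 : Sp n K ⧸ borel n K)) := by
    constructor
    · rintro ⟨σ, x, u, hu⟩ ⟨τ, y, v, hv⟩ h
      simp only at h
      have hστ : σ = τ := by
        have e : ((u.1 * repElt σ : Sp n K) : Sp n K ⧸ borel n K) =
            ((v.1 * repElt τ : Sp n K) : Sp n K ⧸ borel n K) := by
          have h1 : ((u.1 * repElt σ : Sp n K) : Sp n K ⧸ borel n K) = x := hu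
          have h2 : ((v.1 * repElt τ : Sp n K) : Sp n K ⧸ borel n K) = y := hv
          rw [h1, h2, h]
        rw [QuotientGroup.eq] at e
        refine Subtype.ext ((mono_repElt σ).eq_of_inv_mul_mem_borel (mono_repElt τ)
          (u := u.1⁻¹ * v.1) (triUni_rk_le (mul_mem (inv_mem u.2) v.2)) ?_)
        convert e using 1
        group
      subst hστ
      simp only [Sigma.mk.injEq, heq_eq_eq, true_and]
      exact Subtype.ext h
    · intro x
      obtain ⟨g, rfl⟩ := QuotientGroup.mk_surjective x
      obtain ⟨u, hu, σ, b, hb, rfl⟩ := bruhat g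
      refine ⟨⟨σ, ((u * repElt σ : Sp n K) : Sp n K ⧸ borel n K), ⟨u, hu⟩, rfl⟩, ?_⟩
      simp only
      rw [QuotientGroup.eq]
      convert hb using 1
      group
  rw [Subgroup.index, ← Nat.card_congr (Equiv.ofBijective _ hbij), Nat.card_sigma,
    Finset.sum_congr rfl fun σ _ => horb σ]
  exact Equiv.sum_comp (Equiv.mulLeft w) fun σ : weylPerm n K => cellCard K σ.1

end Bruhat

/-! ### The Steinberg lattice -/

section SteinbergLattice

variable {n : ℕ} {K : Type*} [Field K]

instance [Finite K] : Fintype (Sp n K) := Fintype.ofFinite _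

instance [Finite K] (S : Subgroup (Sp n K)) : Fintype S := Fintype.ofFinite _

instance : Fintype (weylPerm n K) := Fintype.ofFinite _

theorem exists_weylEquiv : ∃ f : Weyl n K ≃ weylPerm n K, ∀ w, Mono (w.out : Sp n K) (f w).1 := by
  have hex : ∀ w : Weyl n K, ∃ σ, Mono (w.out : Sp n K) σ := fun w =>
    (exists_mono w.out.2).imp fun σ h => h.1
  choose p hp using hex
  refine ⟨Equiv.ofBijective (fun w => ⟨p w, w.out, w.out.2, hp w⟩) ⟨fun w w' h => ?_, fun σ => ?_⟩, hp⟩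
  · have h' : p w = p w' := congrArg Subtype.val h
    rw [← QuotientGroup.out_eq' w, ← QuotientGroup.out_eq' w', QuotientGroup.eq,
      Subgroup.mem_subgroupOf]
    exact (hp w).inv_mul_mem_torus (h' ▸ hp w')
  · obtain ⟨h, hh⟩ := QuotientGroup.mk_out_eq_mul
      ((torus n K).subgroupOf (monomialGroup n K)) ⟨repElt σ, repElt_mem σ⟩
    refine ⟨QuotientGroup.mk ⟨repElt σ, repElt_mem σ⟩, Subtype.ext ?_⟩
    refine (hp _).unique ?_
    rw [hh]
    have := (mono_repElt σ).mul (mono_one_iff.2 (Subgroup.mem_subgroupOf.1 h.2))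
    rwa [mul_one] at this

theorem Mono.inv_mul_mem_borel_iff {g h : Sp n K} {σ : Equiv.Perm (Fin n ⊕ Fin n)} (hg : Mono g σ)
    (hh : Mono h σ) (x : Sp n K) : g⁻¹ * x ∈ borel n K ↔ h⁻¹ * x ∈ borel n K := by
  have : g⁻¹ * x = g⁻¹ * h * (h⁻¹ * x) := by group
  rw [this]
  exact Subgroup.mul_mem_cancel_left _ (torus_le_borel (hg.inv_mul_mem_torus hh))

theorem inv_mul_mem_borel_comm (a g : Sp n K) : a⁻¹ * g ∈ borel n K ↔ g⁻¹ * a ∈ borel n K := by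
  rw [← inv_mem_iff, _root_.mul_inv_rev, inv_inv]

theorem para_inv_mul_repElt_iff (g : Sp n K) (i : Fin n) (σ τ : weylPerm n K)
    (h : τ.1 = σ.1 * simplePerm i) : Para i (g⁻¹ * repElt τ) ↔ Para i (g⁻¹ * repElt σ) := by
  have hm : Mono (repElt σ * simpleElt K i) τ.1 := h ▸ (mono_repElt σ).mul (mono_simpleElt i)
  have ht := (mono_repElt τ).inv_mul_mem_torus hm
  have hp : Para i (simpleElt K i * ((repElt τ)⁻¹ * (repElt σ * simpleElt K i))⁻¹) :=
    (para_of_mono i (mono_simpleElt i)).mul (para_of_mem_borel i (inv_mem (torus_le_borel ht)))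
  have hp' : Para i (((repElt τ)⁻¹ * (repElt σ * simpleElt K i)) * (simpleElt K i)⁻¹) :=
    (para_of_mem_borel i (torus_le_borel ht)).mul (para_of_mono i (mono_simpleElt_inv i))
  refine ⟨fun h => ?_, fun h => ?_⟩
  · have e : g⁻¹ * repElt τ * (((repElt τ)⁻¹ * (repElt σ * simpleElt K i)) * (simpleElt K i)⁻¹) =
      g⁻¹ * repElt σ := by group
    exact e ▸ h.mul hp'
  · have e : g⁻¹ * repElt σ * (simpleElt K i * ((repElt τ)⁻¹ * (repElt σ * simpleElt K i))⁻¹) =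
      g⁻¹ * repElt τ := by group
    exact e ▸ h.mul hp

variable [Finite K] {R : Type*} [CommRing R]

open Classical in
theorem coeff_mul_sum_borel (m g : Sp n K) (r : R) :
    (MonoidAlgebra.single m r * ∑ᶠ b : borel n K, MonoidAlgebra.single (b : Sp n K) (1 : R)).coeff g =
      if m⁻¹ * g ∈ borel n K then r else 0 := by
  rw [MonoidAlgebra.coeff_single_mul_apply, finsum_eq_sum_of_fintype, MonoidAlgebra.coeff_sum,
    Finsupp.finsetSum_apply]
  simp only [MonoidAlgebra.coeff_single, Finsupp.single_apply]
  split_ifs with h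
  · rw [Finset.sum_eq_single ⟨_, h⟩] <;> simp +contextual [Subtype.ext_iff]
  · rw [Finset.sum_eq_zero, mul_zero]
    rintro b -
    rw [if_neg]
    intro e
    exact h (e ▸ b.2)

open Classical in
-- Representatives chosen in the quotient differ from `repElt` by torus elements, which `B` absorbs,
-- and the sign depends on the permutation only.
theorem coeff_steinbergElt (g : Sp n K) : (steinbergElt n K R).coeff g =
    ∑ σ : weylPerm n K, ((weylSign K σ.1 : ℤ) : R) *
      if (repElt σ)⁻¹ * g ∈ borel n K then 1 else 0 := by
  obtain ⟨f, hf⟩ := exists_weylEquiv (n := n) (K := K)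
  have hfin : Finite (Weyl n K) := Finite.of_equiv _ f.symm
  have := Fintype.ofFinite (Weyl n K)
  rw [steinbergElt, finsum_eq_sum_of_fintype (f := fun w : Weyl n K => MonoidAlgebra.single _ _),
    Finset.sum_mul, MonoidAlgebra.coeff_sum, Finsupp.finsetSum_apply]
  simp only [coeff_mul_sum_borel]
  refine Fintype.sum_equiv f _ _ fun w => ?_
  have h1 : ((-1 : R)) ^ weylLength (w.out : Sp n K) = ((weylSign K (f w).1 : ℤ) : R) := by
    rw [← neg_one_pow_weylLength (f w).2 (hf w)]
    simp
  rw [h1, (hf w).inv_mul_mem_borel_iff (mono_repElt (f w)) g]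
  split_ifs <;> simp

theorem pairing_eq_sum (x y : MonoidAlgebra R (Sp n K)) :
    pairing x y = ∑ g, x.coeff g * y.coeff g := by
  rw [pairing, Finsupp.sum_fintype]
  simp

theorem pairing_comm (x y : MonoidAlgebra R (Sp n K)) : pairing x y = pairing y x := by
  rw [pairing_eq_sum, pairing_eq_sum]
  exact Finset.sum_congr rfl fun g _ => mul_comm _ _

/-- The functions on the cosets of the Borel subgroup whose sums over all panels vanish. -/
structure IsCycle [Fintype K] (y : Sp n K → R) : Prop where
  mul_borel : ∀ g, ∀ b ∈ borel n K, y (g * b) = y g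
  panel : ∀ g i, y g + ∑ t : K, y (g * rootElt i t * simpleElt K i) = 0

open Classical in
theorem panel_indicator_repElt [Fintype K] (g m : Sp n K) (i : Fin n) :
    (if m⁻¹ * g ∈ borel n K then (1 : R) else 0) +
      ∑ t : K, (if m⁻¹ * (g * rootElt i t * simpleElt K i) ∈ borel n K then (1 : R) else 0) =
    if Para i (g⁻¹ * m) then 1 else 0 := by
  rw [← panel_indicator i R (g⁻¹ * m)]
  refine congrArg₂ (· + ·) ?_ (Finset.sum_congr rfl fun t _ => ?_)
  · simp only [inv_mul_mem_borel_comm m g]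
  · have : (g * rootElt i t * simpleElt K i)⁻¹ * m =
        (simpleElt K i)⁻¹ * (rootElt i t)⁻¹ * (g⁻¹ * m) := by group
    simp only [inv_mul_mem_borel_comm m, this]

/-- A panel contains the coset of `n_σ` if and only if it contains that of `n_{σ s}`, where `s` is
the `i`-th simple reflection. These occur in `e` with opposite signs and cancel: `e` is an apartment
cycle of the building. -/
theorem isCycle_steinbergElt [Fintype K] : IsCycle fun g => (steinbergElt n K R).coeff g := by
  classical
  constructor
  · intro g b hb
    simp only [coeff_steinbergElt]
    refine Finset.sum_congr rfl fun σ _ => ?_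
    rw [← mul_assoc, Subgroup.mul_mem_cancel_right _ hb]
  · intro g i
    have h1 : (steinbergElt n K R).coeff g +
        ∑ t : K, (steinbergElt n K R).coeff (g * rootElt i t * simpleElt K i) =
        ∑ σ : weylPerm n K, ((weylSign K σ.1 : ℤ) : R) * if Para i (g⁻¹ * repElt σ) then 1 else 0 := by
      simp only [coeff_steinbergElt]
      rw [Finset.sum_comm, ← Finset.sum_add_distrib]
      refine Finset.sum_congr rfl fun σ _ => ?_
      rw [← Finset.mul_sum, ← mul_add, panel_indicator_repElt]
    rw [h1]
    let s : weylPerm n K := ⟨simplePerm i, simplePerm_mem i⟩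
    refine Finset.sum_involution (fun σ _ => σ * s) ?_ ?_ (fun _ _ => Finset.mem_univ _) ?_
    · intro σ _
      have h2 := para_inv_mul_repElt_iff g i σ (σ * s) rfl
      have h3 : weylSign K (σ * s).1 = -weylSign K σ.1 := weylSign_mul σ.2 i
      simp only [h2, h3]
      push_cast
      ring
    · intro σ _ _ h
      have : s = 1 := mul_eq_left.1 h
      have h2 : simplePerm i = 1 := congrArg Subtype.val this
      have h3 := simplePerm_lowIdx i
      rw [h2] at h3
      exact lowIdx_ne_highIdx i h3
    · intro σ _
      have : s * s = 1 := Subtype.ext (simplePerm_mul_self i)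
      rw [mul_assoc, this, mul_one]

theorem isCycle_of_mem [Fintype K] {y : MonoidAlgebra R (Sp n K)} (hy : y ∈ steinberg n K R) :
    IsCycle fun g => y.coeff g := by
  rw [steinberg] at hy
  obtain ⟨a, rfl⟩ := Submodule.mem_span_singleton.1 hy
  have he := isCycle_steinbergElt (n := n) (K := K) (R := R)
  rw [smul_eq_mul]
  induction a using MonoidAlgebra.induction_linear with
  | zero => constructor <;> simp
  | add a b ha hb =>
    have ha := ha (Submodule.smul_mem _ _ (Submodule.mem_span_singleton_self _))
    have hb := hb (Submodule.smul_mem _ _ (Submodule.mem_span_singleton_self _))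
    constructor
    · intro g c hc
      simp only [add_mul, MonoidAlgebra.coeff_add, Finsupp.add_apply]
      rw [ha.1 g c hc, hb.1 g c hc]
    · intro g i
      simp only [add_mul, MonoidAlgebra.coeff_add, Finsupp.add_apply, Finset.sum_add_distrib]
      rw [add_add_add_comm, ha.2 g i, hb.2 g i, add_zero]
  | single h r =>
    constructor
    · intro g c hc
      simp only [MonoidAlgebra.coeff_single_mul_apply]
      rw [← mul_assoc, he.1 _ c hc]
    · intro g i
      simp only [MonoidAlgebra.coeff_single_mul_apply]
      rw [← Finset.mul_sum, ← mul_add]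
      have := he.2 (h⁻¹ * g) i
      simp only [mul_assoc] at this ⊢
      rw [this, mul_zero]

end SteinbergLattice

/-! ### Sums over the unipotent radical against a character of a simple root -/

section Whittaker

variable {n : ℕ} {K : Type*} [Field K]

theorem rootElt_low_high (l : Fin n) (t : K) : (rootElt l t).1 (lowIdx l) (highIdx l) = t := by
  rw [rootElt_apply, if_neg (lowIdx_ne_highIdx l), if_pos ⟨rfl, rfl⟩]

variable [Finite K]

theorem cellCard_inv {σ : Equiv.Perm (Fin n ⊕ Fin n)} (hσ : σ ∈ weylPerm n K) :
    cellCard K σ⁻¹ = cellCard K σ := by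
  obtain ⟨g, -, hg⟩ := hσ
  have h1 : ∀ u : Sp n K, u ∈ triUni K (rk (n := n)) ⊓ triUni K (rk ∘ σ) →
      g * u * g⁻¹ ∈ triUni K (rk (n := n)) ⊓ triUni K (rk ∘ σ.symm) := fun u hu =>
    ⟨hg.conj_mem_triUni hu.2, hg.conj_mem_triUni (by
      have e : (rk ∘ σ.symm) ∘ σ = rk := by funext x; simp
      rw [e]; exact hu.1)⟩
  have h2 : ∀ u : Sp n K, u ∈ triUni K (rk (n := n)) ⊓ triUni K (rk ∘ σ.symm) →
      g⁻¹ * u * g ∈ triUni K (rk (n := n)) ⊓ triUni K (rk ∘ σ) := fun u hu => by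
    refine ⟨?_, hg.inv_conj_mem_triUni hu.1⟩
    have := hg.inv_conj_mem_triUni hu.2
    have e : (rk ∘ σ.symm) ∘ σ = rk := by funext x; simp
    rwa [e] at this
  exact Nat.card_congr
    { toFun := fun u => ⟨g * u.1 * g⁻¹, h1 u.1 u.2⟩
      invFun := fun u => ⟨g⁻¹ * u.1 * g, h2 u.1 u.2⟩
      left_inv := fun u => Subtype.ext (by simp only; group)
      right_inv := fun u => Subtype.ext (by simp only; group) }

theorem odd_cellCard (hq : Odd (Nat.card K)) {σ : Equiv.Perm (Fin n ⊕ Fin n)}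
    (hσ : σ ∈ weylPerm n K) : Odd (cellCard K σ) := by
  refine weyl_induction_desc (K := K) (P := fun σ => Odd (cellCard K σ)) ?_ (fun σ hσ i hi h => ?_) σ hσ
  · rw [cellCard_sumComm]; exact odd_one
  · rw [cellCard_eq_mul hσ hi]; exact hq.mul h

theorem asc_or_asc_mul (σ : Equiv.Perm (Fin n ⊕ Fin n)) (i : Fin n) :
    Asc (σ * simplePerm i) i ↔ ¬ Asc σ i := by
  refine ⟨fun h h' => ?_, Asc.of_not⟩
  unfold Asc at h h'
  simp at h
  omega

variable {R : Type*} [CommRing R] (l : Fin n) (ψ : AddChar K R)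

/-- The permutations `σ` for which `ψ` is trivial on the root elements of `U ∩ σ U σ⁻¹` for the
`l`-th simple root. -/
def Adm (σ : Equiv.Perm (Fin n ⊕ Fin n)) : Prop := ψ = 1 ∨ ¬ Asc σ⁻¹ l

variable {l ψ} in
-- If multiplication by the simple reflection destroyed the descent of `σ⁻¹` at `l`, the pair it
-- reverses would be the one at which `σ` ascends, in the wrong order.
theorem Adm.mul_simplePerm {σ : Equiv.Perm (Fin n ⊕ Fin n)} (h : Adm l ψ σ) {i : Fin n}
    (hi : Asc σ i) (hσ : σ ∈ weylPerm n K) : Adm l ψ (σ * simplePerm i) := by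
  refine h.imp_right fun h h' => ?_
  have h1 : rk (σ⁻¹ (highIdx l)) < rk (σ⁻¹ (lowIdx l)) := by
    refine lt_of_le_of_ne (not_lt.1 h) fun e => lowIdx_ne_highIdx l ?_
    exact (σ⁻¹.injective (rk_injective e)).symm
  have h2 : rk (simplePerm i (σ⁻¹ (lowIdx l))) < rk (simplePerm i (σ⁻¹ (highIdx l))) := by
    simpa [Asc] using h'
  rcases eq_of_rk_simplePerm_lt h1 h2 with ⟨e1, e2⟩ | ⟨e1, e2⟩
  · rw [Equiv.Perm.inv_eq_iff_eq] at e1 e2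
    rw [Asc, ← e1, ← e2] at hi
    simp at hi
  · rw [Equiv.Perm.inv_eq_iff_eq, weylPerm_swap hσ] at e1 e2
    have h3 := hi.swap_lt
    rw [← e1, ← e2] at h3
    simp at h3

theorem val_mul_triUni {u v : Sp n K} (hu : u ∈ triUni K (rk (n := n))) (hv : v ∈ triUni K (rk (n := n))) :
    ψ ((u * v).1 (lowIdx l) (highIdx l)) =
      ψ (u.1 (lowIdx l) (highIdx l)) * ψ (v.1 (lowIdx l) (highIdx l)) := by
  rw [mul_apply_of_succ rk_injective (by simp) hu hv, AddChar.map_add_eq_mul]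

/-- The sum of the translates of `y` by the elements of `U`, weighted by `ψ`. -/
def whitSum (y : Sp n K → R) (g : Sp n K) : R :=
  ∑ u : triUni K (rk (n := n)), ψ (u.1.1 (lowIdx l) (highIdx l)) * y (u * g)

theorem whitSum_mul (y : Sp n K → R) {v : Sp n K} (hv : v ∈ triUni K (rk (n := n))) (g : Sp n K) :
    ψ (v.1 (lowIdx l) (highIdx l)) * whitSum l ψ y (v * g) = whitSum l ψ y g := by
  rw [whitSum, whitSum, Finset.mul_sum]
  refine Fintype.sum_equiv (Equiv.mulRight (⟨v, hv⟩ : triUni K (rk (n := n)))) _ _ fun u => ?_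
  have := val_mul_triUni l ψ u.2 hv
  change _ = ψ ((u.1 * v).1 _ _) * y (u.1 * v * g)
  rw [this, mul_assoc u.1 v g]
  ring

theorem whitSum_mul_borel [Fintype K] {y : Sp n K → R} (hy : IsCycle y) (g : Sp n K) {b : Sp n K}
    (hb : b ∈ borel n K) : whitSum l ψ y (g * b) = whitSum l ψ y g := by
  refine Finset.sum_congr rfl fun u _ => ?_
  rw [← mul_assoc, hy.mul_borel _ b hb]

theorem whitSum_panel [Fintype K] {y : Sp n K → R} (hy : IsCycle y) (g : Sp n K) (i : Fin n) :
    whitSum l ψ y g + ∑ t : K, whitSum l ψ y (g * rootElt i t * simpleElt K i) = 0 := by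
  simp only [whitSum]
  rw [Finset.sum_comm, ← Finset.sum_add_distrib]
  refine Finset.sum_eq_zero fun u _ => ?_
  rw [← Finset.mul_sum, ← mul_add]
  have := hy.panel (u * g) i
  simp only [mul_assoc] at this ⊢
  rw [this, mul_zero]

theorem Adm.conj_val {σ : Equiv.Perm (Fin n ⊕ Fin n)} (h : Adm l ψ σ) {u : Sp n K}
    (hu : u ∈ triUni K (rk ∘ σ.symm)) : ψ (u.1 (lowIdx l) (highIdx l)) = 1 := by
  rcases h with rfl | h
  · simp
  · rw [hu.1, AddChar.map_zero_eq_one]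
    refine lt_of_le_of_ne (not_lt.1 h) fun e => lowIdx_ne_highIdx l ?_
    exact (σ.symm.injective (rk_injective e)).symm

/-- Conjugation by `g` carries the root elements at an ascent into `U ∩ σ U σ⁻¹`, on which `ψ` is
trivial. So the `q` terms in the panel relation besides the one at `g` are equal. -/
theorem whitSum_asc [Fintype K] {y : Sp n K → R} (hy : IsCycle y) {σ : Equiv.Perm (Fin n ⊕ Fin n)}
    (hσ : σ ∈ weylPerm n K) (h : Adm l ψ σ) {i : Fin n} (hi : Asc σ i) {g : Sp n K} (hg : Mono g σ) :
    whitSum l ψ y g = -(Nat.card K : R) * whitSum l ψ y (g * simpleElt K i) := by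
  have h1 := whitSum_panel l ψ hy g i
  have h2 : ∀ t : K, whitSum l ψ y (g * rootElt i t * simpleElt K i) =
      whitSum l ψ y (g * simpleElt K i) := by
    intro t
    have h3 := whitSum_mul l ψ y (conj_rootElt_mem hσ hi hg t) (g * simpleElt K i)
    have h4 : g * rootElt i t * g⁻¹ ∈ triUni K (rk ∘ σ.symm) :=
      hg.conj_mem_triUni (by convert rootElt_mem_rk i t using 2; funext x; simp)
    rw [h.conj_val l ψ h4, one_mul] at h3
    rw [← h3]
    congr 1
    group
  rw [Finset.sum_congr rfl fun t _ => h2 t, Finset.sum_const, nsmul_eq_mul, Finset.card_univ,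
    ← Nat.card_eq_fintype_card] at h1
  linear_combination h1

/-- Climbing from `σ` to the longest element collects one factor `-q` per step; admissibility
survives each step. -/
theorem whitSum_of_adm [Fintype K] {y : Sp n K → R} (hy : IsCycle y) {σ : Equiv.Perm (Fin n ⊕ Fin n)}
    (hσ : σ ∈ weylPerm n K) (h : Adm l ψ σ) {g : Sp n K} (hg : Mono g σ) :
    whitSum l ψ y g = ((weylSign K σ * weylSign K (Equiv.sumComm (Fin n) (Fin n)) : ℤˣ) : ℤ) *
      cellCard K σ * whitSum l ψ y (longElt n K) := by
  revert g h
  refine weyl_induction_desc (K := K) (P := fun σ => Adm l ψ σ → ∀ {g : Sp n K}, Mono g σ →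
    whitSum l ψ y g = ((weylSign K σ * weylSign K (Equiv.sumComm (Fin n) (Fin n)) : ℤˣ) : ℤ) *
      cellCard K σ * whitSum l ψ y (longElt n K)) ?_ ?_ σ hσ
  · intro _ g hg
    have h1 := whitSum_mul_borel l ψ hy (longElt n K)
      (torus_le_borel (mono_longElt.inv_mul_mem_torus hg))
    rw [mul_inv_cancel_left] at h1
    rw [h1, cellCard_sumComm, Int.units_mul_self]
    simp
  · intro σ hσ i hi hP h g hg
    rw [whitSum_asc l ψ hy hσ h hi hg, hP (h.mul_simplePerm hi hσ) (hg.mul (mono_simpleElt i)),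
      weylSign_mul hσ, cellCard_eq_mul hσ hi]
    push_cast
    ring

/-- Left translation by a root element for the `l`-th simple root amounts to right translation
by an element of the Borel subgroup. -/
theorem eq_zero_of_not_adm [IsDomain R] {f : Sp n K → R} (hf : ∀ g, ∀ b ∈ borel n K, f (g * b) = f g)
    {σ : Equiv.Perm (Fin n ⊕ Fin n)} (hσ : σ ∈ weylPerm n K) {g : Sp n K} (hg : Mono g σ)
    (hl : ∀ t, ψ t * f (rootElt l t * g) = f g) (h : ¬ Adm l ψ σ) : f g = 0 := by
  simp only [Adm, not_or, not_not] at h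
  obtain ⟨h1, h2⟩ := h
  obtain ⟨t, ht⟩ := (AddChar.ne_one_iff).1 h1
  have h3 := conj_rootElt_mem (inv_mem hσ) h2 hg.inv t
  have h4 := hf g _ (triUni_rk_le h3)
  rw [inv_inv, mul_assoc g⁻¹, mul_inv_cancel_left] at h4
  have h5 := hl t
  rw [h4] at h5
  by_contra h0
  exact ht ((mul_eq_right₀ h0).1 h5)

theorem whitSum_of_not_adm [Fintype K] [IsDomain R] {y : Sp n K → R} (hy : IsCycle y)
    {σ : Equiv.Perm (Fin n ⊕ Fin n)} (hσ : σ ∈ weylPerm n K) (h : ¬ Adm l ψ σ) {g : Sp n K}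
    (hg : Mono g σ) : whitSum l ψ y g = 0 := by
  refine eq_zero_of_not_adm l ψ (f := whitSum l ψ y) (fun g b hb => whitSum_mul_borel l ψ hy g hb)
    hσ hg (fun t => ?_) h
  have := whitSum_mul l ψ y (rootElt_mem_rk l t) g
  rwa [rootElt_low_high] at this

variable (n K) in
/-- The element of the Steinberg module obtained from `e` by weighted summation over `U`. -/
def whitElt : MonoidAlgebra R (Sp n K) :=
  (∑ u : triUni K (rk (n := n)), MonoidAlgebra.single u.1 (ψ (u.1.1 (lowIdx l) (highIdx l)))) *
    steinbergElt n K R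

theorem whitElt_mem : whitElt n K l ψ ∈ steinberg n K R :=
  Submodule.smul_mem _ _ (Submodule.mem_span_singleton_self _)

theorem pairing_sum_left {ι : Type*} (s : Finset ι) (x : ι → MonoidAlgebra R (Sp n K))
    (y : MonoidAlgebra R (Sp n K)) : pairing (∑ i ∈ s, x i) y = ∑ i ∈ s, pairing (x i) y := by
  simp only [pairing_eq_sum]
  rw [Finset.sum_comm]
  refine Finset.sum_congr rfl fun g _ => ?_
  rw [MonoidAlgebra.coeff_sum, Finsupp.finsetSum_apply, Finset.sum_mul]

theorem pairing_steinbergElt {z : MonoidAlgebra R (Sp n K)}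
    (hz : ∀ g, ∀ b ∈ borel n K, z.coeff (g * b) = z.coeff g) :
    pairing (steinbergElt n K R) z = (Nat.card (borel n K) : R) *
      ∑ σ : weylPerm n K, ((weylSign K σ.1 : ℤ) : R) * z.coeff (repElt σ) := by
  classical
  rw [pairing_eq_sum]
  simp only [coeff_steinbergElt, Finset.sum_mul]
  rw [Finset.sum_comm, Finset.mul_sum]
  refine Finset.sum_congr rfl fun σ _ => ?_
  simp only [mul_assoc]
  rw [← Finset.mul_sum, mul_left_comm]
  congr 1
  rw [← Equiv.sum_comp (Equiv.mulLeft (repElt σ))]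
  simp only [Equiv.coe_mulLeft, inv_mul_cancel_left, ite_mul, one_mul, zero_mul]
  rw [← Finset.sum_filter, Finset.sum_congr rfl (g := fun _ => z.coeff (repElt σ)), Finset.sum_const,
    nsmul_eq_mul, Nat.card_eq_fintype_card, Fintype.card_subtype]
  intro b hb
  exact hz _ b (Finset.mem_filter.1 hb).2

variable (n K) in
open Classical in
/-- The number by which the pairing with `whitElt` differs from the sum at the longest element. -/
def whitIndex : ℕ := ∑ σ : weylPerm n K, if Adm l ψ σ.1 then cellCard K σ.1 else 0

/-- Moved across the pairing, the elements of `U` turn it into the signed sum of the weighted sums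
of `y` at the `n_σ`. The nonadmissible terms vanish. In the others the sign of `σ` occurs twice, so
that the multiples `cellCard` of the common value add up without cancellation. -/
theorem pairing_whitElt [Fintype K] [IsDomain R] {y : MonoidAlgebra R (Sp n K)}
    (hy : y ∈ steinberg n K R) :
    pairing (whitElt n K l ψ) y = (Nat.card (borel n K) : R) *
      (((weylSign K (Equiv.sumComm (Fin n) (Fin n)) : ℤ) : R) * whitIndex n K l ψ *
        whitSum l ψ y.coeff (longElt n K)) := by
  classical
  have hc := isCycle_of_mem hy
  rw [whitElt, Finset.sum_mul, pairing_sum_left]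
  simp only [pairing_single_mul]
  have h1 : ∀ u : Sp n K, pairing (steinbergElt n K R) (MonoidAlgebra.single u⁻¹ 1 * y) =
      (Nat.card (borel n K) : R) *
        ∑ σ : weylPerm n K, ((weylSign K σ.1 : ℤ) : R) * y.coeff (u * repElt σ) := by
    intro u
    rw [pairing_steinbergElt]
    · simp only [MonoidAlgebra.coeff_single_mul_apply, inv_inv, one_mul]
    · intro g b hb
      simp only [MonoidAlgebra.coeff_single_mul_apply, inv_inv, one_mul]
      rw [← mul_assoc, hc.mul_borel _ b hb]
  simp only [h1, mul_left_comm _ (Nat.card (borel n K) : R)]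
  rw [← Finset.mul_sum]
  congr 1
  simp only [Finset.mul_sum]
  rw [Finset.sum_comm, whitIndex, Nat.cast_sum, Finset.mul_sum, Finset.sum_mul]
  refine Finset.sum_congr rfl fun σ _ => ?_
  have h2 : ∑ u : triUni K (rk (n := n)), ψ (u.1.1 (lowIdx l) (highIdx l)) *
      (((weylSign K σ.1 : ℤ) : R) * y.coeff (u * repElt σ)) =
      ((weylSign K σ.1 : ℤ) : R) * whitSum l ψ y.coeff (repElt σ) := by
    rw [whitSum, Finset.mul_sum]
    exact Finset.sum_congr rfl fun u _ => mul_left_comm _ _ _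
  rw [h2]
  split_ifs with h
  · rw [whitSum_of_adm l ψ hc σ.2 h (mono_repElt σ)]
    have h3 : ((weylSign K σ.1 : ℤ) : R) * ((weylSign K σ.1 : ℤ) : R) = 1 := by
      rw [← Int.cast_mul, ← Units.val_mul, Int.units_mul_self]; simp
    push_cast
    linear_combination ((weylSign K (Equiv.sumComm (Fin n) (Fin n)) : ℤ) : R) * cellCard K σ.1 *
      whitSum l ψ y.coeff (longElt n K) * h3
  · rw [whitSum_of_not_adm l ψ hc σ.2 h (mono_repElt σ)]
    simp

theorem whitIndex_one : whitIndex n K l (1 : AddChar K R) = (borel n K).index := by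
  classical
  rw [index_borel, whitIndex]
  exact Finset.sum_congr rfl fun σ _ => if_pos (Or.inl rfl)

/-- Pair `σ` with its left multiple by the `l`-th simple reflection. Exactly one of the two is
admissible, and the other has a `cellCard` larger by the factor `q`, so all cells together count `q
+ 1` times the admissible ones. -/
theorem whitIndex_mul (hψ : ψ ≠ 1) : (Nat.card K + 1) * whitIndex n K l ψ = (borel n K).index := by
  classical
  let s : weylPerm n K := ⟨simplePerm l, simplePerm_mem l⟩
  have h1 : whitIndex n K l ψ = ∑ σ : weylPerm n K, if Asc σ.1⁻¹ l then 0 else cellCard K σ.1 := by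
    refine Finset.sum_congr rfl fun σ _ => ?_
    by_cases h : Asc σ.1⁻¹ l <;> simp [Adm, h, hψ]
  have h2 : Nat.card K * whitIndex n K l ψ =
      ∑ σ : weylPerm n K, if Asc σ.1⁻¹ l then cellCard K σ.1 else 0 := by
    rw [h1, ← Equiv.sum_comp (Equiv.mulLeft s), Finset.mul_sum]
    refine Finset.sum_congr rfl fun σ _ => ?_
    have e : (s * σ).1⁻¹ = σ.1⁻¹ * simplePerm l := by
      change (simplePerm l * σ.1)⁻¹ = _
      rw [_root_.mul_inv_rev, simplePerm_inv]
    rw [Equiv.coe_mulLeft, e, asc_or_asc_mul]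
    by_cases h : Asc σ.1⁻¹ l
    -- Invariance of `cellCard` under inversion turns left multiplication into right multiplication.
    · rw [if_neg (not_not.2 h), if_pos h, ← cellCard_inv σ.2, cellCard_eq_mul (inv_mem σ.2) h,
        ← cellCard_inv (s * σ).2, e]
    · rw [if_pos h, if_neg h, mul_zero]
  rw [add_mul, one_mul, h2, h1, ← Finset.sum_add_distrib, index_borel]
  refine Finset.sum_congr rfl fun σ _ => ?_
  split_ifs <;> simp

theorem coeff_whitElt (g : Sp n K) : (whitElt n K l ψ).coeff g =
    ∑ u : triUni K (rk (n := n)), ψ (u.1.1 (lowIdx l) (highIdx l)) *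
      (steinbergElt n K R).coeff (u⁻¹ * g) := by
  rw [whitElt, Finset.sum_mul, MonoidAlgebra.coeff_sum, Finsupp.finsetSum_apply]
  simp only [MonoidAlgebra.coeff_single_mul_apply]
  rfl

theorem coeff_whitElt_mul {v : Sp n K} (hv : v ∈ triUni K (rk (n := n))) (g : Sp n K) :
    (whitElt n K l ψ).coeff (v * g) = ψ (v.1 (lowIdx l) (highIdx l)) * (whitElt n K l ψ).coeff g := by
  rw [coeff_whitElt, coeff_whitElt, Finset.mul_sum]
  refine (Fintype.sum_equiv (Equiv.mulLeft (⟨v, hv⟩ : triUni K (rk (n := n)))) _ _ fun u => ?_).symm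
  have := val_mul_triUni l ψ hv u.2
  change _ = ψ ((v * u.1).1 _ _) * (steinbergElt n K R).coeff ((v * u.1)⁻¹ * (v * g))
  have e : (v * u.1)⁻¹ * (v * g) = u.1⁻¹ * g := by group
  rw [this, e, mul_assoc]
  rfl

theorem coeff_whitElt_mul_borel (g : Sp n K) {b : Sp n K} (hb : b ∈ borel n K) :
    (whitElt n K l ψ).coeff (g * b) = (whitElt n K l ψ).coeff g := by
  have := Fintype.ofFinite K
  exact (isCycle_of_mem (whitElt_mem l ψ)).mul_borel g b hb

theorem coeff_whitElt_repElt_of_not_adm [IsDomain R] (σ : weylPerm n K) (h : ¬ Adm l ψ σ.1) :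
    (whitElt n K l ψ).coeff (repElt σ) = 0 := by
  -- The coefficients transform by `ψ` under left translation, so the vanishing criterion is applied
  -- to the inverse character.
  refine eq_zero_of_not_adm l ψ⁻¹ (f := fun g => (whitElt n K l ψ).coeff g)
    (fun g b hb => coeff_whitElt_mul_borel l ψ g hb) σ.2 (mono_repElt σ) (fun t => ?_) ?_
  · rw [coeff_whitElt_mul l ψ (rootElt_mem_rk l t), rootElt_low_high, ← mul_assoc, AddChar.inv_apply,
      ← AddChar.map_add_eq_mul]
    simp
  · unfold Adm
    rwa [inv_eq_one]

/-- By disjointness of the Bruhat cells, `u⁻¹ n_σ` meets the support of `e` only in `n_σ B`, and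
this happens for `u ∈ U ∩ σ U σ⁻¹`, where `ψ` is `1`. -/
theorem coeff_whitElt_repElt_of_adm (σ : weylPerm n K) (h : Adm l ψ σ.1) :
    (whitElt n K l ψ).coeff (repElt σ) = ((weylSign K σ.1 : ℤ) : R) * cellCard K σ.1 := by
  classical
  have h1 : ∀ u : triUni K (rk (n := n)), (steinbergElt n K R).coeff (u⁻¹.1 * repElt σ) =
      ((weylSign K σ.1 : ℤ) : R) * if u.1 ∈ triUni K (rk ∘ σ.1.symm) then 1 else 0 := by
    intro u
    rw [coeff_steinbergElt, Finset.sum_eq_single σ]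
    · have h2 := inv_repElt_mul_mem_borel_iff σ (inv_mem u.2)
      rw [Subgroup.mem_inf, inv_mem_iff, inv_mem_iff (x := u.1)] at h2
      simp only [u.2, true_and] at h2
      rw [← mul_assoc, Subgroup.coe_inv]
      simp only [h2]
    · intro τ _ hτ
      rw [if_neg, mul_zero]
      intro hm
      refine hτ (Subtype.ext ((mono_repElt τ).eq_of_inv_mul_mem_borel (mono_repElt σ)
        (triUni_rk_le (inv_mem u.2)) ?_))
      rwa [mul_assoc]
    · simp
  rw [coeff_whitElt]
  have h2 : ∀ u : triUni K (rk (n := n)), ψ (u.1.1 (lowIdx l) (highIdx l)) *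
      (steinbergElt n K R).coeff (u⁻¹.1 * repElt σ) =
      ((weylSign K σ.1 : ℤ) : R) * if u.1 ∈ triUni K (rk ∘ σ.1.symm) then 1 else 0 := by
    intro u
    rw [h1]
    split_ifs with hu
    · rw [h.conj_val l ψ hu, one_mul]
    · simp
  rw [Finset.sum_congr rfl fun u _ => h2 u, ← Finset.mul_sum, Finset.sum_boole, cellCard,
    ← Fintype.card_subtype, ← Nat.card_eq_fintype_card]
  congr 2
  exact Nat.card_congr (Equiv.subtypeSubtypeEquivSubtypeInter (· ∈ triUni K (rk (n := n)))
    (· ∈ triUni K (rk ∘ σ.1.symm)))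

end Whittaker

/-! ### Two elements of the reduced filtration -/

section Filtration

variable {n : ℕ} {K : Type*} [Field K] {R : Type*} [CommRing R]

section Reduction

variable {F : Type*} [Field F] (φ : R →+* F)

/-- The reduction of an additive character. -/
def redChar (ψ : AddChar K R) : AddChar K F := (φ : R →* F).compAddChar ψ

theorem redChar_apply (ψ : AddChar K R) (t : K) : redChar φ ψ t = φ (ψ t) := rfl

theorem coeff_mapRingHom_single_mul (g : Sp n K) (y : MonoidAlgebra R (Sp n K)) :
    MonoidAlgebra.single g (1 : F) * MonoidAlgebra.mapRingHom (Sp n K) φ y =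
      MonoidAlgebra.mapRingHom (Sp n K) φ (MonoidAlgebra.single g 1 * y) := by
  rw [map_mul, MonoidAlgebra.mapRingHom_single, map_one]

end Reduction

variable [Finite K]

/-- A function on the group as an element of the group algebra. -/
def ofFun (θ : Sp n K → R) : MonoidAlgebra R (Sp n K) := ∑ g, MonoidAlgebra.single g (θ g)

@[simp] theorem coeff_ofFun (θ : Sp n K → R) (g : Sp n K) : (ofFun θ).coeff g = θ g := by
  classical
  rw [ofFun, MonoidAlgebra.coeff_sum, Finsupp.finsetSum_apply]
  simp [Finsupp.single_apply]

variable [IsDomain R] [CharZero R] (l : Fin n) (ψ : AddChar K R)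

theorem whitElt_mem_gowLattice_of_dvd {k : ℕ} (h : 2 ^ k ∣ whitIndex n K l ψ) :
    whitElt n K l ψ ∈ gowLattice n K R k := by
  have := Fintype.ofFinite K
  refine ⟨whitElt_mem l ψ, fun y hy => ?_⟩
  rw [pairing_whitElt l ψ hy]
  refine mul_dvd_mul_left _ (Dvd.dvd.mul_right (Dvd.dvd.mul_left ?_ _) _)
  have := Nat.cast_dvd_cast (α := R) h
  simpa using this

theorem whitElt_one_mem : whitElt n K l (1 : AddChar K R) ∈
    gowLattice n K R (padicValNat 2 (borel n K).index) :=
  whitElt_mem_gowLattice_of_dvd l 1 (by rw [whitIndex_one]; exact pow_padicValNat_dvd)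

variable {ψ} in
-- This is where `q ≡ 1 mod 4` enters: `q + 1` is twice an odd number, so dividing the index by it
-- costs a single factor `2`.
theorem whitElt_mem_pred (hq : Nat.card K % 4 = 1) (hψ : ψ ≠ 1) : whitElt n K l ψ ∈
    gowLattice n K R (padicValNat 2 (borel n K).index - 1) := by
  refine whitElt_mem_gowLattice_of_dvd l ψ ?_
  have h1 : 2 ^ padicValNat 2 (borel n K).index ∣ (borel n K).index := pow_padicValNat_dvd
  -- If the exponent is `0`, the truncated subtraction leaves `2 ^ 0 = 1` to divide.
  rcases Nat.eq_zero_or_pos (padicValNat 2 (borel n K).index) with h0 | h0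
  · simp [h0]
  · obtain ⟨m, hm⟩ : ∃ m, Nat.card K + 1 = 2 * m := ⟨(Nat.card K + 1) / 2, by omega⟩
    have hodd : Nat.Coprime (2 ^ (padicValNat 2 (borel n K).index - 1)) m :=
      Nat.Coprime.pow_left _ ((Nat.coprime_two_left).2 (Nat.odd_iff.2 (by omega)))
    refine hodd.dvd_of_dvd_mul_left ?_
    have h2 := whitIndex_mul l ψ hψ
    rw [hm, mul_assoc] at h2
    rw [← Nat.sub_add_cancel h0, pow_succ'] at h1
    have h1 := h1.trans (dvd_of_eq h2.symm)
    exact Nat.dvd_of_mul_dvd_mul_left two_pos h1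

variable {F : Type*} [Field F] [CharP F 2] (φ : R →+* F)

theorem natCast_eq_one_of_odd {m : ℕ} (h : Odd m) : (m : F) = 1 := by
  obtain ⟨k, rfl⟩ := h
  push_cast
  rw [CharTwo.two_eq_zero, zero_mul, zero_add]

theorem units_cast_eq_one (a : ℤˣ) : ((a : ℤ) : F) = 1 := by
  rcases Int.units_eq_one_or a with rfl | rfl
  · simp
  · simp [CharTwo.neg_eq]

variable {ψ} in
-- Let `S` be the weighted sum, `c` the integer `whitIndex` and `m` the odd part of the index, so
-- `(q + 1) c = 2 ^ κ m`. From `± c S = 2 ^ κ z` one gets `± m S = (q + 1) z`, where `m` is odd and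
-- `q + 1` is even.
theorem map_whitSum_eq_zero (hq : Odd (Nat.card K)) (hψ : ψ ≠ 1) {y : MonoidAlgebra R (Sp n K)}
    (hy : y ∈ gowLattice n K R (padicValNat 2 (borel n K).index)) :
    φ (whitSum l ψ y.coeff (longElt n K)) = 0 := by
  have := Fintype.ofFinite K
  set k := padicValNat 2 (borel n K).index with hk
  obtain ⟨z, hz⟩ := hy.2 _ (whitElt_mem l ψ)
  rw [pairing_comm, pairing_whitElt l ψ hy.1, mul_assoc (Nat.card (borel n K) : R)] at hz
  have hB : (Nat.card (borel n K) : R) ≠ 0 := Nat.cast_ne_zero.2 Nat.card_pos.ne'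
  have hz := mul_left_cancel₀ hB hz
  have hidx : (borel n K).index ≠ 0 := Subgroup.index_ne_zero_of_finite
  obtain ⟨m, hm⟩ : 2 ^ k ∣ (borel n K).index := pow_padicValNat_dvd
  have hmodd : Odd m := by
    rw [← Nat.not_even_iff_odd, even_iff_two_dvd]
    intro h2
    refine pow_succ_padicValNat_not_dvd (p := 2) hidx ?_
    rw [← hk, hm, pow_succ]
    exact mul_dvd_mul_left _ h2
  have hc := whitIndex_mul l ψ hψ
  rw [hm] at hc
  have hc' : ((Nat.card K : R) + 1) * (whitIndex n K l ψ : R) = 2 ^ k * m := by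
    exact_mod_cast congrArg (Nat.cast (R := R)) hc
  have h2 : (2 : R) ^ k ≠ 0 := pow_ne_zero _ two_ne_zero
  have key : ((weylSign K (Equiv.sumComm (Fin n) (Fin n)) : ℤ) : R) * m *
      whitSum l ψ y.coeff (longElt n K) = ((Nat.card K : R) + 1) * z := by
    refine mul_left_cancel₀ h2 ?_
    linear_combination ((Nat.card K : R) + 1) * hz -
      ((weylSign K (Equiv.sumComm (Fin n) (Fin n)) : ℤ) : R) * whitSum l ψ y.coeff (longElt n K) * hc'
  have := congrArg φ key
  simpa only [map_mul, map_add, map_one, map_intCast, map_natCast, units_cast_eq_one,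
    natCast_eq_one_of_odd hmodd, natCast_eq_one_of_odd hq, CharTwo.add_self_eq_zero, one_mul,
    zero_mul] using this

variable {ψ φ} in
theorem whitSum_eq_zero_of_mem_gowFiltration (hq : Odd (Nat.card K)) (hψ : ψ ≠ 1)
    {z : MonoidAlgebra F (Sp n K)}
    (hz : z ∈ gowFiltration n K φ (padicValNat 2 (borel n K).index)) :
    whitSum l (redChar φ ψ) z.coeff (longElt n K) = 0 := by
  have hadd : ∀ a b : MonoidAlgebra F (Sp n K), whitSum l (redChar φ ψ) (a + b).coeff (longElt n K) =
      whitSum l (redChar φ ψ) a.coeff (longElt n K) + whitSum l (redChar φ ψ) b.coeff (longElt n K) := by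
    intro a b
    simp only [whitSum, MonoidAlgebra.coeff_add, Finsupp.add_apply, mul_add, Finset.sum_add_distrib]
  have hsmul : ∀ (r : F) (g : Sp n K) (a : MonoidAlgebra F (Sp n K)),
      whitSum l (redChar φ ψ) (MonoidAlgebra.single g r * a).coeff (longElt n K) =
      r * whitSum l (redChar φ ψ) (MonoidAlgebra.single g 1 * a).coeff (longElt n K) := by
    intro r g a
    simp only [whitSum, MonoidAlgebra.coeff_single_mul_apply, Finset.mul_sum]
    exact Finset.sum_congr rfl fun u _ => by ring
  have hzero : whitSum l (redChar φ ψ) (0 : MonoidAlgebra F (Sp n K)).coeff (longElt n K) = 0 := by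
    simp [whitSum]
  -- The sum at one group element is not invariant under translation, so all multiples of `z` are
  -- treated at once to make induction over the span possible.
  suffices ∀ a : MonoidAlgebra F (Sp n K),
      whitSum l (redChar φ ψ) (a * z).coeff (longElt n K) = 0 by
    simpa using this 1
  rw [gowFiltration] at hz
  induction hz using Submodule.span_induction with
  | mem z hz =>
    obtain ⟨y, hy, rfl⟩ := hz
    intro a
    induction a using MonoidAlgebra.induction_linear with
    | zero => rw [zero_mul, hzero]
    | add a b ha hb => rw [add_mul, hadd, ha, hb, add_zero]
    | single g r =>
      have h1 := map_whitSum_eq_zero l φ hq hψ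
        (Submodule.smul_mem _ (MonoidAlgebra.single g (1 : R)) hy)
      rw [hsmul, coeff_mapRingHom_single_mul]
      rw [whitSum, map_sum] at h1
      rw [whitSum, Finset.sum_congr rfl fun u _ => ?_, h1, mul_zero]
      rw [redChar_apply, MonoidAlgebra.coeff_mapRingHom, map_mul φ]
      rfl
  | zero => intro a; rw [mul_zero, hzero]
  | add a b _ _ ha hb => intro c; rw [mul_add, hadd, ha, hb, add_zero]
  | smul c a _ ha => intro b; rw [smul_eq_mul, ← mul_assoc]; exact ha _

/-- The reduction of `whitElt` is determined by its invariance properties. -/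
theorem map_whitElt (hq : Odd (Nat.card K)) (hψ : ψ = 1 ∨ redChar φ ψ ≠ 1) (θ : Sp n K → F)
    (hB : ∀ g, ∀ b ∈ borel n K, θ (g * b) = θ g)
    (hU : ∀ u ∈ triUni K (rk (n := n)), ∀ g, θ (u * g) = redChar φ ψ (u.1 (lowIdx l) (highIdx l)) * θ g)
    (hθ : ∀ σ : weylPerm n K, Adm l ψ σ.1 → θ (repElt σ) = 1) :
    MonoidAlgebra.mapRingHom (Sp n K) φ (whitElt n K l ψ) = ofFun θ := by
  ext g
  obtain ⟨u, hu, σ, b, hb, rfl⟩ := bruhat g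
  rw [MonoidAlgebra.coeff_mapRingHom, coeff_ofFun,
    coeff_whitElt_mul_borel l ψ _ hb, hB _ b hb, coeff_whitElt_mul l ψ hu, hU u hu, map_mul, redChar_apply]
  congr 1
  -- On admissible cells the signs and the powers of the odd number `q` become `1`; on the others
  -- both sides vanish because of their transformation behaviour.
  by_cases h : Adm l ψ σ.1
  · rw [hθ σ h, coeff_whitElt_repElt_of_adm l ψ σ h]
    simp [units_cast_eq_one, natCast_eq_one_of_odd (odd_cellCard hq σ.2)]
  · rw [coeff_whitElt_repElt_of_not_adm l ψ σ h, map_zero]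
    have hχ : redChar φ ψ ≠ 1 := hψ.resolve_left fun e => h (Or.inl e)
    refine (eq_zero_of_not_adm l (redChar φ ψ)⁻¹ hB σ.2 (mono_repElt σ) (fun t => ?_) ?_).symm
    · rw [hU _ (rootElt_mem_rk l t), rootElt_low_high, ← mul_assoc, AddChar.inv_apply,
        ← AddChar.map_add_eq_mul]
      simp
    · simp only [Adm, not_or, inv_eq_one] at h ⊢
      exact ⟨hχ, h.2⟩

theorem ofFun_one_mem (hq : Odd (Nat.card K)) (l : Fin n) :
    ofFun (fun _ => 1) ∈ gowFiltration n K φ (padicValNat 2 (borel n K).index) := by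
  rw [← map_whitElt l (1 : AddChar K R) φ hq (Or.inl rfl) (fun _ => 1) (fun _ _ _ => rfl)
    (fun u _ _ => by rw [redChar_apply]; simp) (fun _ _ => rfl)]
  exact Submodule.subset_span ⟨_, whitElt_one_mem l, rfl⟩

variable {ψ φ} in
-- The weight `ψ⁻¹` cancels the character by which the function transforms, so its weighted sum at
-- the longest element is `|U| = 1` in `F`, whereas this sum is zero on the lower term.
theorem ofFun_mem_gowFiltration (hq : Nat.card K % 4 = 1) (hψ : redChar φ ψ ≠ 1) (θ : Sp n K → F)
    (hB : ∀ g, ∀ b ∈ borel n K, θ (g * b) = θ g)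
    (hU : ∀ u ∈ triUni K (rk (n := n)), ∀ g, θ (u * g) = redChar φ ψ (u.1 (lowIdx l) (highIdx l)) * θ g)
    (hθ : ∀ σ : weylPerm n K, ¬ Asc σ.1⁻¹ l → θ (repElt σ) = 1) :
    ofFun θ ∈ gowFiltration n K φ (padicValNat 2 (borel n K).index - 1) ∧
      ofFun θ ∉ gowFiltration n K φ (padicValNat 2 (borel n K).index) := by
  have hq' : Odd (Nat.card K) := Nat.odd_iff.2 (by omega)
  have hψ1 : ψ ≠ 1 := by
    rintro rfl
    refine hψ (DFunLike.ext _ _ fun t => ?_)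
    rw [redChar_apply]; simp
  constructor
  · rw [← map_whitElt l ψ φ hq' (Or.inr hψ) θ hB hU fun σ h => hθ σ (h.resolve_left hψ1)]
    exact Submodule.subset_span ⟨_, whitElt_mem_pred l hq hψ1, rfl⟩
  · intro h
    have h1 := whitSum_eq_zero_of_mem_gowFiltration l hq' (inv_ne_one.2 hψ1) h
    have h2 : ∀ u : triUni K (rk (n := n)), redChar φ ψ⁻¹ (u.1.1 (lowIdx l) (highIdx l)) *
        (ofFun θ).coeff (u * longElt n K) = 1 := by
      intro u
      have hw : θ (longElt n K) = 1 := by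
        let w : weylPerm n K := ⟨Equiv.sumComm (Fin n) (Fin n), sumComm_mem⟩
        have h3 : ¬ Asc w.1⁻¹ l := by
          change ¬ rk (Sum.swap (lowIdx l)) < rk (Sum.swap (highIdx l))
          have := l.2
          rw [rk_swap, rk_swap, rk_lowIdx, rk_highIdx]
          omega
        have h4 := hB (repElt w) _ (torus_le_borel ((mono_repElt w).inv_mul_mem_torus mono_longElt))
        rwa [mul_inv_cancel_left, hθ w h3] at h4
      rw [coeff_ofFun, hU u u.2, hw, mul_one, redChar_apply, redChar_apply, ← map_mul,
        ← AddChar.mul_apply, inv_mul_cancel]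
      simp
    rw [whitSum, Finset.sum_congr rfl fun u _ => h2 u, Finset.sum_const, nsmul_one, Finset.card_univ,
      ← Nat.card_eq_fintype_card, ← cellCard_one,
      natCast_eq_one_of_odd (odd_cellCard hq' (one_mem _))] at h1
    exact one_ne_zero h1

end Filtration

/-! ### Weil operators -/

section WeilOperators

variable {n : ℕ} {K : Type*} [Field K] [Fintype K] [DecidableEq K] {R : Type*} [CommRing R]

/-- The matrix of the Schrödinger operator `J(0, x)`, over an arbitrary ring. -/
def schMat (ψ : AddChar K R) (x : Fin n ⊕ Fin n → K) : Matrix (Fin n → K) (Fin n → K) R :=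
  of fun a b => if a = b + x ∘ Sum.inr then ψ ((x ∘ Sum.inl) ⬝ᵥ (x ∘ Sum.inr + (2 : K) • b)) else 0

theorem mul_schMat (ψ : AddChar K R) (x : Fin n ⊕ Fin n → K) (T : Matrix (Fin n → K) (Fin n → K) R)
    (a b : Fin n → K) : (T * schMat ψ x) a b =
      T a (b + x ∘ Sum.inr) * ψ ((x ∘ Sum.inl) ⬝ᵥ (x ∘ Sum.inr + (2 : K) • b)) := by
  rw [Matrix.mul_apply, Finset.sum_eq_single (b + x ∘ Sum.inr)]
  · simp [schMat]
  · intro c _ hc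
    simp [schMat, hc]
  · simp

theorem schMat_mul (ψ : AddChar K R) (x : Fin n ⊕ Fin n → K) (T : Matrix (Fin n → K) (Fin n → K) R)
    (a b : Fin n → K) : (schMat ψ x * T) a b =
      ψ ((x ∘ Sum.inl) ⬝ᵥ ((2 : K) • a - x ∘ Sum.inr)) * T (a - x ∘ Sum.inr) b := by
  rw [Matrix.mul_apply, Finset.sum_eq_single (a - x ∘ Sum.inr)]
  · simp only [schMat, of_apply, sub_add_cancel, if_true]
    congr 3
    rw [smul_sub, two_smul K (x ∘ Sum.inr)]
    abel
  · intro c _ hc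
    have : a ≠ c + x ∘ Sum.inr := fun e => hc (by rw [e, add_sub_cancel_right])
    simp [schMat, this]
  · simp

/-- `T` carries the Schrödinger operator of `x` to that of `g x`. -/
def Intw (ψ : AddChar K R) (g : Sp n K) (T : Matrix (Fin n → K) (Fin n → K) R) : Prop :=
  ∀ x, T * schMat ψ x = schMat ψ (g.1 *ᵥ x) * T

theorem intw_iff {ψ : AddChar K R} {g : Sp n K} {T : Matrix (Fin n → K) (Fin n → K) R} :
    Intw ψ g T ↔ ∀ x a b, T a (b + x ∘ Sum.inr) *
      ψ ((x ∘ Sum.inl) ⬝ᵥ (x ∘ Sum.inr + (2 : K) • b)) =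
      ψ (((g.1 *ᵥ x) ∘ Sum.inl) ⬝ᵥ ((2 : K) • a - (g.1 *ᵥ x) ∘ Sum.inr)) *
        T (a - (g.1 *ᵥ x) ∘ Sum.inr) b := by
  refine forall_congr' fun x => ?_
  rw [← Matrix.ext_iff]
  simp only [mul_schMat, schMat_mul]

variable {ψ : AddChar K R}

theorem Intw.mul {g h : Sp n K} {S T : Matrix (Fin n → K) (Fin n → K) R} (hS : Intw ψ g S)
    (hT : Intw ψ h T) : Intw ψ (g * h) (S * T) := fun x => by
  rw [mul_assoc, hT x, ← mul_assoc, hS, mul_assoc, mulVec_mulVec]; rfl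

theorem Intw.smul {g : Sp n K} {T : Matrix (Fin n → K) (Fin n → K) R} (hT : Intw ψ g T) (c : R) :
    Intw ψ g (c • T) := fun x => by
  rw [Matrix.smul_mul, hT x, Matrix.mul_smul]

theorem Intw.inv {g : Sp n K} {T : (Matrix (Fin n → K) (Fin n → K) R)ˣ} (hT : Intw ψ g T.1) :
    Intw ψ g⁻¹ (T⁻¹).1 := fun x => by
  have h := hT ((g⁻¹).1 *ᵥ x)
  have e : g.1 *ᵥ ((g⁻¹).1 *ᵥ x) = x := by
    rw [mulVec_mulVec]
    have : g.1 * (g⁻¹).1 = (g * g⁻¹).1 := rfl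
    rw [this, mul_inv_cancel]
    exact one_mulVec x
  rw [e] at h
  rw [Units.inv_mul_eq_iff_eq_mul, ← mul_assoc, h, mul_assoc, Units.mul_inv, mul_one]

theorem intw_unip (S : Matrix (Fin n) (Fin n) K) (hS : Sᵀ = S) :
    Intw ψ (unip S hS) (diagonal fun w => ψ (w ⬝ᵥ S *ᵥ w)) := by
  rw [intw_iff]
  intro x a b
  rw [coe_unip, fromBlocks_mulVec]
  simp only [Sum.elim_comp_inl, Sum.elim_comp_inr, one_mulVec, zero_mulVec, zero_add]
  set u := x ∘ Sum.inl
  set v := x ∘ Sum.inr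
  rcases eq_or_ne a (b + v) with rfl | h
  · rw [add_sub_cancel_right, diagonal_apply_eq, diagonal_apply_eq, ← AddChar.map_add_eq_mul,
      ← AddChar.map_add_eq_mul]
    congr 1
    have hs : b ⬝ᵥ S *ᵥ v = v ⬝ᵥ S *ᵥ b := by
      rw [dotProduct_mulVec, ← mulVec_transpose, hS, dotProduct_comm]
    have hs' : S *ᵥ v ⬝ᵥ b = v ⬝ᵥ S *ᵥ b := by rw [dotProduct_comm, hs]
    have hs'' : S *ᵥ v ⬝ᵥ v = v ⬝ᵥ S *ᵥ v := dotProduct_comm _ _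
    simp only [mulVec_add, dotProduct_add, add_dotProduct, dotProduct_sub, dotProduct_smul, smul_eq_mul,
      hs, hs', hs'']
    ring
  · rw [diagonal_apply_ne _ h, diagonal_apply_ne _ (fun e => h (by rw [← e, sub_add_cancel])), zero_mul,
      mul_zero]

theorem intw_levi (A : GL (Fin n) K) :
    Intw ψ (levi A) (of fun a b => if a = ((A⁻¹).1)ᵀ *ᵥ b then 1 else 0) := by
  rw [intw_iff]
  intro x a b
  rw [coe_levi, fromBlocks_mulVec]
  simp only [Sum.elim_comp_inl, Sum.elim_comp_inr, zero_mulVec, zero_add, add_zero, of_apply]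
  set u := x ∘ Sum.inl
  set v := x ∘ Sum.inr
  rcases eq_or_ne a (((A⁻¹).1)ᵀ *ᵥ (b + v)) with rfl | h
  · rw [if_pos rfl, if_pos (by rw [mulVec_add, add_sub_cancel_right]), one_mul, mul_one]
    congr 1
    have e : (2 : K) • ((A⁻¹).1)ᵀ *ᵥ (b + v) - ((A⁻¹).1)ᵀ *ᵥ v = ((A⁻¹).1)ᵀ *ᵥ (v + (2 : K) • b) := by
      rw [mulVec_add, mulVec_add, mulVec_smul, smul_add, two_smul K (((A⁻¹).1)ᵀ *ᵥ v)]
      abel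
    rw [e, dotProduct_mulVec, vecMul_transpose, mulVec_mulVec]
    have : (A⁻¹).1 * A.1 = 1 := A.inv_mul
    rw [this, one_mulVec]
  · rw [if_neg h, if_neg, zero_mul, mul_zero]
    intro e
    exact h (by rw [mulVec_add, ← e, sub_add_cancel])

/-- The partial Fourier transform in the `j`-th coordinate. -/
def fourierMat (ψ : AddChar K R) (c : K) (j : Fin n) : Matrix (Fin n → K) (Fin n → K) R :=
  of fun a b => if ∀ i, i ≠ j → a i = b i then ψ (c * (a j * b j)) else 0

theorem flipElt_mulVec_inl (j : Fin n) (x : Fin n ⊕ Fin n → K) (i : Fin n) :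
    ((flipElt K j).1 *ᵥ x) (Sum.inl i) = if i = j then -x (Sum.inr j) else x (Sum.inl i) := by
  simp only [flipElt, fromBlocks_mulVec, Sum.elim_inl, Pi.add_apply, sub_mulVec, one_mulVec,
    neg_mulVec, single_mulVec, one_mul, Pi.sub_apply, Pi.neg_apply, Function.update_apply,
    Function.comp_apply, Pi.zero_apply]
  split_ifs with h
  · subst h; ring
  · ring

theorem flipElt_mulVec_inr (j : Fin n) (x : Fin n ⊕ Fin n → K) (i : Fin n) :
    ((flipElt K j).1 *ᵥ x) (Sum.inr i) = if i = j then x (Sum.inl j) else x (Sum.inr i) := by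
  simp only [flipElt, fromBlocks_mulVec, Sum.elim_inr, Pi.add_apply, sub_mulVec, one_mulVec,
    single_mulVec, one_mul, Pi.sub_apply, Function.update_apply,
    Function.comp_apply, Pi.zero_apply]
  split_ifs with h
  · subst h; ring
  · ring

/-- A flip exchanges translation and multiplication operators in one coordinate, as the Fourier
transform does. The constant `-2` matches the factor `2` in `⟨u, v + 2w⟩`. -/
theorem intw_flipElt (j : Fin n) : Intw ψ (flipElt K j) (fourierMat ψ (-2) j) := by
  rw [intw_iff]
  intro x a b
  simp only [fourierMat, of_apply, Pi.add_apply, Pi.sub_apply, Function.comp_apply, flipElt_mulVec_inr,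
    if_true]
  have hiff : (∀ i, i ≠ j → a i = b i + x (Sum.inr i)) ↔
      ∀ i, i ≠ j → (a i - if i = j then x (Sum.inl j) else x (Sum.inr i)) = b i :=
    forall_congr' fun i => forall_congr' fun hi => by rw [if_neg hi, sub_eq_iff_eq_add]
  by_cases h : ∀ i, i ≠ j → a i = b i + x (Sum.inr i)
  · rw [if_pos h, if_pos (hiff.1 h), ← AddChar.map_add_eq_mul, ← AddChar.map_add_eq_mul]
    congr 1
    simp only [dotProduct, Function.comp_apply, Pi.add_apply, Pi.sub_apply, Pi.smul_apply, smul_eq_mul,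
      flipElt_mulVec_inl, flipElt_mulVec_inr]
    rw [← Finset.add_sum_erase _ _ (Finset.mem_univ j), ← Finset.add_sum_erase _ _ (Finset.mem_univ j),
      if_pos rfl, if_pos rfl]
    have hs : ∑ i ∈ Finset.univ.erase j, x (Sum.inl i) * (x (Sum.inr i) + 2 * b i) =
        ∑ i ∈ Finset.univ.erase j, (if i = j then -x (Sum.inr j) else x (Sum.inl i)) *
          (2 * a i - if i = j then x (Sum.inl j) else x (Sum.inr i)) := by
      refine Finset.sum_congr rfl fun i hi => ?_
      have hi := Finset.ne_of_mem_erase hi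
      rw [if_neg hi, if_neg hi, h i hi]
      ring
    rw [hs]
    ring
  · rw [if_neg h, if_neg (fun e => h (hiff.2 e)), zero_mul, mul_zero]

/-- Fourier inversion without normalization: orthogonality of characters leaves the factor `q`, so
invertibility over `R` requires `q` to be a unit. -/
theorem fourierMat_mul [IsDomain R] (hψ : ψ ≠ 1) (h2 : (2 : K) ≠ 0) (j : Fin n) :
    fourierMat ψ (-2) j * fourierMat ψ 2 j = (Fintype.card K : R) • 1 := by
  ext a b
  have hinj : Function.Injective fun t : K => Function.update a j t := Function.update_injective a j
  rw [Matrix.mul_apply, ← Finset.sum_subset (Finset.subset_univ (Finset.univ.image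
    fun t : K => Function.update a j t)), Finset.sum_image hinj.injOn]
  · simp only [fourierMat, of_apply, Function.update_self, Matrix.smul_apply, one_apply, smul_eq_mul]
    have h1 : ∀ t : K, ∀ i, i ≠ j → a i = Function.update a j t i := fun t i hi => by simp [hi]
    have h3 : ∀ t : K, (∀ i, i ≠ j → Function.update a j t i = b i) ↔ ∀ i, i ≠ j → a i = b i :=
      fun t => forall_congr' fun i => forall_congr' fun hi => by simp [hi]
    simp only [if_pos (h1 _), h3]
    by_cases h : ∀ i, i ≠ j → a i = b i
    · simp only [if_pos h]
      have h4 : ∀ t : K, ψ (-2 * (a j * t)) * ψ (2 * (t * b j)) = ψ (t * (2 * (b j - a j))) := by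
        intro t
        rw [← AddChar.map_add_eq_mul]
        congr 1
        ring
      rw [Finset.sum_congr rfl fun t _ => h4 t]
      rcases eq_or_ne a b with rfl | hab
      · simp
      · have hne : 2 * (b j - a j) ≠ 0 := by
          refine mul_ne_zero h2 (sub_ne_zero.2 fun e => hab (funext fun i => ?_))
          rcases eq_or_ne i j with rfl | hi
          · exact e.symm
          · exact h i hi
        rw [if_neg hab, mul_zero]
        have := AddChar.sum_eq_zero_of_ne_one hψ
        rw [← this]
        exact Fintype.sum_equiv (Equiv.mulRight₀ _ hne) _ _ fun t => rfl
    · rw [if_neg (fun e => h (fun i _ => by rw [e])), mul_zero]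
      exact Finset.sum_eq_zero fun t _ => by rw [if_neg h, mul_zero]
  · intro c _ hc
    simp only [fourierMat, of_apply]
    rw [if_neg, zero_mul]
    intro e
    refine hc (Finset.mem_image.2 ⟨c j, Finset.mem_univ _, funext fun i => ?_⟩)
    rcases eq_or_ne i j with rfl | hi
    · simp
    · simp [hi, e i hi]

theorem isUnit_fourierMat [IsDomain R] (hψ : ψ ≠ 1) (h2 : (2 : K) ≠ 0)
    (hq : IsUnit (Fintype.card K : R)) (j : Fin n) : IsUnit (fourierMat ψ (-2) j) := by
  obtain ⟨c, hc⟩ := hq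
  refine IsUnit.of_mul_eq_one (((c⁻¹ : Rˣ) : R) • fourierMat ψ 2 j) ?_
  rw [Matrix.mul_smul, fourierMat_mul hψ h2, smul_smul, ← hc, Units.inv_mul, one_smul]

/-- The matrices which commute with the map induced by `v ↦ -v`. -/
def IsEvenMat (T : Matrix (Fin n → K) (Fin n → K) R) : Prop := ∀ a b, T (-a) (-b) = T a b

theorem IsEvenMat.mul {S T : Matrix (Fin n → K) (Fin n → K) R} (hS : IsEvenMat S) (hT : IsEvenMat T) :
    IsEvenMat (S * T) := fun a b => by
  rw [Matrix.mul_apply, Matrix.mul_apply, ← Equiv.sum_comp (Equiv.neg (Fin n → K))]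
  exact Finset.sum_congr rfl fun c _ => by rw [Equiv.neg_apply, hS, hT]

theorem IsEvenMat.inv {T : (Matrix (Fin n → K) (Fin n → K) R)ˣ} (hT : IsEvenMat T.1) :
    IsEvenMat (T⁻¹).1 := by
  have h : (T⁻¹).1.submatrix (Equiv.neg _) (Equiv.neg _) = (T⁻¹).1 := by
    have h1 : T.1.submatrix (Equiv.neg _) (Equiv.neg _) = T.1 := Matrix.ext fun a b => hT a b
    have h2 : T.1 * (T⁻¹).1.submatrix (Equiv.neg _) (Equiv.neg _) = 1 := by
      rw [← h1, submatrix_mul_equiv, Units.mul_inv, submatrix_one_equiv]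
    exact (Units.inv_eq_of_mul_eq_one_right h2).symm
  intro a b
  exact congrFun (congrFun h a) b

theorem IsEvenMat.smul {T : Matrix (Fin n → K) (Fin n → K) R} (hT : IsEvenMat T) (c : R) :
    IsEvenMat (c • T) := fun a b => by
  rw [Matrix.smul_apply, Matrix.smul_apply, hT]

variable (R) in
-- Invertible even intertwiners can be multiplied and inverted, so explicit ones for the generators
-- suffice: diagonal, permutation and Fourier matrices.
theorem exists_intw [IsDomain R] {ψ : AddChar K R} (hψ : ψ ≠ 1) (h2 : (2 : K) ≠ 0)
    (hq : IsUnit (Fintype.card K : R)) (g : Sp n K) :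
    ∃ T : (Matrix (Fin n → K) (Fin n → K) R)ˣ, Intw ψ g T.1 ∧ IsEvenMat T.1 := by
  let S : Subgroup (Sp n K) :=
    { carrier := {g | ∃ T : (Matrix (Fin n → K) (Fin n → K) R)ˣ, Intw ψ g T.1 ∧ IsEvenMat T.1}
      one_mem' := ⟨1, fun x => by
        have : (1 : Sp n K).1 *ᵥ x = x := one_mulVec x
        rw [this, Units.val_one, one_mul, mul_one],
        fun a b => by simp [one_apply]⟩
      mul_mem' := by
        rintro g h ⟨T, hT, hT'⟩ ⟨T', hS, hS'⟩
        exact ⟨T * T', hT.mul hS, hT'.mul hS'⟩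
      inv_mem' := by
        rintro g ⟨T, hT, hT'⟩
        exact ⟨T⁻¹, hT.inv, hT'.inv⟩ }
  have hlevi : ∀ A, levi A ∈ S := by
    intro A
    have hu : IsUnit (of fun a b : Fin n → K => if a = ((A⁻¹).1)ᵀ *ᵥ b then (1 : R) else 0) := by
      refine IsUnit.of_mul_eq_one (of fun a b : Fin n → K => if a = (A.1)ᵀ *ᵥ b then (1 : R) else 0) ?_
      ext a b
      rw [Matrix.mul_apply, Finset.sum_eq_single ((A.1)ᵀ *ᵥ b)]
      · have : ((A⁻¹).1)ᵀ *ᵥ (A.1)ᵀ *ᵥ b = b := by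
          rw [mulVec_mulVec, ← transpose_mul, ← Units.val_mul, mul_inv_cancel]
          simp
        simp only [of_apply, this, one_apply, if_true, mul_one]
      · intro c _ hc
        simp [hc]
      · simp
    refine ⟨hu.unit, intw_levi A, fun a b => ?_⟩
    simp [mulVec_neg]
  refine mem_of_forall_generators S (fun X hX => ?_) (fun i j h c => hlevi _) (fun d => hlevi _)
    (fun j => ⟨(isUnit_fourierMat hψ h2 hq j).unit, intw_flipElt j, fun a b => ?_⟩) g
  · have hu : IsUnit (diagonal fun w : Fin n → K => ψ (w ⬝ᵥ X *ᵥ w)) := by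
      refine IsUnit.of_mul_eq_one (diagonal fun w : Fin n → K => ψ (-(w ⬝ᵥ X *ᵥ w))) ?_
      rw [diagonal_mul_diagonal, ← diagonal_one]
      congr 1
      funext w
      rw [← AddChar.map_add_eq_mul, add_neg_cancel, AddChar.map_zero_eq_one]
    refine ⟨hu.unit, intw_unip X hX, fun a b => ?_⟩
    simp [diagonal_apply, mulVec_neg]
  · simp [fourierMat]

/-- Schur's lemma for the Schrödinger representation. -/
theorem intw_one [IsDomain R] (hψ : ψ ≠ 1) (h2 : (2 : K) ≠ 0) {T : Matrix (Fin n → K) (Fin n → K) R}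
    (hT : Intw ψ 1 T) : T = T 0 0 • (1 : Matrix (Fin n → K) (Fin n → K) R) := by
  rw [intw_iff] at hT
  have he : ∀ x, (1 : Sp n K).1 *ᵥ x = x := fun x => one_mulVec x
  simp only [he] at hT
  -- The operators `J(0, u)` with `u` in `M` are diagonal and separate the points of `N`, so a
  -- matrix commuting with them is diagonal.
  have hdiag : ∀ a b, a ≠ b → T a b = 0 := by
    intro a b hab
    obtain ⟨i, hi⟩ : ∃ i, a i ≠ b i := Function.ne_iff.1 hab
    obtain ⟨t, ht⟩ := AddChar.ne_one_iff.1 hψ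
    have hne : 2 * (b i - a i) ≠ 0 := mul_ne_zero h2 (sub_ne_zero.2 hi.symm)
    have h := hT (Sum.elim (Pi.single i (t / (2 * (b i - a i)))) 0) a b
    simp only [Sum.elim_comp_inl, Sum.elim_comp_inr, add_zero, zero_add, sub_zero,
      single_dotProduct, Pi.smul_apply, smul_eq_mul] at h
    by_contra h0
    rw [mul_comm, mul_left_inj' h0] at h
    refine ht ?_
    have e : t = t / (2 * (b i - a i)) * (2 * b i) - t / (2 * (b i - a i)) * (2 * a i) := by
      field_simp
    rw [e, sub_eq_add_neg, AddChar.map_add_eq_mul, h, ← AddChar.map_add_eq_mul, add_neg_cancel, AddChar.map_zero_eq_one]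
  ext a b
  rw [Matrix.smul_apply, one_apply, smul_eq_mul]
  rcases eq_or_ne a b with rfl | hab
  -- Translation by `a` identifies the diagonal entries at `0` and `a`.
  · have h := hT (Sum.elim 0 a) a 0
    simpa using h
  · rw [hdiag a b hab, if_neg hab, mul_zero]

end WeilOperators

/-! ### Weil representations over a ring -/

section WeilRepresentations

/-! ### Representatives of the pairs `{v, -v}` -/

section HalfSystem

variable {V : Type*} [AddCommGroup V] {d : ℕ}

/-- `r` enumerates representatives of the pairs `{v, -v}`, `v ≠ 0`. -/
structure IsHalfSystem (r : Fin d → V) : Prop where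
  injective : Function.Injective r
  ne_neg : ∀ i j, r i ≠ -r j
  exists_eq : ∀ v, v ≠ 0 → ∃ i, v = r i ∨ v = -r i

theorem IsHalfSystem.ne_zero {r : Fin d → V} (hr : IsHalfSystem r) (i : Fin d) : r i ≠ 0 := fun h =>
  hr.ne_neg i i (by rw [h, neg_zero])

theorem IsHalfSystem.sum_eq [Fintype V] {r : Fin d → V} (hr : IsHalfSystem r) {M : Type*}
    [AddCommMonoid M] (f : V → M) : ∑ v, f v = f 0 + ∑ i, (f (r i) + f (-r i)) := by
  let e : Option (Fin d ⊕ Fin d) → V := fun x => x.elim 0 (Sum.elim r fun i => -r i)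
  have he : Function.Bijective e := by
    constructor
    · rintro (_ | i | i) (_ | j | j) h
      · rfl
      · exact (hr.ne_zero j h.symm).elim
      · exact (hr.ne_zero j (neg_eq_zero.1 h.symm)).elim
      · exact (hr.ne_zero i h).elim
      · exact congrArg (fun i => some (Sum.inl i)) (hr.injective h)
      · exact (hr.ne_neg i j h).elim
      · exact (hr.ne_zero i (neg_eq_zero.1 h)).elim
      · exact (hr.ne_neg j i h.symm).elim
      · exact congrArg (fun i => some (Sum.inr i)) (hr.injective (neg_injective h))
    · intro v
      rcases eq_or_ne v 0 with rfl | hv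
      · exact ⟨none, rfl⟩
      · obtain ⟨i, h | h⟩ := hr.exists_eq v hv
        · exact ⟨some (Sum.inl i), h.symm⟩
        · exact ⟨some (Sum.inr i), h.symm⟩
  rw [← (Equiv.ofBijective e he).sum_comp, Fintype.sum_option, Fintype.sum_sum_type,
    Finset.sum_add_distrib]
  rfl

theorem IsHalfSystem.card_eq [Fintype V] {r : Fin d → V} (hr : IsHalfSystem r) :
    Fintype.card V = 2 * d + 1 := by
  have := hr.sum_eq fun _ => 1
  simp only [Finset.sum_const, Finset.card_univ, Fintype.card_fin, smul_eq_mul, mul_one] at this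
  omega

theorem exists_isHalfSystem [Fintype V] (hV : ∀ v : V, v = -v → v = 0) :
    ∃ r : Fin ((Fintype.card V - 1) / 2) → V, IsHalfSystem r := by
  classical
  let e := Fintype.equivFin V
  -- From each pair the member that comes first in an arbitrary enumeration is chosen.
  let H := {v : V // e v < e (-v)}
  have hH : ∀ v : V, v ≠ 0 → e v < e (-v) ∨ e (-v) < e v := fun v hv =>
    lt_or_gt_of_ne fun h => hv (hV v (e.injective h))
  have key : ∀ r : Fin (Fintype.card H) → V, (∀ i, r i = ((Fintype.equivFin H).symm i).1) →
      IsHalfSystem r := by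
    intro r hr
    refine ⟨fun i j h => ?_, fun i j h => ?_, fun v hv => ?_⟩
    · rw [hr, hr] at h
      exact (Fintype.equivFin H).symm.injective (Subtype.ext h)
    · rw [hr, hr] at h
      have h1 := ((Fintype.equivFin H).symm i).2
      have h2 := ((Fintype.equivFin H).symm j).2
      rw [h, neg_neg] at h1
      exact lt_asymm h1 h2
    · rcases hH v hv with h | h
      · exact ⟨Fintype.equivFin H ⟨v, h⟩, Or.inl (by rw [hr]; simp)⟩
      · refine ⟨Fintype.equivFin H ⟨-v, by rwa [neg_neg]⟩, Or.inr (by rw [hr]; simp)⟩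
  have h1 := key _ fun i => rfl
  have h2 : (Fintype.card V - 1) / 2 = Fintype.card H := by
    have := h1.card_eq
    omega
  rw [h2]
  exact ⟨_, h1⟩

end HalfSystem

variable {n : ℕ} {K : Type*} [Field K] [Fintype K] [DecidableEq K] {R : Type*} [CommRing R]

section OddMat

variable {d : ℕ} (r : Fin d → Fin n → K)

/-- The matrix of the restriction of an even matrix to the odd part, with respect to the basis
`ε_v - ε_{-v}`. -/
def oddMat (T : Matrix (Fin n → K) (Fin n → K) R) : Matrix (Fin d) (Fin d) R :=
  of fun i j => T (r i) (r j) - T (r i) (-r j)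

variable {r}

/-- In the product the index `0` contributes nothing, since the row of `T` at `0` is an even
function, and the contributions of `r k` and `-r k` combine into a product of differences. -/
theorem oddMat_mul (hr : IsHalfSystem r) {S T : Matrix (Fin n → K) (Fin n → K) R}
    (hT : IsEvenMat T) : oddMat r (S * T) = oddMat r S * oddMat r T := by
  ext i j
  simp only [oddMat, of_apply, Matrix.mul_apply]
  rw [← Finset.sum_sub_distrib, hr.sum_eq]
  have h0 : T 0 (-r j) = T 0 (r j) := by rw [← hT 0 (r j), neg_zero]
  rw [h0, sub_self, zero_add]
  refine Finset.sum_congr rfl fun k _ => ?_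
  have h1 : T (-r k) (r j) = T (r k) (-r j) := by rw [← hT (r k) (-r j), neg_neg]
  rw [h1, hT (r k)]
  ring

theorem oddMat_one (hr : IsHalfSystem r) : oddMat r (1 : Matrix (Fin n → K) (Fin n → K) R) = 1 := by
  ext i j
  simp [oddMat, one_apply, hr.injective.eq_iff, hr.ne_neg]

theorem oddMat_smul (c : R) (T : Matrix (Fin n → K) (Fin n → K) R) :
    oddMat r (c • T) = c • oddMat r T := by
  ext i j
  simp [oddMat, mul_sub]

end OddMat

/-- A Weil representation of type `ψ`, by even matrices over `R`. -/
structure IsWeil (ψ : AddChar K R) (P : Sp n K →* Matrix (Fin n → K) (Fin n → K) R) : Prop where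
  intw : ∀ g, Intw ψ g (P g)
  even : ∀ g, IsEvenMat (P g)

variable {ψ : AddChar K R}

/-- By Schur's lemma the quotient of two intertwiners is a scalar; comparison of determinants shows
that it is a unit. -/
theorem intw_isScalar [IsDomain R] (hψ : ψ ≠ 1) (h2 : (2 : K) ≠ 0) {g : Sp n K}
    {S T : (Matrix (Fin n → K) (Fin n → K) R)ˣ} (hS : Intw ψ g S.1) (hT : Intw ψ g T.1) :
    ∃ c : Rˣ, S.1 = (c : R) • T.1 := by
  have h1 := hT.inv.mul hS
  rw [inv_mul_cancel] at h1
  have h3 := intw_one hψ h2 h1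
  set c := ((T⁻¹).1 * S.1) 0 0
  have h4 : S.1 = c • T.1 := by
    have := congrArg (fun X => T.1 * X) h3
    simpa [← mul_assoc] using this
  have hc : IsUnit c := by
    have h5 := congrArg det h4
    rw [det_smul] at h5
    have h6 : IsUnit (c ^ Fintype.card (Fin n → K) * T.1.det) :=
      h5 ▸ (isUnit_iff_isUnit_det S.1).1 S.isUnit
    exact (isUnit_pow_iff Fintype.card_ne_zero).1 (isUnit_of_mul_isUnit_left h6)
  exact ⟨hc.unit, h4⟩

section Normalize

variable {d : ℕ} (r : Fin d → Fin n → K)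

/-- The multiple of `T` that depends only on the class of `T` modulo scalars. -/
def normalize (T : Matrix (Fin n → K) (Fin n → K) R) : Matrix (Fin n → K) (Fin n → K) R :=
  ((oddMat r T).det ^ 2 * Ring.inverse T.det) • T

variable {r}

/-- The odd part has rank `d` and the whole space rank `2d + 1`, so the scalar enters with exponent
`2d - (2d + 1) + 1 = 0`. -/
theorem normalize_smul (hr : IsHalfSystem r) (c : Rˣ) (T : Matrix (Fin n → K) (Fin n → K) R) :
    normalize r ((c : R) • T) = normalize r T := by
  have hd : Fintype.card (Fin n → K) = 2 * d + 1 := hr.card_eq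
  rw [normalize, normalize, oddMat_smul, det_smul, det_smul, Fintype.card_fin, hd,
    Ring.mul_inverse_rev, smul_smul]
  congr 1
  rw [← Units.val_pow_eq_pow_val c (2 * d + 1), Ring.inverse_unit]
  have : (c : R) ^ (2 * d) * (((c ^ (2 * d + 1))⁻¹ : Rˣ) : R) * c = 1 := by
    have hu : c ^ (2 * d) * (c ^ (2 * d + 1))⁻¹ * c = 1 := by rw [pow_succ]; group
    rw [← Units.val_pow_eq_pow_val, ← Units.val_mul, ← Units.val_mul, hu, Units.val_one]
  have h3 : ((c : R) ^ d * (oddMat r T).det) ^ 2 = c ^ (2 * d) * (oddMat r T).det ^ 2 := by ring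
  rw [h3]
  linear_combination (oddMat r T).det ^ 2 * Ring.inverse T.det * this

theorem normalize_mul (hr : IsHalfSystem r) {S T : Matrix (Fin n → K) (Fin n → K) R}
    (hT : IsEvenMat T) : normalize r (S * T) = normalize r S * normalize r T := by
  simp only [normalize]
  rw [oddMat_mul hr hT, det_mul, det_mul, Ring.mul_inverse_rev, smul_mul_smul_comm]
  congr 1
  ring

theorem normalize_one (hr : IsHalfSystem r) :
    normalize r (1 : Matrix (Fin n → K) (Fin n → K) R) = 1 := by
  rw [normalize, oddMat_one hr, det_one, det_one]
  simp

end Normalize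

/-- Any choice of even intertwiners is multiplicative up to scalars. Since `normalize` ignores
scalars and respects products, it turns the projective representation into a genuine one with
entries in `R`. -/
theorem exists_isWeil [IsDomain R] (hψ : ψ ≠ 1) (h2 : (2 : K) ≠ 0) (hq : IsUnit (Fintype.card K : R)) :
    ∃ P : Sp n K →* Matrix (Fin n → K) (Fin n → K) R, IsWeil ψ P := by
  have hV : ∀ v : Fin n → K, v = -v → v = 0 := by
    intro v hv
    funext i
    have h3 := congrFun hv i
    have h4 : 2 * v i = 0 := by
      rw [Pi.neg_apply] at h3
      linear_combination h3
    exact (mul_eq_zero.1 h4).resolve_left h2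
  obtain ⟨r, hr⟩ := exists_isHalfSystem hV
  choose T hT hE using fun g : Sp n K => exists_intw R hψ h2 hq g
  refine ⟨{ toFun := fun g => normalize r (T g).1, map_one' := ?_, map_mul' := fun g h => ?_ },
    fun g => (hT g).smul _, fun g => (hE g).smul _⟩
  · have h1 : Intw ψ (1 : Sp n K) (1 : (Matrix (Fin n → K) (Fin n → K) R)ˣ).1 := fun x => by
      have : (1 : Sp n K).1 *ᵥ x = x := one_mulVec x
      rw [this, Units.val_one, one_mul, mul_one]
    obtain ⟨c, hc⟩ := intw_isScalar hψ h2 (hT 1) h1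
    rw [hc, normalize_smul hr, Units.val_one, normalize_one hr]
  · obtain ⟨c, hc⟩ := intw_isScalar (S := T (g * h)) (T := T g * T h) hψ h2 (hT (g * h)) ((hT g).mul (hT h))
    rw [hc, normalize_smul hr, Units.val_mul, normalize_mul hr (hE h)]

/-- By Schur's lemma two such representations differ by a linear character, which is trivial because
the group is perfect. -/
theorem IsWeil.unique [IsDomain R] (hψ : ψ ≠ 1) (h2 : (2 : K) ≠ 0) (hq : 3 < Nat.card K)
    {P P' : Sp n K →* Matrix (Fin n → K) (Fin n → K) R} (hP : ∀ g, Intw ψ g (P g))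
    (hP' : ∀ g, Intw ψ g (P' g)) : P' = P := by
  have h1 : ∀ g, P' g = (P' g * P g⁻¹) 0 0 • P g := by
    intro g
    have h3 := (hP' g).mul (hP g⁻¹)
    rw [mul_inv_cancel] at h3
    have h4 := congrArg (fun X => X * P g) (intw_one hψ h2 h3)
    simp only [mul_assoc, ← map_mul, inv_mul_cancel, map_one, mul_one, Matrix.smul_mul,
      one_mul] at h4
    exact h4
  let c : Sp n K →* R :=
    { toFun := fun g => (P' g * P g⁻¹) 0 0
      map_one' := by simp
      map_mul' := fun g h => by
        have e : P' (g * h) * P (g * h)⁻¹ = ((P' g * P g⁻¹) 0 0 * (P' h * P h⁻¹) 0 0) • 1 := by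
          rw [map_mul, h1 g, h1 h, smul_mul_smul_comm, ← map_mul, Matrix.smul_mul, ← map_mul,
            mul_inv_cancel, map_one]
          simp only [Matrix.smul_mul, ← map_mul, mul_inv_cancel, map_one]
          simp
        rw [e]
        simp }
  refine MonoidHom.ext fun g => ?_
  have h3 : c g = 1 := by
    have := congrArg Units.val (hom_eq_one hq c.toHomUnits g)
    simpa using this
  rw [h1 g]
  change c g • P g = P g
  rw [h3, one_smul]

section Map

variable {S : Type*} [Field S] (f : R →+* S)

/-- Change of rings for matrix representations. -/
def mapRep (P : Sp n K →* Matrix (Fin n → K) (Fin n → K) R) :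
    Sp n K →* Matrix (Fin n → K) (Fin n → K) S :=
  (f.mapMatrix : Matrix (Fin n → K) (Fin n → K) R →+* _).toMonoidHom.comp P

theorem mapRep_apply (P : Sp n K →* Matrix (Fin n → K) (Fin n → K) R) (g : Sp n K) (a b : Fin n → K) :
    mapRep f P g a b = f (P g a b) := rfl

theorem IsWeil.map {P : Sp n K →* Matrix (Fin n → K) (Fin n → K) R} (hP : IsWeil ψ P) :
    IsWeil (redChar f ψ) (mapRep f P) := by
  refine ⟨fun g => intw_iff.2 fun x a b => ?_, fun g a b => ?_⟩
  · have := congrArg f (intw_iff.1 (hP.intw g) x a b)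
    rw [map_mul, map_mul] at this
    exact this
  · exact congrArg f (hP.even g a b)

end Map

/-- The contragredient matrix representation. -/
def dualRep (P : Sp n K →* Matrix (Fin n → K) (Fin n → K) R) :
    Sp n K →* Matrix (Fin n → K) (Fin n → K) R where
  toFun g := (P g⁻¹)ᵀ
  map_one' := by simp
  map_mul' g h := by rw [_root_.mul_inv_rev, map_mul, transpose_mul]

theorem dualRep_apply (P : Sp n K →* Matrix (Fin n → K) (Fin n → K) R) (g : Sp n K) :
    dualRep P g = (P g⁻¹)ᵀ := rfl

theorem schMat_transpose (x : Fin n ⊕ Fin n → K) : (schMat ψ⁻¹ x)ᵀ = schMat ψ (-x) := by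
  ext a b
  simp only [transpose_apply, schMat, of_apply]
  have e1 : (-x) ∘ Sum.inr = -(x ∘ Sum.inr) := rfl
  have e2 : (-x) ∘ Sum.inl = -(x ∘ Sum.inl) := rfl
  rw [e1, e2, ← sub_eq_add_neg]
  rcases eq_or_ne b (a + x ∘ Sum.inr) with rfl | h
  · rw [if_pos rfl, if_pos (by rw [add_sub_cancel_right]), AddChar.inv_apply, neg_dotProduct]
    congr 3
    rw [smul_add, two_smul K (x ∘ Sum.inr)]
    abel
  · rw [if_neg h, if_neg (fun e => h (by rw [e, sub_add_cancel]))]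

theorem IsWeil.dual {P : Sp n K →* Matrix (Fin n → K) (Fin n → K) R} (hP : IsWeil ψ P) :
    IsWeil ψ⁻¹ (dualRep P) := by
  refine ⟨fun g x => ?_, fun g a b => hP.even g⁻¹ b a⟩
  refine transpose_injective ?_
  rw [transpose_mul, transpose_mul, dualRep_apply, transpose_transpose, schMat_transpose,
    schMat_transpose, ← mulVec_neg]
  have h := hP.intw g⁻¹ (g.1 *ᵥ (-x))
  have e : (g⁻¹).1 *ᵥ (g.1 *ᵥ (-x)) = -x := by
    rw [mulVec_mulVec]
    have : (g⁻¹).1 * g.1 = (g⁻¹ * g).1 := rfl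
    rw [this, inv_mul_cancel]
    exact one_mulVec _
  rw [e] at h
  exact h.symm

/-- The odd part of a Weil representation. -/
def oddRep {d : ℕ} {r : Fin d → Fin n → K} (hr : IsHalfSystem r)
    {P : Sp n K →* Matrix (Fin n → K) (Fin n → K) R} (hP : IsWeil ψ P) :
    Sp n K →* Matrix (Fin d) (Fin d) R where
  toFun g := oddMat r (P g)
  map_one' := by rw [map_one, oddMat_one hr]
  map_mul' g h := by rw [map_mul, oddMat_mul hr (hP.even h)]

theorem oddRep_apply {d : ℕ} {r : Fin d → Fin n → K} (hr : IsHalfSystem r)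
    {P : Sp n K →* Matrix (Fin n → K) (Fin n → K) R} (hP : IsWeil ψ P) (g : Sp n K) :
    oddRep hr hP g = oddMat r (P g) := rfl

end WeilRepresentations

/-! ### Weil representations in characteristic two -/

section CharTwoWeil

theorem exists_levi_mulVec_eq {n : ℕ} {K : Type*} [Field K] {v w : Fin n → K} (hv : v ≠ 0) (hw : w ≠ 0) :
    ∃ A : GL (Fin n) K, ((A⁻¹).1)ᵀ *ᵥ v = w := by
  obtain ⟨g, hg⟩ := Submodule.exists_linearEquiv_restrict_eq
    ((LinearEquiv.toSpanNonzeroSingleton K _ v hv).symm ≪≫ₗ LinearEquiv.toSpanNonzeroSingleton K _ w hw)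
  have h1 : g v = w := by
    have h := hg ⟨v, Submodule.mem_span_singleton_self v⟩
    have e : (LinearEquiv.toSpanNonzeroSingleton K _ v hv).symm
        ⟨v, Submodule.mem_span_singleton_self v⟩ = 1 := by
      rw [LinearEquiv.symm_apply_eq]
      simp
    rw [← h, LinearEquiv.trans_apply, e]
    simp
  have h2 : LinearMap.toMatrix' g.toLinearMap * LinearMap.toMatrix' g.symm.toLinearMap = 1 := by
    rw [← LinearMap.toMatrix'_comp]; simp
  have h3 : LinearMap.toMatrix' g.symm.toLinearMap * LinearMap.toMatrix' g.toLinearMap = 1 := by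
    rw [← LinearMap.toMatrix'_comp]; simp
  refine ⟨⟨(LinearMap.toMatrix' g.symm.toLinearMap)ᵀ, (LinearMap.toMatrix' g.toLinearMap)ᵀ,
    by rw [← transpose_mul, h2, transpose_one], by rw [← transpose_mul, h3, transpose_one]⟩, ?_⟩
  change ((LinearMap.toMatrix' g.toLinearMap)ᵀ)ᵀ *ᵥ v = w
  rw [transpose_transpose, LinearMap.toMatrix'_mulVec]
  exact h1

variable {n : ℕ} {K : Type*} [Field K] {F : Type*} [Field F] {χ : AddChar K F}

/-- A quadratic form of rank one is determined by its values on symmetric matrices. -/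
theorem mul_eq_of_forall_quadratic (hχ : χ ≠ 1) (h2 : (2 : K) ≠ 0) {a : K} {s t : Fin n → K}
    (h : ∀ X : Matrix (Fin n) (Fin n) K, Xᵀ = X → χ (a * (X *ᵥ s ⬝ᵥ s)) = χ (X *ᵥ t ⬝ᵥ t))
    (i j : Fin n) : a * (s i * s j) = t i * t j := by
  by_contra hne
  obtain ⟨c, hc⟩ := AddChar.ne_one_iff.1 hχ
  have hδ : 2 * (a * (s i * s j) - t i * t j) ≠ 0 := mul_ne_zero h2 (sub_ne_zero.2 hne)
  -- The symmetric matrix `y (E_{ij} + E_{ji})` has the value `2 y v_i v_j` at `v`; with this `y`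
  -- the two arguments to be compared differ by `c`, where `χ` is not `1`.
  set y := c / (2 * (a * (s i * s j) - t i * t j)) with hy
  have hq : ∀ v : Fin n → K, (single i j y + single j i y) *ᵥ v ⬝ᵥ v = 2 * y * (v i * v j) := by
    intro v
    rw [add_mulVec, add_dotProduct, single_mulVec, single_mulVec, ← Pi.single, ← Pi.single,
      single_dotProduct, single_dotProduct]
    ring
  have h1 := h (single i j y + single j i y) (by
    rw [transpose_add, transpose_single, transpose_single, add_comm])
  rw [hq, hq] at h1
  refine hc ?_
  have e : c = a * (2 * y * (s i * s j)) - 2 * y * (t i * t j) := by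
    have : y * (2 * (a * (s i * s j) - t i * t j)) = c := div_mul_cancel₀ c hδ
    linear_combination -this
  rw [e, sub_eq_add_neg, AddChar.map_add_eq_mul, h1, ← AddChar.map_add_eq_mul, add_neg_cancel,
    AddChar.map_zero_eq_one]

/-- The products of the coordinates determine a vector up to sign. -/
theorem IsHalfSystem.eq_of_mul_eq {d : ℕ} {r : Fin d → Fin n → K} (hr : IsHalfSystem r) {k m : Fin d}
    (h : ∀ i j, r k i * r k j = r m i * r m j) : k = m := by
  obtain ⟨c, hc⟩ := Function.ne_iff.1 (hr.ne_zero m)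
  rw [Pi.zero_apply] at hc
  have h1 := h c c
  rcases mul_self_eq_mul_self_iff.1 h1 with h2 | h2
  · refine hr.injective (funext fun j => ?_)
    have h3 := h c j
    rw [h2] at h3
    exact mul_left_cancel₀ hc h3
  · refine (hr.ne_neg k m (funext fun j => ?_)).elim
    have h3 := h c j
    rw [h2, neg_mul, ← mul_neg] at h3
    have := mul_left_cancel₀ hc h3
    rw [Pi.neg_apply, ← this, neg_neg]

variable [Fintype K] [DecidableEq K] {P : Sp n K →* Matrix (Fin n → K) (Fin n → K) F}
  {d : ℕ} {r : Fin d → Fin n → K}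

section Values

variable [CharP F 2]

/-- In the matrix product at `(0, 0)` the terms for `v` and `-v` agree and cancel in characteristic
two. So this entry is a linear character of a perfect group. -/
theorem IsWeil.apply_zero_zero (hP : IsWeil χ P) (hr : IsHalfSystem r) (hq : 3 < Nat.card K)
    (g : Sp n K) : P g 0 0 = 1 := by
  let c : Sp n K →* F :=
    { toFun := fun g => P g 0 0
      map_one' := by simp
      map_mul' := fun g h => by
        rw [map_mul, Matrix.mul_apply, hr.sum_eq, Finset.sum_eq_zero, add_zero]
        intro i _
        have h1 : P g 0 (-r i) = P g 0 (r i) := by rw [← hP.even g 0 (r i), neg_zero]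
        have h2 : P h (-r i) 0 = P h (r i) 0 := by rw [← hP.even h (r i) 0, neg_zero]
        rw [h1, h2, CharTwo.add_self_eq_zero] }
  have := congrArg Units.val (hom_eq_one hq c.toHomUnits g)
  exact this

/-- The vector `ε_0` is fixed by `J(0, u)` for `u` in `M`. An element of the Siegel parabolic
stabilizes `M`, so the image of `ε_0` is fixed as well and is a multiple of `ε_0`; the factor is
known to be `1`. -/
theorem IsWeil.apply_col_zero (hχ : χ ≠ 1) (h2 : (2 : K) ≠ 0) (hP : IsWeil χ P)
    (hr : IsHalfSystem r) (hq : 3 < Nat.card K) {g : Sp n K} (hg : g.1.toBlocks₂₁ = 0)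
    (a : Fin n → K) : P g a 0 = if a = 0 then 1 else 0 := by
  split_ifs with ha
  · rw [ha, hP.apply_zero_zero hr hq]
  · obtain ⟨i, hi⟩ := Function.ne_iff.1 ha
    rw [Pi.zero_apply] at hi
    obtain ⟨t, ht⟩ := AddChar.ne_one_iff.1 hχ
    set y : Fin n ⊕ Fin n → K := Sum.elim (Pi.single i (t / (2 * a i))) 0 with hy
    have h := intw_iff.1 (hP.intw g) ((g⁻¹).1 *ᵥ y) a 0
    have e : g.1 *ᵥ ((g⁻¹).1 *ᵥ y) = y := by
      rw [mulVec_mulVec]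
      have : g.1 * (g⁻¹).1 = (g * g⁻¹).1 := rfl
      rw [this, mul_inv_cancel]
      exact one_mulVec _
    have e2 : ((g⁻¹).1 *ᵥ y) ∘ Sum.inr = 0 := by
      rw [coe_inv_fromBlocks, fromBlocks_mulVec, hg, Sum.elim_comp_inr, hy, Sum.elim_comp_inl,
        Sum.elim_comp_inr, transpose_zero, neg_zero, zero_mulVec, mulVec_zero, add_zero]
    rw [e, e2] at h
    simp only [hy, Sum.elim_comp_inl, Sum.elim_comp_inr, smul_zero, add_zero, dotProduct_zero,
      AddChar.map_zero_eq_one, mul_one, sub_zero, single_dotProduct, Pi.smul_apply, smul_eq_mul] at h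
    by_contra h0
    refine ht ?_
    have e3 : t = t / (2 * a i) * (2 * a i) := by field_simp
    rw [e3]
    exact (left_eq_mul₀ h0).1 (by rwa [mul_comm])

/-- Since `ε_b` is `J(0, b) ε_0`, the column at `0` determines the others. No quadratic character
appears in characteristic two. -/
theorem IsWeil.apply_of_siegel (hχ : χ ≠ 1) (h2 : (2 : K) ≠ 0) (hP : IsWeil χ P)
    (hr : IsHalfSystem r) (hq : 3 < Nat.card K) {g : Sp n K} (hg : g.1.toBlocks₂₁ = 0)
    (a b : Fin n → K) : P g a b = if a = g.1.toBlocks₂₂ *ᵥ b then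
      χ ((g.1.toBlocks₁₂ *ᵥ b) ⬝ᵥ (g.1.toBlocks₂₂ *ᵥ b)) else 0 := by
  have h := intw_iff.1 (hP.intw g) (Sum.elim 0 b) a 0
  have e : g.1 *ᵥ (Sum.elim 0 b) = Sum.elim (g.1.toBlocks₁₂ *ᵥ b) (g.1.toBlocks₂₂ *ᵥ b) := by
    conv_lhs => rw [← fromBlocks_toBlocks g.1]
    rw [fromBlocks_mulVec]
    simp
  rw [e] at h
  simp only [Sum.elim_comp_inl, Sum.elim_comp_inr, zero_add, zero_dotProduct,
    AddChar.map_zero_eq_one, mul_one] at h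
  rw [h, hP.apply_col_zero hχ h2 hr hq hg]
  by_cases ha : a = g.1.toBlocks₂₂ *ᵥ b
  · rw [if_pos ha, if_pos (sub_eq_zero.2 ha), ha, mul_one, two_smul, add_sub_cancel_right]
  · rw [if_neg ha, if_neg (fun e => ha (sub_eq_zero.1 e)), mul_zero]

theorem IsWeil.apply_unip (hχ : χ ≠ 1) (h2 : (2 : K) ≠ 0) (hP : IsWeil χ P)
    (hr : IsHalfSystem r) (hq : 3 < Nat.card K) (X : Matrix (Fin n) (Fin n) K) (hX : Xᵀ = X)
    (a b : Fin n → K) : P (unip X hX) a b = if a = b then χ ((X *ᵥ b) ⬝ᵥ b) else 0 := by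
  rw [hP.apply_of_siegel hχ h2 hr hq (by rw [coe_unip, toBlocks_fromBlocks₂₁]), coe_unip,
    toBlocks_fromBlocks₁₂, toBlocks_fromBlocks₂₂, one_mulVec]

theorem IsWeil.apply_levi (hχ : χ ≠ 1) (h2 : (2 : K) ≠ 0) (hP : IsWeil χ P)
    (hr : IsHalfSystem r) (hq : 3 < Nat.card K) (A : GL (Fin n) K)
    (a b : Fin n → K) : P (levi A) a b = if a = ((A⁻¹).1)ᵀ *ᵥ b then 1 else 0 := by
  rw [hP.apply_of_siegel hχ h2 hr hq (by rw [coe_levi, toBlocks_fromBlocks₂₁]), coe_levi,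
    toBlocks_fromBlocks₁₂, toBlocks_fromBlocks₂₂, zero_mulVec, zero_dotProduct,
    AddChar.map_zero_eq_one]

theorem IsWeil.apply_mul_siegel (hχ : χ ≠ 1) (h2 : (2 : K) ≠ 0) (hP : IsWeil χ P)
    (hr : IsHalfSystem r) (hq : 3 < Nat.card K) {b : Sp n K} (hb : b.1.toBlocks₂₁ = 0) (g : Sp n K)
    (w : Fin n → K) : P (g * b) w 0 = P g w 0 := by
  rw [map_mul, Matrix.mul_apply, Finset.sum_eq_single 0]
  · rw [hP.apply_zero_zero hr hq, mul_one]
  · intro c _ hc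
    rw [hP.apply_col_zero hχ h2 hr hq hb, if_neg hc, mul_zero]
  · simp

theorem IsWeil.apply_siegel_mul (hχ : χ ≠ 1) (h2 : (2 : K) ≠ 0) (hP : IsWeil χ P)
    (hr : IsHalfSystem r) (hq : 3 < Nat.card K) {h : Sp n K} (hh : h.1.toBlocks₂₁ = 0) (g : Sp n K)
    (b : Fin n → K) : P (h * g) (h.1.toBlocks₂₂ *ᵥ b) 0 =
      χ ((h.1.toBlocks₁₂ *ᵥ b) ⬝ᵥ (h.1.toBlocks₂₂ *ᵥ b)) * P g b 0 := by
  rw [map_mul, Matrix.mul_apply, Finset.sum_eq_single b]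
  · rw [hP.apply_of_siegel hχ h2 hr hq hh, if_pos rfl]
  · intro c _ hc
    rw [hP.apply_of_siegel hχ h2 hr hq hh, if_neg, zero_mul]
    intro e
    obtain ⟨A, S, hS, rfl⟩ := exists_levi_mul_unip h hh
    have e3 : (levi A * unip S hS).1.toBlocks₂₂ = ((A⁻¹).1)ᵀ := by
      change (fromBlocks _ _ _ _ * fromBlocks _ _ _ _ : Matrix _ _ K).toBlocks₂₂ = _
      rw [fromBlocks_multiply, toBlocks_fromBlocks₂₂]
      simp
    rw [e3] at e
    have h4 : (A.1)ᵀ * ((A⁻¹).1)ᵀ = 1 := by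
      rw [← transpose_mul, ← Units.val_mul, inv_mul_cancel]; simp
    have h5 := congrArg (fun v => (A.1)ᵀ *ᵥ v) e
    simp only [mulVec_mulVec, h4, one_mulVec] at h5
    exact hc h5.symm
  · simp

/-- `J(0, u)` fixes `ε_0`, and its conjugate `J(0, w)` carries the coordinate at `0` to the
coordinate at `w`. -/
theorem IsWeil.apply_eq_one (hP : IsWeil χ P) (hr : IsHalfSystem r) (hq : 3 < Nat.card K)
    {g : Sp n K} {u w : Fin n → K} (h : g.1 *ᵥ Sum.elim u (0 : Fin n → K) = Sum.elim (0 : Fin n → K) w) : P g w 0 = 1 := by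
  have h1 := intw_iff.1 (hP.intw g) (Sum.elim u 0) w 0
  rw [h] at h1
  simp only [Sum.elim_comp_inl, Sum.elim_comp_inr, smul_zero, add_zero, dotProduct_zero,
      AddChar.map_zero_eq_one, mul_one, zero_dotProduct, sub_self,
      hP.apply_zero_zero hr hq] at h1
  exact h1

end Values

end CharTwoWeil

/-! ### The odd part in characteristic two -/

section Layer

variable {G : Type*} [Group G] {F : Type*} [Field F] {V : Type*} [AddCommGroup V] [Module F V]

theorem mem_submoduleOf_iff {S M : Type*} [Ring S] [AddCommGroup M] [Module S M]
    {A A' : Submodule S M} {x : A} : x ∈ A'.submoduleOf A ↔ (x : M) ∈ A' := Iff.rfl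

theorem single_one_mul_eq_smul (a : F) (z : MonoidAlgebra F G) :
    MonoidAlgebra.single (1 : G) a * z = a • z := by
  ext h
  simp [MonoidAlgebra.coeff_single_mul_apply]

/-- An irreducible representation embeds into a layer if it has a linear map to the top which
is nonzero and equivariant modulo the bottom. -/
theorem embedsInLayer_of_linearMap {ρ : Representation F G V} (hρ : ρ.IsIrreducible)
    {A A' : Submodule (MonoidAlgebra F G) (MonoidAlgebra F G)} (Φ : V →ₗ[F] MonoidAlgebra F G)
    (hA : ∀ x, Φ x ∈ A) (hA' : ∀ g x, Φ (ρ g x) - MonoidAlgebra.single g 1 * Φ x ∈ A')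
    {x₀ : V} (h₀ : Φ x₀ ∉ A') : EmbedsInLayer ρ A A' := by
  let f : ρ.asModule →ₗ[MonoidAlgebra F G] (A ⧸ A'.submoduleOf A) :=
    { toFun := fun x => Submodule.Quotient.mk ⟨Φ (ρ.asModuleEquiv x), hA _⟩
      map_add' := fun x y => by
        rw [← Submodule.Quotient.mk_add]
        congr 1
        exact Subtype.ext (by simp)
      map_smul' := fun c x => by
        rw [RingHom.id_apply]
        induction c using MonoidAlgebra.induction_linear with
        | zero =>
          rw [zero_smul, zero_smul, Submodule.Quotient.mk_eq_zero, mem_submoduleOf_iff]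
          simp
        | add a b ha hb =>
          rw [add_smul, add_smul, ← ha, ← hb, ← Submodule.Quotient.mk_add]
          congr 1
          exact Subtype.ext (by simp)
        | single g a =>
          rw [← Submodule.Quotient.mk_smul, Submodule.Quotient.eq, mem_submoduleOf_iff]
          have h1 := hA' g (ρ.asModuleEquiv x)
          have h2 : Φ (ρ.asModuleEquiv (MonoidAlgebra.single g a • x)) -
              MonoidAlgebra.single g a * Φ (ρ.asModuleEquiv x) =
              MonoidAlgebra.single (1 : G) a • (Φ (ρ g (ρ.asModuleEquiv x)) -
                MonoidAlgebra.single g 1 * Φ (ρ.asModuleEquiv x)) := by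
            rw [Representation.asModuleEquiv_map_smul, Representation.asAlgebraHom_single,
              LinearMap.smul_apply, map_smul, smul_eq_mul (MonoidAlgebra.single (1 : G) a), mul_sub, single_one_mul_eq_smul, ← mul_assoc,
              MonoidAlgebra.single_mul_single, one_mul, mul_one]
          have h3 := Submodule.smul_mem A' (MonoidAlgebra.single (1 : G) a) h1
          rw [← h2] at h3
          exact h3 }
  -- By simplicity it is enough that the induced map is nonzero.
  have := (Representation.irreducible_iff_isSimpleModule_asModule ρ).1 hρ
  refine ⟨f, (LinearMap.injective_or_eq_zero f).resolve_right fun h => h₀ ?_⟩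
  have h1 := LinearMap.congr_fun h (ρ.asModuleEquiv.symm x₀)
  have h2 : (Submodule.Quotient.mk (p := A'.submoduleOf A)
      ⟨Φ (ρ.asModuleEquiv (ρ.asModuleEquiv.symm x₀)), hA _⟩) = 0 := h1
  rw [Submodule.Quotient.mk_eq_zero, mem_submoduleOf_iff] at h2
  simpa using h2

end Layer

/-! ### Irreducibility of the odd part and separation of the two types -/

section OddPart

variable {n : ℕ} {K : Type*} [Field K] [Fintype K] [DecidableEq K] {F : Type*} [Field F]
  [CharP F 2] {χ : AddChar K F} {P : Sp n K →* Matrix (Fin n → K) (Fin n → K) F}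
  {d : ℕ} {r : Fin d → Fin n → K} {ρ : Representation F (Sp n K) (Fin d → F)}

theorem odd_unip (hχ : χ ≠ 1) (h2 : (2 : K) ≠ 0) (hq : 3 < Nat.card K) (hr : IsHalfSystem r)
    (hP : IsWeil χ P) (hρ : ∀ g, ρ g = toLin' (oddMat r (P g)))
    (X : Matrix (Fin n) (Fin n) K) (hX : Xᵀ = X) (x : Fin d → F) (i : Fin d) :
    ρ (unip X hX) x i = χ ((X *ᵥ r i) ⬝ᵥ r i) * x i := by
  have : oddMat r (P (unip X hX)) = diagonal fun i => χ ((X *ᵥ r i) ⬝ᵥ r i) := by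
    ext i j
    simp only [oddMat, of_apply, hP.apply_unip hχ h2 hr hq]
    rw [if_neg (hr.ne_neg i j), sub_zero, diagonal_apply]
    by_cases h : i = j
    · rw [if_pos h, if_pos (by rw [h]), h]
    · rw [if_neg h, if_neg (fun e => h (hr.injective e))]
  rw [hρ, this, toLin'_apply, mulVec_diagonal]

theorem exists_odd_levi (hχ : χ ≠ 1) (h2 : (2 : K) ≠ 0) (hq : 3 < Nat.card K) (hr : IsHalfSystem r)
    (hP : IsWeil χ P) (hρ : ∀ g, ρ g = toLin' (oddMat r (P g))) (i j : Fin d) :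
    ∃ g, ρ g (Pi.single i 1) = Pi.single j 1 := by
  obtain ⟨A, hA⟩ := exists_levi_mulVec_eq (hr.ne_zero i) (hr.ne_zero j)
  refine ⟨levi A, funext fun k => ?_⟩
  rw [hρ, toLin'_apply, mulVec_single_one, Pi.single_apply]
  simp only [oddMat, col_apply, of_apply, hP.apply_levi hχ h2 hr hq, mulVec_neg, hA]
  rw [if_neg (hr.ne_neg k j), sub_zero]
  by_cases h : k = j
  · rw [if_pos h, if_pos (by rw [h])]
  · rw [if_neg h, if_neg (fun e => h (hr.injective e))]

/-- The Siegel radical acts diagonally, and distinct indices carry distinct characters. Subtracting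
the eigenvalue at one index of the support removes this index and keeps another, so induction on the
support reaches a coordinate vector. -/
theorem exists_single_mem (hχ : χ ≠ 1) (h2 : (2 : K) ≠ 0) (hq : 3 < Nat.card K) (hr : IsHalfSystem r)
    (hP : IsWeil χ P) (hρ : ∀ g, ρ g = toLin' (oddMat r (P g))) (S : Subrepresentation ρ)
    {x : Fin d → F} (hx : x ∈ S.toSubmodule) (hx0 : x ≠ 0) :
    ∃ i, Pi.single i 1 ∈ S.toSubmodule := by
  classical
  induction hm : (Finset.univ.filter fun i => x i ≠ 0).card using Nat.strong_induction_on
    generalizing x with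
  | _ m ih =>
    obtain ⟨i, hi⟩ := Function.ne_iff.1 hx0
    rw [Pi.zero_apply] at hi
    by_cases hall : ∀ j, j ≠ i → x j = 0
    · refine ⟨i, ?_⟩
      have e : Pi.single i 1 = (x i)⁻¹ • x := by
        funext j
        rcases eq_or_ne j i with rfl | hj
        · simp [hi]
        · simp [hj, hall j hj]
      rw [e]
      exact Submodule.smul_mem _ _ hx
    · push Not at hall
      obtain ⟨j, hji, hj⟩ := hall
      obtain ⟨X, hX, hne⟩ : ∃ X : Matrix (Fin n) (Fin n) K, ∃ _ : Xᵀ = X,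
          χ ((X *ᵥ r j) ⬝ᵥ r j) ≠ χ ((X *ᵥ r i) ⬝ᵥ r i) := by
        by_contra! hcon
        refine hji (hr.eq_of_mul_eq fun a b => ?_)
        have := mul_eq_of_forall_quadratic (a := 1) (s := r j) (t := r i) hχ h2
          (fun X hX => by rw [one_mul]; exact hcon X hX) a b
        rwa [one_mul] at this
      set y := ρ (unip X hX) x - χ ((X *ᵥ r i) ⬝ᵥ r i) • x with hy
      have hyk : ∀ k, y k = (χ ((X *ᵥ r k) ⬝ᵥ r k) - χ ((X *ᵥ r i) ⬝ᵥ r i)) * x k := by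
        intro k
        rw [hy, Pi.sub_apply, odd_unip hχ h2 hq hr hP hρ, Pi.smul_apply, smul_eq_mul, sub_mul]
      have hyS : y ∈ S.toSubmodule :=
        Submodule.sub_mem _ (S.apply_mem_toSubmodule _ hx) (Submodule.smul_mem _ _ hx)
      have hyj : y j ≠ 0 := by
        rw [hyk]
        exact mul_ne_zero (sub_ne_zero.2 hne) hj
      refine ih _ ?_ hyS (fun e => hyj (by rw [e]; rfl)) rfl
      rw [← hm]
      refine Finset.card_lt_card ⟨fun k hk => ?_, fun hsub => ?_⟩
      · simp only [Finset.mem_filter, Finset.mem_univ, true_and] at hk ⊢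
        rw [hyk] at hk
        exact right_ne_zero_of_mul hk
      · have := hsub (Finset.mem_filter.2 ⟨Finset.mem_univ i, hi⟩)
        simp only [Finset.mem_filter, Finset.mem_univ, true_and] at this
        exact this (by rw [hyk, sub_self, zero_mul])

/-- A nonzero submodule contains a coordinate vector, and the Levi subgroup permutes the coordinate
vectors transitively. -/
theorem isIrreducible_odd (hχ : χ ≠ 1) (h2 : (2 : K) ≠ 0) (hq : 3 < Nat.card K) (hr : IsHalfSystem r)
    (hd : 0 < d) (hP : IsWeil χ P) (hρ : ∀ g, ρ g = toLin' (oddMat r (P g))) : ρ.IsIrreducible := by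
  refine { exists_pair_ne := ⟨⊥, ⊤, fun h => ?_⟩, eq_bot_or_eq_top := fun S => ?_ }
  · have h1 : (⊥ : Submodule F (Fin d → F)) = ⊤ := congrArg Subrepresentation.toSubmodule h
    have h3 : (Pi.single ⟨0, hd⟩ 1 : Fin d → F) ∈ (⊥ : Submodule F (Fin d → F)) := by
      rw [h1]; trivial
    have := congrFun ((Submodule.mem_bot F).1 h3) ⟨0, hd⟩
    simp at this
  · rcases eq_or_ne S.toSubmodule ⊥ with h | h
    · exact Or.inl (Subrepresentation.toSubmodule_injective h)
    · obtain ⟨x, hx, hx0⟩ := Submodule.exists_mem_ne_zero_of_ne_bot h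
      obtain ⟨i, hi⟩ := exists_single_mem hχ h2 hq hr hP hρ S hx hx0
      refine Or.inr (Subrepresentation.toSubmodule_injective ?_)
      have hall : ∀ j, (Pi.single j 1 : Fin d → F) ∈ S.toSubmodule := fun j => by
        obtain ⟨g, hg⟩ := exists_odd_levi hχ h2 hq hr hP hρ i j
        exact hg ▸ S.apply_mem_toSubmodule g hi
      refine (Submodule.eq_top_iff' (p := S.toSubmodule)).2 fun y => ?_
      rw [pi_eq_sum_univ' y]
      refine Submodule.sum_mem _ fun j _ => Submodule.smul_mem _ _ ?_
      convert hall j using 1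

/-- An isomorphism would match a character `X ↦ χ(X r_i · r_i)` of the Siegel radical with some `X ↦
χ(a X r_j · r_j)`, so that `a` would be the square of a ratio of coordinates. -/
theorem isEmpty_odd_equiv (hχ : χ ≠ 1) (h2 : (2 : K) ≠ 0) (hq : 3 < Nat.card K) (hr : IsHalfSystem r)
    (hd : 0 < d) (hP : IsWeil χ P) (hρ : ∀ g, ρ g = toLin' (oddMat r (P g)))
    {χ' : AddChar K F} {P' : Sp n K →* Matrix (Fin n → K) (Fin n → K) F} (hP' : IsWeil χ' P')
    {ρ' : Representation F (Sp n K) (Fin d → F)} (hρ' : ∀ g, ρ' g = toLin' (oddMat r (P' g)))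
    {a : K} (ha : ¬ IsSquare a) (hχ' : ∀ t, χ' t = χ (a * t)) : IsEmpty (ρ.Equiv ρ') := by
  have hχ1 : χ' ≠ 1 := by
    intro h
    obtain ⟨t, ht⟩ := AddChar.ne_one_iff.1 hχ
    have ha0 : a ≠ 0 := fun e => ha (e ▸ IsSquare.zero)
    have := hχ' (a⁻¹ * t)
    rw [h, mul_inv_cancel_left₀ ha0] at this
    exact ht (by rw [← this]; rfl)
  refine ⟨fun e => ?_⟩
  let i : Fin d := ⟨0, hd⟩
  have hne : e.toLinearEquiv (Pi.single i 1) ≠ 0 := by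
    rw [Ne, LinearEquiv.map_eq_zero_iff]
    intro h
    have := congrFun h i
    simp at this
  obtain ⟨j, hj⟩ := Function.ne_iff.1 hne
  rw [Pi.zero_apply] at hj
  have hX : ∀ X : Matrix (Fin n) (Fin n) K, Xᵀ = X →
      χ (a * (X *ᵥ r j ⬝ᵥ r j)) = χ (X *ᵥ r i ⬝ᵥ r i) := by
    intro X hX
    have h1 : ρ (unip X hX) (Pi.single i 1) = χ (X *ᵥ r i ⬝ᵥ r i) • Pi.single i 1 := by
      funext k
      rw [odd_unip hχ h2 hq hr hP hρ, Pi.smul_apply, smul_eq_mul]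
      rcases eq_or_ne k i with rfl | hk
      · rfl
      · simp [hk]
    have h3 := Representation.IntertwiningMap.isIntertwining _ _ e.toIntertwiningMap (unip X hX) (Pi.single i 1)
    rw [h1] at h3
    have h4 := congrFun h3 j
    rw [odd_unip hχ1 h2 hq hr hP' hρ', hχ', map_smul, Pi.smul_apply, smul_eq_mul] at h4
    exact (mul_right_cancel₀ hj h4).symm
  have h5 := mul_eq_of_forall_quadratic hχ h2 hX
  obtain ⟨c, hc⟩ := Function.ne_iff.1 (hr.ne_zero j)
  rw [Pi.zero_apply] at hc
  refine ha ⟨r i c / r j c, ?_⟩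
  have := h5 c c
  field_simp
  linear_combination this

end OddPart

/-! ### Matrix coefficients of the Weil representation in the layer -/

section Embedding

variable {n : ℕ} {K : Type*} [Field K] [Fintype K] [DecidableEq K] {F : Type*} [Field F]
  [CharP F 2] {R : Type*} [CommRing R] [IsDomain R] [CharZero R] {φ : R →+* F} {ψ : AddChar K R}
  {P : Sp n K →* Matrix (Fin n → K) (Fin n → K) F}
  {d : ℕ} {r : Fin d → Fin n → K} {ρ : Representation F (Sp n K) (Fin d → F)}

theorem highIdx_last {l : Fin n} (hl : (l : ℕ) + 1 = n) : highIdx l = Sum.inr l := by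
  unfold highIdx
  rw [dif_neg (by omega)]

/-- The coefficient has the invariance of the reduced `whitElt` for the long simple root: `B` acts
trivially on the column at `0`, `U` fixes the last `v` modulo `M`, and on admissible cells the value
is `1`. -/
theorem ofFun_apply_mem (hψ : redChar φ ψ ≠ 1) (h2 : (2 : K) ≠ 0) (hq : 3 < Nat.card K)
    (hq4 : Nat.card K % 4 = 1) (hr : IsHalfSystem r) (hP : IsWeil (redChar φ ψ) P)
    {l : Fin n} (hl : (l : ℕ) + 1 = n) :
    ofFun (fun g => P g (Pi.single l 1) 0) ∈ gowFiltration n K φ (padicValNat 2 (borel n K).index - 1) ∧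
      ofFun (fun g => P g (Pi.single l 1) 0) ∉ gowFiltration n K φ (padicValNat 2 (borel n K).index) := by
  refine ofFun_mem_gowFiltration l hq4 hψ _ (fun g b hb => ?_) (fun u hu g => ?_) (fun σ hσ => ?_)
  · exact hP.apply_mul_siegel hψ h2 hr hq hb.1 g _
  · have h1 := hP.apply_siegel_mul hψ h2 hr hq (triUni_rk_le hu).1 g (Pi.single l 1)
    -- As `l` is the last index, every other `v_i` has larger rank than `v_l`, so these entries lie
    -- below the diagonal.
    have h3 : u.1.toBlocks₂₂ *ᵥ Pi.single l 1 = Pi.single l 1 := by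
      funext i
      rw [mulVec_single_one, col_apply, toBlocks₂₂, of_apply, Pi.single_apply]
      split_ifs with h
      · rw [h, hu.2 _ _ rfl, one_apply_eq]
      · refine hu.1 ?_
        have := i.2
        have : (i : ℕ) ≠ l := fun e => h (Fin.ext e)
        rw [rk_inr, rk_inr]
        omega
    rw [h3, dotProduct_single_one, mulVec_single_one, col_apply] at h1
    rw [h1, highIdx_last hl]
    rfl
  · rw [Asc, highIdx_last hl] at hσ
    have h1 : σ.1⁻¹ (Sum.inr l) = (σ.1⁻¹ (lowIdx l)).swap := weylPerm_swap (inv_mem σ.2) (lowIdx l)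
    have h3 := rk_lt (σ.1⁻¹ (lowIdx l))
    -- The preimages of `u_l` and `v_l` are mirror images, and the one of smaller rank is a `u_i`.
    -- Hence `n_σ` carries a multiple of `u_i` to `v_l`.
    obtain ⟨i, hi⟩ : ∃ i, σ.1⁻¹ (Sum.inr l) = Sum.inl i := by
      rcases hc : σ.1⁻¹ (Sum.inr l) with i | i
      · exact ⟨i, rfl⟩
      · exfalso
        have h4 : rk (σ.1⁻¹ (Sum.inr l)) = 2 * n - 1 - i := by rw [hc, rk_inr]
        have := i.2
        rw [h1, rk_swap] at hσ h4
        omega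
    rw [Equiv.Perm.inv_eq_iff_eq] at hi
    have hm := mono_repElt σ
    have hne := hm.ne_zero (Sum.inl i)
    rw [← hi] at hne
    refine hP.apply_eq_one hr hq (u := Pi.single i ((repElt σ).1 (Sum.inr l) (Sum.inl i))⁻¹) ?_
    have e : (Sum.elim (Pi.single i ((repElt σ).1 (Sum.inr l) (Sum.inl i))⁻¹) (0 : Fin n → K)) =
        Pi.single (Sum.inl i) ((repElt σ).1 (Sum.inr l) (Sum.inl i))⁻¹ := by
      funext x
      rcases x with x | x <;> simp [Pi.single_apply]
    rw [e]
    funext x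
    rw [mulVec_single, Pi.smul_apply, op_smul_eq_mul, col_apply]
    by_cases hx : x = Sum.inr l
    · rw [hx, mul_inv_cancel₀ hne]
      simp
    · rw [hm x (Sum.inl i) (by rw [← hi]; exact hx), zero_mul]
      rcases x with x | x
      · rfl
      · have : x ≠ l := fun e => hx (by rw [e])
        simp [this]

/-- Send the `i`-th coordinate vector to the function `g ↦ Q(g)_{r_i, 0}`. This is equivariant up to
constant functions, which lie in the lower term, and some image is outside that term; irreducibility
gives injectivity. -/
theorem embedsInLayer_odd (hψ : redChar φ ψ ≠ 1) (h2 : (2 : K) ≠ 0) (hq4 : Nat.card K % 4 = 1)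
    (hq : 3 < Nat.card K) (hn : 0 < n) (hr : IsHalfSystem r) (hP : IsWeil (redChar φ ψ) P)
    (hρ : ∀ g, ρ g = toLin' (oddMat r (P g))) :
    EmbedsInLayer ρ (gowFiltration n K φ (padicValNat 2 (borel n K).index - 1))
      (gowFiltration n K φ (padicValNat 2 (borel n K).index)) := by
  have hinv : (redChar φ ψ)⁻¹ = redChar φ ψ⁻¹ := DFunLike.ext _ _ fun t => rfl
  have hψ' : redChar φ ψ⁻¹ ≠ 1 := by rwa [← hinv, Ne, inv_eq_one]
  -- Left translation by `g` brings in the rows of `Q(g⁻¹)`. For `Q` contragredient to `P` these are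
  -- the columns of `P(g)`, as equivariance for `P` demands.
  have hQ : IsWeil (redChar φ ψ⁻¹) (dualRep P) := hinv ▸ hP.dual
  set Q := dualRep P with hQP
  let l : Fin n := ⟨n - 1, by omega⟩
  have hl : (l : ℕ) + 1 = n := by simp only [l]; omega
  have hl0 : (Pi.single l 1 : Fin n → K) ≠ 0 := by
    intro h
    have := congrFun h l
    simp at this
  obtain ⟨h3, h4⟩ := ofFun_apply_mem hψ' h2 hq hq4 hr hQ hl
  -- All nonzero `w` are conjugate under the Levi subgroup, so one coefficient suffices.
  have hmem : ∀ w, w ≠ 0 → ofFun (fun g => Q g w 0) ∈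
      gowFiltration n K φ (padicValNat 2 (borel n K).index - 1) := by
    intro w hw
    obtain ⟨A, hA⟩ := exists_levi_mulVec_eq hw hl0
    have e : ofFun (fun g => Q g w 0) =
        MonoidAlgebra.single (levi A)⁻¹ (1 : F) • ofFun (fun g => Q g (Pi.single l 1) 0) := by
      ext g
      rw [smul_eq_mul, MonoidAlgebra.coeff_single_mul_apply, coeff_ofFun, coeff_ofFun, one_mul, inv_inv]
      have := hQ.apply_siegel_mul hψ' h2 hr hq (h := levi A)
        (by rw [coe_levi, toBlocks_fromBlocks₂₁]) g w
      rw [coe_levi, toBlocks_fromBlocks₁₂, toBlocks_fromBlocks₂₂, zero_mulVec, zero_dotProduct,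
        AddChar.map_zero_eq_one, one_mul, hA] at this
      exact this.symm
    rw [e]
    exact Submodule.smul_mem _ _ h3
  obtain ⟨i₀, hi₀⟩ : ∃ i, ∀ g, Q g (r i) 0 = Q g (Pi.single l 1) 0 := by
    obtain ⟨i, hi | hi⟩ := hr.exists_eq _ hl0
    · exact ⟨i, fun g => by rw [hi]⟩
    · refine ⟨i, fun g => ?_⟩
      rw [hi, ← hQ.even g (r i) 0, neg_zero]
  let Φ : (Fin d → F) →ₗ[F] MonoidAlgebra F (Sp n K) :=
    ∑ i, (LinearMap.proj i).smulRight (ofFun fun g => Q g (r i) 0)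
  have hΦ : ∀ x, Φ x = ∑ i, x i • ofFun fun g => Q g (r i) 0 := fun x => by
    simp [Φ]
  have hΦc : ∀ x g, (Φ x).coeff g = ∑ i, x i * Q g (r i) 0 := fun x g => by
    rw [hΦ, MonoidAlgebra.coeff_sum, Finsupp.finsetSum_apply]
    simp
  refine embedsInLayer_of_linearMap (isIrreducible_odd hψ h2 hq hr (Nat.pos_of_ne_zero ?_) hP hρ) Φ
    (fun x => ?_) (fun g x => ?_) (x₀ := Pi.single i₀ 1) ?_
  · rintro rfl
    exact i₀.elim0
  · rw [hΦ]
    refine Submodule.sum_mem _ fun i _ => ?_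
    rw [← single_one_mul_eq_smul]
    exact Submodule.smul_mem _ _ (hmem _ (hr.ne_zero i))
  -- The defect comes from the summation index `0`, where `Q h 0 0 = 1` makes the function constant.
  · have e : Φ (ρ g x) - MonoidAlgebra.single g 1 * Φ x =
        MonoidAlgebra.single (1 : Sp n K) (-∑ i, x i * P g 0 (r i)) •
          ofFun (fun _ : Sp n K => (1 : F)) := by
      ext h
      have h5 : ∀ i, Q (g⁻¹ * h) (r i) 0 = P g 0 (r i) + ∑ j, oddMat r (P g) j i * Q h (r j) 0 := by
        intro i
        rw [map_mul, Matrix.mul_apply, hr.sum_eq, hQ.apply_zero_zero hr hq, mul_one]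
        have e1 : ∀ v, Q g⁻¹ (r i) v = P g v (r i) := fun v => by
          rw [hQP, dualRep_apply, inv_inv, transpose_apply]
        simp only [e1]
        congr 1
        refine Finset.sum_congr rfl fun j _ => ?_
        have e2 : P g (-r j) (r i) = P g (r j) (-r i) := by rw [← hP.even g (r j) (-r i), neg_neg]
        have e3 : Q h (-r j) 0 = Q h (r j) 0 := by rw [← hQ.even h (r j) 0, neg_zero]
        -- The sum over the pair `{v, -v}` becomes the difference in `oddMat` because signs do not
        -- matter in characteristic two.
        rw [e2, e3, ← add_mul, oddMat, of_apply, CharTwo.sub_eq_add]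
      rw [smul_eq_mul, single_one_mul_eq_smul]
      simp only [MonoidAlgebra.coeff_sub, Finsupp.sub_apply, MonoidAlgebra.coeff_smul,
        Finsupp.smul_apply, MonoidAlgebra.coeff_single_mul_apply, one_mul, coeff_ofFun, smul_eq_mul,
        mul_one, hΦc, h5, mul_add, Finset.sum_add_distrib, hρ, toLin'_apply, mulVec, dotProduct]
      have e4 : ∑ i, (∑ j, oddMat r (P g) i j * x j) * Q h (r i) 0 =
          ∑ i, x i * ∑ j, oddMat r (P g) j i * Q h (r j) 0 := by
        simp only [Finset.sum_mul, Finset.mul_sum]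
        rw [Finset.sum_comm]
        exact Finset.sum_congr rfl fun i _ => Finset.sum_congr rfl fun j _ => by ring
      rw [e4]
      ring
    rw [e]
    exact Submodule.smul_mem _ _ (ofFun_one_mem φ (Nat.odd_iff.2 (by omega)) l)
  · have e : Φ (Pi.single i₀ 1) = ofFun (fun g => Q g (Pi.single l 1) 0) := by
      ext g
      rw [hΦc, coeff_ofFun, ← hi₀ g]
      simp [Pi.single_apply]
    rw [e]
    exact h4

end Embedding

/-! ### Comparison of reductions -/

section Reductions

variable {G : Type*} [Group G]

theorem baseChangeRep_apply {R E : Type*} [CommRing R] [CommRing E] (f : R →+* E) {d : ℕ}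
    (ρ : G →* Matrix (Fin d) (Fin d) R) (g : G) :
    baseChangeRep f ρ g = toLin' ((ρ g).map f) := rfl

/-- Matrices with coefficients in an extension which intertwine two matrix representations yield
such matrices over a principal ideal domain. -/
theorem exists_intertwiner_of_complex {R : Subring ℂ} [IsPrincipalIdealRing R] {d e : ℕ}
    {ρ : G →* Matrix (Fin d) (Fin d) R} {τ : G →* Matrix (Fin e) (Fin e) R}
    {M : Matrix (Fin e) (Fin d) ℂ} (hM : M ≠ 0)
    (h : ∀ g, M * (ρ g).map R.subtype = (τ g).map R.subtype * M) :
    ∃ M' : Matrix (Fin e) (Fin d) R, M' ≠ 0 ∧ ∀ g, M' * ρ g = τ g * M' := by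
  -- The `R`-span of the entries is finitely generated and torsion-free, hence free. A coordinate
  -- function on it is `R`-linear, so applied entrywise it preserves the intertwining relations; one
  -- is chosen that does not kill `M`.
  let S : Submodule R ℂ := Submodule.span R (Set.range fun x : Fin e × Fin d => M x.1 x.2)
  have hfin : Module.Finite R S := Module.Finite.span_of_finite R (Set.finite_range _)
  have hS : ∀ i j, M i j ∈ S := fun i j => Submodule.subset_span ⟨(i, j), rfl⟩
  let b := Module.Free.chooseBasis R S
  obtain ⟨i, j, hij⟩ : ∃ i j, M i j ≠ 0 := by
    by_contra! hc
    exact hM (Matrix.ext hc)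
  obtain ⟨k, hk⟩ : ∃ k, b.coord k ⟨M i j, hS i j⟩ ≠ 0 := by
    by_contra! hc
    have := b.forall_coord_eq_zero_iff.1 hc
    exact hij (congrArg Subtype.val this)
  refine ⟨of fun i j => b.coord k ⟨M i j, hS i j⟩, fun h0 => hk (congrFun (congrFun h0 i) j), fun g => ?_⟩
  ext1 a c
  have h1 : ∑ x, (ρ g x c) • (⟨M a x, hS a x⟩ : S) = ∑ x, (τ g a x) • (⟨M x c, hS x c⟩ : S) := by
    refine Subtype.ext ?_
    have h2 := congrFun (congrFun (h g) a) c
    rw [Matrix.mul_apply, Matrix.mul_apply] at h2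
    rw [AddSubmonoidClass.coe_finsetSum, AddSubmonoidClass.coe_finsetSum]
    simp only [Submodule.coe_smul, map_apply, Subring.subtype_apply] at h2 ⊢
    rw [Finset.sum_congr rfl fun x _ => ?_, h2]
    · rfl
    · exact mul_comm _ _
  have h3 := congrArg (b.coord k) h1
  rw [map_sum, map_sum] at h3
  simp only [map_smul, smul_eq_mul] at h3
  rw [Matrix.mul_apply, Matrix.mul_apply]
  simp only [of_apply]
  rw [← h3]
  exact Finset.sum_congr rfl fun x _ => mul_comm _ _

/-- Divide by an entry of minimal valuation. The entry `1` keeps the matrix nonzero after reduction.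
-/
theorem exists_intertwiner_entry_one {R : Type*} [CommRing R] [IsDomain R] [IsDiscreteValuationRing R]
    {d e : ℕ} {ρ : G →* Matrix (Fin d) (Fin d) R} {τ : G →* Matrix (Fin e) (Fin e) R}
    {M : Matrix (Fin e) (Fin d) R} (hM : M ≠ 0) (h : ∀ g, M * ρ g = τ g * M) :
    ∃ M' : Matrix (Fin e) (Fin d) R, (∃ i j, M' i j = 1) ∧ ∀ g, M' * ρ g = τ g * M' := by
  obtain ⟨i, j, hij⟩ : ∃ i j, M i j ≠ 0 := by
    by_contra! hc
    exact hM (Matrix.ext hc)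
  obtain ⟨⟨a, b⟩, -, hmin⟩ := Finset.exists_min_image (Finset.univ : Finset (Fin e × Fin d))
    (fun x => IsDiscreteValuationRing.addVal R (M x.1 x.2)) ⟨(i, j), Finset.mem_univ _⟩
  have hdvd : ∀ k m, M a b ∣ M k m := fun k m =>
    IsDiscreteValuationRing.addVal_le_iff_dvd.1 (hmin (k, m) (Finset.mem_univ _))
  have h0 : M a b ≠ 0 := fun e => hij (by simpa [e] using hdvd i j)
  choose N hN using hdvd
  have hN' : M = M a b • of N := Matrix.ext hN
  refine ⟨of N, ⟨a, b, mul_left_cancel₀ h0 (by rw [mul_one]; exact (hN a b).symm)⟩, fun g => ?_⟩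
  have h1 := h g
  rw [hN', Matrix.smul_mul, Matrix.mul_smul] at h1
  ext1 k m
  exact mul_left_cancel₀ h0 (by simpa using congrFun (congrFun h1 k) m)

variable {F : Type*} [Field F]

/-- A complex isomorphism yields an intertwiner over `R` with nonzero reduction. Irreducibility of
the source makes this reduction injective, and equality of the dimensions makes it bijective. -/
theorem nonempty_equiv_of_complex {R : Subring ℂ} [IsDiscreteValuationRing R] (φ : R →+* F) {d e : ℕ}
    {ρ : G →* Matrix (Fin d) (Fin d) R} {τ : G →* Matrix (Fin e) (Fin e) R}
    (hρ : (baseChangeRep φ ρ).IsIrreducible)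
    (E : (baseChangeRep R.subtype ρ).Equiv (baseChangeRep R.subtype τ)) :
    Nonempty ((baseChangeRep φ ρ).Equiv (baseChangeRep φ τ)) := by
  have hde : d = e := by
    have := E.toLinearEquiv.finrank_eq
    simpa using this
  have hd : 0 < d := by
    rw [Nat.pos_iff_ne_zero]
    rintro rfl
    obtain ⟨S, T, hST⟩ := hρ.toNontrivial
    refine hST (Subrepresentation.toSubmodule_injective ?_)
    exact Subsingleton.elim _ _
  obtain ⟨M, hM, hMi⟩ : ∃ M : Matrix (Fin e) (Fin d) ℂ, M ≠ 0 ∧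
      ∀ g, M * (ρ g).map R.subtype = (τ g).map R.subtype * M := by
    refine ⟨LinearMap.toMatrix' E.toLinearEquiv.toLinearMap, fun h0 => ?_, fun g => ?_⟩
    · rw [LinearEquiv.map_eq_zero_iff] at h0
      have h1 := LinearMap.congr_fun h0 (Pi.single ⟨0, hd⟩ 1)
      have h2 : (Pi.single ⟨0, hd⟩ 1 : Fin d → ℂ) = 0 := E.toLinearEquiv.map_eq_zero_iff.1 h1
      have := congrFun h2 ⟨0, hd⟩
      simp at this
    · have h1 : E.toLinearEquiv.toLinearMap ∘ₗ toLin' ((ρ g).map R.subtype) =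
          toLin' ((τ g).map R.subtype) ∘ₗ E.toLinearEquiv.toLinearMap :=
        E.toIntertwiningMap.isIntertwining' g
      have h2 := congrArg LinearMap.toMatrix' h1
      rw [LinearMap.toMatrix'_comp, LinearMap.toMatrix'_comp, LinearMap.toMatrix'_toLin',
        LinearMap.toMatrix'_toLin'] at h2
      exact h2
  obtain ⟨M₁, hM₁, hM₁i⟩ := exists_intertwiner_of_complex hM hMi
  obtain ⟨M₂, ⟨i, j, hij⟩, hM₂i⟩ := exists_intertwiner_entry_one hM₁ hM₁i
  let f : Representation.IntertwiningMap (baseChangeRep φ ρ) (baseChangeRep φ τ) :=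
    { toLinearMap := toLin' (M₂.map φ)
      isIntertwining' := fun g => by
        rw [baseChangeRep_apply, baseChangeRep_apply, ← toLin'_mul, ← toLin'_mul, ← Matrix.map_mul,
          ← Matrix.map_mul, hM₂i] }
  have hf : Function.Injective f := by
    refine (Representation.IsIrreducible.injective_or_eq_zero f).resolve_right fun h0 => ?_
    have h1 : toLin' (M₂.map φ) = 0 := congrArg (fun f => f.toLinearMap) h0
    rw [LinearEquiv.map_eq_zero_iff] at h1
    have h2 := congrFun (congrFun h1 i) j
    rw [map_apply, hij, map_one] at h2
    exact one_ne_zero h2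
  have hf' : Function.Surjective f :=
    (LinearMap.injective_iff_surjective_of_finrank_eq_finrank (f := f.toLinearMap)
      (by simp [hde])).1 hf
  exact ⟨f.ofBijective ⟨hf, hf'⟩⟩

variable {V V' : Type*} [AddCommGroup V] [Module F V] [AddCommGroup V'] [Module F V']

theorem isIrreducible_of_equiv {ρ : Representation F G V} {τ : Representation F G V'} (E : ρ.Equiv τ)
    (h : τ.IsIrreducible) : ρ.IsIrreducible := by
  rw [Representation.irreducible_iff_isSimpleModule_asModule] at h ⊢
  have hb : Function.Bijective (Representation.IntertwiningMap.equivLinearMapAsModule ρ τ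
    E.toIntertwiningMap) := E.toLinearEquiv.bijective
  exact IsSimpleModule.congr (LinearEquiv.ofBijective _ hb)

theorem embedsInLayer_of_equiv {ρ : Representation F G V} {τ : Representation F G V'} (E : ρ.Equiv τ)
    {A A' : Submodule (MonoidAlgebra F G) (MonoidAlgebra F G)} (h : EmbedsInLayer τ A A') :
    EmbedsInLayer ρ A A' := by
  obtain ⟨f, hf⟩ := h
  have hb : Function.Injective (Representation.IntertwiningMap.equivLinearMapAsModule ρ τ
    E.toIntertwiningMap) := E.toLinearEquiv.injective
  refine ⟨f ∘ₗ Representation.IntertwiningMap.equivLinearMapAsModule ρ τ E.toIntertwiningMap, ?_⟩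
  exact hf.comp hb

theorem nonempty_equiv_of_isReduction {R : Subring ℂ} [IsDiscreteValuationRing R] {φ : R →+* F} {d : ℕ}
    {ρ : G →* Matrix (Fin d) (Fin d) R} (hρ : (baseChangeRep φ ρ).IsIrreducible)
    {N : Representation F G V} (hN : IsReduction φ (baseChangeRep R.subtype ρ) N) :
    Nonempty (N.Equiv (baseChangeRep φ ρ)) := by
  obtain ⟨e, τ, ⟨E⟩, ⟨E'⟩⟩ := hN
  obtain ⟨E''⟩ := nonempty_equiv_of_complex φ hρ E
  exact ⟨E'.trans E''.symm⟩

end Reductions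

/-! ### Complex Weil modules -/

section ComplexWeil

variable {n : ℕ} {K : Type*} [Field K] [Fintype K] [DecidableEq K]

variable (n K) in
/-- Matrices as endomorphisms of the space with basis `(ε_w)`. -/
def endEquiv : Matrix (Fin n → K) (Fin n → K) ℂ ≃ₐ[ℂ] Module.End ℂ ((Fin n → K) →₀ ℂ) :=
  toLinAlgEquiv'.trans
    (LinearEquiv.conjAlgEquiv ℂ (Finsupp.linearEquivFunOnFinite ℂ ℂ (Fin n → K)).symm)

theorem endEquiv_apply (M : Matrix (Fin n → K) (Fin n → K) ℂ) (y : (Fin n → K) →₀ ℂ) (a : Fin n → K) :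
    endEquiv n K M y a = ∑ b, M a b * y b := rfl

theorem endEquiv_schMat (ψ : AddChar K ℂ) (α : K) (x : Fin n ⊕ Fin n → K) :
    endEquiv n K (ψ α • schMat ψ x) = schrodinger ψ α x := by
  refine Finsupp.lhom_ext' fun w => LinearMap.ext_ring ?_
  ext a
  rw [LinearMap.comp_apply, LinearMap.comp_apply, Finsupp.lsingle_apply, endEquiv_apply, schrodinger,
    Finsupp.linearCombination_single, one_smul, Finset.sum_eq_single w]
  · rw [Finsupp.single_eq_same, mul_one, Matrix.smul_apply, schMat, of_apply, Finsupp.single_apply,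
      smul_eq_mul, AddChar.map_add_eq_mul]
    by_cases h : a = w + x ∘ Sum.inr
    · rw [if_pos h, if_pos h.symm]
    · rw [if_neg h, if_neg (Ne.symm h), mul_zero]
  · intro b _ hb
    rw [Finsupp.single_eq_of_ne hb, mul_zero]
  · simp

/-- The representation on the space with basis `(ε_w)` given by a matrix representation. -/
def repOf (Q : Sp n K →* Matrix (Fin n → K) (Fin n → K) ℂ) :
    Representation ℂ (Sp n K) ((Fin n → K) →₀ ℂ) :=
  (endEquiv n K).toMulEquiv.toMonoidHom.comp Q

theorem repOf_apply (Q : Sp n K →* Matrix (Fin n → K) (Fin n → K) ℂ) (g : Sp n K) :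
    repOf Q g = endEquiv n K (Q g) := rfl

theorem exists_repOf_eq (P : Representation ℂ (Sp n K) ((Fin n → K) →₀ ℂ)) : ∃ Q, repOf Q = P := by
  refine ⟨(endEquiv n K).symm.toMulEquiv.toMonoidHom.comp P, MonoidHom.ext fun g => ?_⟩
  exact (endEquiv n K).apply_symm_apply (P g)

theorem isWeilRep_repOf_iff {ψ : AddChar K ℂ} {Q : Sp n K →* Matrix (Fin n → K) (Fin n → K) ℂ} :
    IsWeilRep ψ (repOf Q) ↔ ∀ g, Intw ψ g (Q g) := by
  have key : ∀ g α x, (repOf Q g ∘ₗ schrodinger ψ α x = schrodinger ψ α (g.1 *ᵥ x) ∘ₗ repOf Q g ↔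
      ψ α • (Q g * schMat ψ x) = ψ α • (schMat ψ (g.1 *ᵥ x) * Q g)) := by
    intro g α x
    rw [← endEquiv_schMat, ← endEquiv_schMat, repOf_apply]
    change endEquiv n K (Q g) * _ = _ * endEquiv n K (Q g) ↔ _
    rw [← map_mul, ← map_mul, (endEquiv n K).injective.eq_iff, Matrix.mul_smul, Matrix.smul_mul]
  constructor
  · intro h g x
    have := (key g 0 x).1 (h g 0 x)
    rwa [AddChar.map_zero_eq_one, one_smul, one_smul] at this
  · intro h g α x
    rw [key, h g x]

section OddIncl

variable {d : ℕ} (r : Fin d → Fin n → K)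

/-- The parametrization of the odd part by the coordinates with respect to `ε_v - ε_{-v}`. -/
def oddIncl : (Fin d → ℂ) →ₗ[ℂ] ((Fin n → K) →₀ ℂ) :=
  Fintype.linearCombination ℂ fun i => Finsupp.single (r i) 1 - Finsupp.single (-r i) 1

variable {r}

theorem oddIncl_apply (x : Fin d → ℂ) (a : Fin n → K) :
    oddIncl r x a = ∑ i, x i * ((if a = r i then 1 else 0) - if a = -r i then 1 else 0) := by
  rw [oddIncl, Fintype.linearCombination_apply, Finsupp.finsetSum_apply]
  refine Finset.sum_congr rfl fun i _ => ?_
  rw [Finsupp.smul_apply, Finsupp.sub_apply, Finsupp.single_apply, Finsupp.single_apply, smul_eq_mul]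
  simp only [eq_comm]

theorem oddIncl_apply_half (hr : IsHalfSystem r) (x : Fin d → ℂ) (i : Fin d) :
    oddIncl r x (r i) = x i := by
  rw [oddIncl_apply, Finset.sum_eq_single i]
  · rw [if_pos rfl, if_neg (hr.ne_neg i i)]
    ring
  · intro j _ hj
    rw [if_neg (fun e => hj (hr.injective e).symm), if_neg (hr.ne_neg i j)]
    ring
  · simp

theorem oddIncl_neg (x : Fin d → ℂ) (a : Fin n → K) : oddIncl r x (-a) = -oddIncl r x a := by
  rw [oddIncl_apply, oddIncl_apply, ← Finset.sum_neg_distrib]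
  refine Finset.sum_congr rfl fun i _ => ?_
  simp only [neg_eq_iff_eq_neg, neg_neg]
  ring

theorem oddIncl_zero (x : Fin d → ℂ) : oddIncl r x 0 = 0 := by
  have := oddIncl_neg (r := r) x 0
  rw [neg_zero] at this
  linear_combination this / 2

theorem oddIncl_injective (hr : IsHalfSystem r) : Function.Injective (oddIncl r) := fun x y h =>
  funext fun i => by rw [← oddIncl_apply_half hr x i, h, oddIncl_apply_half hr]

theorem range_oddIncl (hr : IsHalfSystem r) : LinearMap.range (oddIncl r) = oddPart n K := by
  rw [oddIncl, Fintype.range_linearCombination, oddPart]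
  refine le_antisymm (Submodule.span_mono ?_) (Submodule.span_le.2 ?_)
  · rintro _ ⟨i, rfl⟩
    exact ⟨r i, rfl⟩
  · rintro _ ⟨v, rfl⟩
    rcases eq_or_ne v 0 with rfl | hv
    · simp
    · obtain ⟨i, rfl | rfl⟩ := hr.exists_eq v hv
      · exact Submodule.subset_span ⟨i, rfl⟩
      · have := Submodule.neg_mem _ (Submodule.subset_span (R := ℂ) (s := Set.range fun i =>
          (Finsupp.single (r i) 1 - Finsupp.single (-r i) 1 : (Fin n → K) →₀ ℂ)) ⟨i, rfl⟩)
        simpa using this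

theorem endEquiv_oddIncl (hr : IsHalfSystem r) {M : Matrix (Fin n → K) (Fin n → K) ℂ}
    (hM : IsEvenMat M) (x : Fin d → ℂ) :
    oddIncl r (oddMat r M *ᵥ x) = endEquiv n K M (oddIncl r x) := by
  have h1 : ∀ i, endEquiv n K M (oddIncl r x) (r i) = (oddMat r M *ᵥ x) i := by
    intro i
    rw [endEquiv_apply, hr.sum_eq, oddIncl_zero, mul_zero, zero_add, mulVec, dotProduct]
    refine Finset.sum_congr rfl fun j _ => ?_
    rw [oddIncl_neg, oddIncl_apply_half hr, oddMat, of_apply]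
    ring
  have h2 : ∀ a, endEquiv n K M (oddIncl r x) (-a) = -endEquiv n K M (oddIncl r x) a := by
    intro a
    rw [endEquiv_apply, endEquiv_apply, ← Equiv.sum_comp (Equiv.neg _), ← Finset.sum_neg_distrib]
    refine Finset.sum_congr rfl fun b _ => ?_
    rw [Equiv.neg_apply, hM, oddIncl_neg]
    ring
  ext a
  rcases eq_or_ne a 0 with rfl | ha
  · have := h2 0
    rw [neg_zero] at this
    rw [oddIncl_zero]
    linear_combination -this / 2
  · obtain ⟨i, rfl | rfl⟩ := hr.exists_eq a ha
    · rw [oddIncl_apply_half hr, h1]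
    · rw [oddIncl_neg, h2, oddIncl_apply_half hr, h1]

end OddIncl

variable {d : ℕ} {r : Fin d → Fin n → K} {R : Subring ℂ} {ψ : AddChar K R}
  {P : Sp n K →* Matrix (Fin n → K) (Fin n → K) R}

/-- The inclusion of the odd part. -/
def oddInclMap (hr : IsHalfSystem r) (hP : IsWeil ψ P) :
    Representation.IntertwiningMap (baseChangeRep R.subtype (oddRep hr hP)) (repOf (mapRep R.subtype P)) where
  toLinearMap := oddIncl r
  isIntertwining' g := LinearMap.ext fun x => by
    have h := endEquiv_oddIncl hr ((hP.map R.subtype).even g) x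
    have e : (oddRep hr hP g).map R.subtype = oddMat r (mapRep R.subtype P g) := by
      ext i j
      simp [oddRep_apply, oddMat, mapRep_apply]
    rw [LinearMap.comp_apply, LinearMap.comp_apply, baseChangeRep_apply, toLin'_apply, e, h]
    rfl

theorem isSmallWeilModule_odd (hr : IsHalfSystem r) (hP : IsWeil ψ P)
    (hψ : redChar R.subtype ψ ≠ 1) : IsSmallWeilModule (baseChangeRep R.subtype (oddRep hr hP)) :=
  ⟨redChar R.subtype ψ, hψ, repOf (mapRep R.subtype P), isWeilRep_repOf_iff.2 (hP.map R.subtype).intw,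
    oddInclMap hr hP, oddIncl_injective hr, range_oddIncl hr⟩

theorem nonempty_equiv_of_range_eq {V V' Y : Type*} [AddCommGroup V] [Module ℂ V] [AddCommGroup V']
    [Module ℂ V'] [AddCommGroup Y] [Module ℂ Y] {G : Type*} [Group G] {ρ : Representation ℂ G V}
    {τ : Representation ℂ G V'} {P : Representation ℂ G Y} (S : Representation.IntertwiningMap ρ P)
    (T : Representation.IntertwiningMap τ P) (hS : Function.Injective S) (hT : Function.Injective T)
    (h : LinearMap.range S.toLinearMap = LinearMap.range T.toLinearMap) : Nonempty (ρ.Equiv τ) := by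
  let e : V ≃ₗ[ℂ] V' := (LinearEquiv.ofInjective S.toLinearMap hS).trans
    ((LinearEquiv.ofEq _ _ h).trans (LinearEquiv.ofInjective T.toLinearMap hT).symm)
  have he : ∀ v, T (e v) = S v := by
    intro v
    have := LinearEquiv.apply_symm_apply (LinearEquiv.ofInjective T.toLinearMap hT)
      (LinearEquiv.ofEq _ _ h (LinearEquiv.ofInjective S.toLinearMap hS v))
    exact congrArg Subtype.val this
  refine ⟨Representation.Equiv.mk e fun g => LinearMap.ext fun v => hT ?_⟩
  have h1 := Representation.IntertwiningMap.isIntertwining _ _ T g (e v)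
  have h2 := Representation.IntertwiningMap.isIntertwining _ _ S g v
  change T (e (ρ g v)) = T (τ g (e v))
  rw [he, h1, h2, he]

/-- Scaling carries a Weil representation to one whose type differs by a square factor. -/
theorem intw_scale {χ ψ : AddChar K ℂ} {s : K} (hs : s ≠ 0) (h : ∀ t, χ t = ψ (s ^ 2 * t))
    {Q Q' : Sp n K →* Matrix (Fin n → K) (Fin n → K) ℂ} (hQ : ∀ g, Intw χ g (Q g))
    (hQ' : ∀ g a b, Q' g (s • a) (s • b) = Q g a b) (g : Sp n K) : Intw ψ g (Q' g) := by
  rw [intw_iff]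
  intro x a b
  have h1 := intw_iff.1 (hQ g) (s⁻¹ • x) (s⁻¹ • a) (s⁻¹ • b)
  have e1 : (s⁻¹ • x) ∘ Sum.inr = s⁻¹ • (x ∘ Sum.inr) := rfl
  have e2 : (s⁻¹ • x) ∘ Sum.inl = s⁻¹ • (x ∘ Sum.inl) := rfl
  have e3 : (s⁻¹ • (g.1 *ᵥ x)) ∘ Sum.inr = s⁻¹ • ((g.1 *ᵥ x) ∘ Sum.inr) := rfl
  have e4 : (s⁻¹ • (g.1 *ᵥ x)) ∘ Sum.inl = s⁻¹ • ((g.1 *ᵥ x) ∘ Sum.inl) := rfl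
  have e5 : ∀ y : K, s ^ 2 * (s⁻¹ * (s⁻¹ * y)) = y := fun y => by field_simp
  rw [mulVec_smul, e1, e2, e3, e4, ← hQ', ← hQ', h, h, smul_comm (2 : K) s⁻¹ b,
    smul_comm (2 : K) s⁻¹ a, ← smul_add, ← smul_add, ← smul_sub, ← smul_sub] at h1
  simp only [smul_inv_smul₀ hs, smul_dotProduct, dotProduct_smul, smul_eq_mul, e5] at h1
  exact h1

/-- Rescaling `N` by `s` changes the type by `s²` and preserves the odd part. After rescaling both
representations have the same type, hence agree by `IsWeil.unique`. -/
theorem nonempty_equiv_odd (hr : IsHalfSystem r) (hP : IsWeil ψ P) (h2 : (2 : K) ≠ 0)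
    (hq : 3 < Nat.card K) (hψ : redChar R.subtype ψ ≠ 1) {χ : AddChar K ℂ} {s : K} (hs : s ≠ 0)
    (hχ : ∀ t, χ t = redChar R.subtype ψ (s ^ 2 * t)) {V : Type*} [AddCommGroup V] [Module ℂ V]
    {W : Representation ℂ (Sp n K) V} {P₀ : Representation ℂ (Sp n K) ((Fin n → K) →₀ ℂ)}
    (hP₀ : IsWeilRep χ P₀) (T : Representation.IntertwiningMap W P₀) (hT : Function.Injective T)
    (hT' : LinearMap.range T.toLinearMap = oddPart n K) :
    Nonempty (W.Equiv (baseChangeRep R.subtype (oddRep hr hP))) := by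
  obtain ⟨Q, rfl⟩ := exists_repOf_eq P₀
  rw [isWeilRep_repOf_iff] at hP₀
  let σ : Equiv.Perm (Fin n → K) := (LinearEquiv.smulOfNeZero K (Fin n → K) s hs).toEquiv
  have hσ : ∀ a, σ a = s • a := fun a => rfl
  let Q' : Sp n K →* Matrix (Fin n → K) (Fin n → K) ℂ :=
    (reindexAlgEquiv ℂ ℂ σ).toMulEquiv.toMonoidHom.comp Q
  have hQ' : ∀ g a b, Q' g (s • a) (s • b) = Q g a b := by
    intro g a b
    change Q g (σ.symm (σ a)) (σ.symm (σ b)) = _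
    rw [σ.symm_apply_apply, σ.symm_apply_apply]
  have heq : Q' = mapRep R.subtype P :=
    IsWeil.unique hψ h2 hq (hP.map R.subtype).intw (intw_scale hs hχ hP₀ hQ')
  let D : ((Fin n → K) →₀ ℂ) ≃ₗ[ℂ] ((Fin n → K) →₀ ℂ) := Finsupp.domLCongr σ
  have hD : ∀ y a, D y (s • a) = y a := by
    intro y a
    change y (σ.symm (σ a)) = y a
    rw [σ.symm_apply_apply]
  let S : Representation.IntertwiningMap W (repOf (mapRep R.subtype P)) :=
    { toLinearMap := D.toLinearMap ∘ₗ T.toLinearMap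
      isIntertwining' := fun g => LinearMap.ext fun v => by
        have h1 := Representation.IntertwiningMap.isIntertwining _ _ T g v
        change D (T (W g v)) = repOf (mapRep R.subtype P) g (D (T v))
        rw [h1, ← heq, repOf_apply, repOf_apply]
        ext a
        obtain ⟨a, rfl⟩ := σ.surjective a
        rw [hσ, hD, endEquiv_apply, endEquiv_apply]
        exact Fintype.sum_equiv σ _ _ fun b => by rw [hσ, hQ', hD] }
  refine nonempty_equiv_of_range_eq S (oddInclMap hr hP) (D.injective.comp hT) (oddIncl_injective hr) ?_
  change LinearMap.range (D.toLinearMap ∘ₗ T.toLinearMap) = LinearMap.range (oddIncl r)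
  rw [LinearMap.range_comp, hT', range_oddIncl hr, oddPart, Submodule.map_span]
  congr 1
  have hDs : ∀ v, D (Finsupp.single v 1) = Finsupp.single (s • v) 1 := fun v =>
    Finsupp.domLCongr_single σ v 1
  ext y
  constructor
  · rintro ⟨_, ⟨v, rfl⟩, rfl⟩
    refine ⟨s • v, ?_⟩
    simp [hDs]
  · rintro ⟨v, rfl⟩
    refine ⟨_, ⟨s⁻¹ • v, rfl⟩, ?_⟩
    simp [hDs, smul_inv_smul₀ hs]

end ComplexWeil

/-! ### Additive characters of finite fields -/

section Characters

variable {K : Type*} [Field K]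

/-- Compose the character `k ↦ ζ ^ k` of the prime field with a linear functional that does not
vanish at `1`. -/
theorem exists_addChar_apply_eq [Finite K] (p : ℕ) [Fact p.Prime] [CharP K p] {R : Type*} [CommRing R]
    {ζ : R} (hζ : ζ ^ p = 1) : ∃ (ψ : AddChar K R) (t : K), ψ t = ζ := by
  let _ := ZMod.algebra K p
  obtain ⟨f, h1⟩ : ∃ f : Module.Dual (ZMod p) K, f 1 ≠ 0 := by
    by_contra! h
    exact one_ne_zero ((Module.forall_dual_apply_eq_zero_iff (ZMod p) (1 : K)).1 h)
  refine ⟨(AddChar.zmodChar p hζ).compAddMonoidHom f.toAddMonoidHom, (f 1)⁻¹ • (1 : K), ?_⟩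
  have h2 : f ((f 1)⁻¹ • (1 : K)) = 1 := by rw [map_smul, smul_eq_mul, inv_mul_cancel₀ h1]
  change AddChar.zmodChar p hζ (f ((f 1)⁻¹ • (1 : K))) = ζ
  have : Fact (1 < p) := ⟨(Fact.out : p.Prime).one_lt⟩
  rw [h2, AddChar.zmodChar_apply, ZMod.val_one, pow_one]

/-- If `ζ` reduced to `1`, then `1 + ζ + ⋯ + ζ ^ (p - 1) = 0` would reduce to `p = 0`, but `p` is
odd and `F` has characteristic two. -/
theorem exists_redChar_ne_one [Finite K] {p : ℕ} [CharP K p] (hp : p.Prime) (hp2 : Odd p)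
    {R : Type*} [CommRing R] [IsDomain R] (hζ : ∃ ζ : R, IsPrimitiveRoot ζ p) {F : Type*} [Field F]
    [CharP F 2] (φ : R →+* F) : ∃ ψ : AddChar K R, redChar φ ψ ≠ 1 := by
  have := Fact.mk hp
  obtain ⟨ζ, hζ⟩ := hζ
  obtain ⟨ψ, t, ht⟩ := exists_addChar_apply_eq (K := K) p hζ.pow_eq_one
  refine ⟨ψ, fun h => ?_⟩
  have h1 : φ ζ = 1 := by
    rw [← ht, ← redChar_apply, h]
    rfl
  have h2 := congrArg φ (hζ.geom_sum_eq_zero hp.one_lt)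
  rw [map_sum, map_zero] at h2
  simp only [map_pow, h1, one_pow, Finset.sum_const, Finset.card_range, nsmul_eq_mul, mul_one,
    natCast_eq_one_of_odd hp2] at h2
  exact one_ne_zero h2

theorem ne_one_of_redChar_ne_one {R F : Type*} [CommRing R] [Field F] {φ : R →+* F} {ψ : AddChar K R}
    (h : redChar φ ψ ≠ 1) : ψ ≠ 1 := by
  rintro rfl
  exact h (DFunLike.ext _ _ fun t => map_one φ)

theorem redChar_subtype_ne_one {R : Subring ℂ} {ψ : AddChar K R} (h : ψ ≠ 1) :
    redChar R.subtype ψ ≠ 1 := by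
  intro h1
  exact h (DFunLike.ext _ _ fun t => Subtype.ext (DFunLike.congr_fun h1 t))

theorem mulShift_ne_one {R : Type*} [CommRing R] {ψ : AddChar K R} (h : ψ ≠ 1) {a : K} (ha : a ≠ 0) :
    AddChar.mulShift ψ a ≠ 1 :=
  AddChar.IsPrimitive.of_ne_one h ha

theorem exists_mulShift_eq [Finite K] {χ ψ : AddChar K ℂ} (hψ : ψ ≠ 1) :
    ∃ c : K, χ = AddChar.mulShift ψ c := by
  have := Fintype.ofFinite K
  have h := (Fintype.bijective_iff_injective_and_card (AddChar.mulShift ψ)).2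
    ⟨AddChar.to_mulShift_inj_of_isPrimitive (AddChar.IsPrimitive.of_ne_one hψ),
      AddChar.card_eq.symm⟩
  obtain ⟨c, hc⟩ := h.2 χ
  exact ⟨c, hc.symm⟩

theorem exists_eq_sq_or_eq_mul_sq [Finite K] {a : K} (ha : ¬ IsSquare a) {c : K} (hc : c ≠ 0) :
    ∃ s : K, s ≠ 0 ∧ (c = s ^ 2 ∨ c = a * s ^ 2) := by
  classical
  have := Fintype.ofFinite K
  have ha0 : a ≠ 0 := fun e => ha (e ▸ IsSquare.zero)
  by_cases h : IsSquare c
  · obtain ⟨s, rfl⟩ := h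
    exact ⟨s, left_ne_zero_of_mul hc, Or.inl (sq s).symm⟩
  -- The product of two nonsquares of a finite field is a square.
  · have h1 : IsSquare (a * c) := by
      rw [← quadraticChar_one_iff_isSquare (mul_ne_zero ha0 hc), map_mul,
        quadraticChar_neg_one_iff_not_isSquare.2 ha, quadraticChar_neg_one_iff_not_isSquare.2 h]
      rfl
    obtain ⟨s, hs⟩ := h1
    have hs0 : s ≠ 0 := by
      rintro rfl
      exact mul_ne_zero ha0 hc (by simpa using hs)
    exact ⟨s / a, div_ne_zero hs0 ha0, Or.inr (by field_simp; linear_combination hs)⟩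

/-- A nontrivial character differs from one of two fixed ones by a square factor. -/
theorem exists_sq_shift [Finite K] {a : K} (ha : ¬ IsSquare a) {ψ χ : AddChar K ℂ} (hψ : ψ ≠ 1)
    (hχ : χ ≠ 1) : ∃ s : K, s ≠ 0 ∧
      ((∀ t, χ t = ψ (s ^ 2 * t)) ∨ ∀ t, χ t = AddChar.mulShift ψ a (s ^ 2 * t)) := by
  obtain ⟨c, rfl⟩ := exists_mulShift_eq (χ := χ) hψ
  have hc : c ≠ 0 := by
    rintro rfl
    exact hχ (AddChar.mulShift_zero ψ)
  obtain ⟨s, hs, rfl | rfl⟩ := exists_eq_sq_or_eq_mul_sq ha hc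
  · exact ⟨s, hs, Or.inl fun t => AddChar.mulShift_apply⟩
  · refine ⟨s, hs, Or.inr fun t => ?_⟩
    rw [AddChar.mulShift_apply, AddChar.mulShift_apply, mul_assoc]

/-- The element `2k` is not a unit because `φ` kills it; were `2k + 1` a nonunit too, so would be
their difference `1`. -/
theorem isUnit_natCast_of_odd {R F : Type*} [CommRing R] [IsLocalRing R] [Field F] [CharP F 2]
    (φ : R →+* F) {m : ℕ} (hm : Odd m) : IsUnit (m : R) := by
  obtain ⟨k, rfl⟩ := hm
  by_contra h
  have h2 : ¬ IsUnit (2 * (k : R)) := fun hu => by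
    have := hu.map φ
    rw [map_mul, map_ofNat, CharTwo.two_eq_zero, zero_mul] at this
    exact not_isUnit_zero this
  have h3 := IsLocalRing.nonunits_add (a := ((2 * k + 1 : ℕ) : R)) (b := -(2 * (k : R))) h
    (by rwa [mem_nonunits_iff, IsUnit.neg_iff])
  refine h3 ?_
  convert isUnit_one (M := R) using 1
  push_cast
  ring

theorem odd_char_of_card_mod_four [Finite K] {p : ℕ} [CharP K p] (hq : Nat.card K % 4 = 1) :
    p.Prime ∧ Odd p := by
  have := Fintype.ofFinite K
  obtain ⟨m, hp, hm⟩ := FiniteField.card K p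
  refine ⟨hp, hp.odd_of_ne_two ?_⟩
  rintro rfl
  rw [Nat.card_eq_fintype_card, hm] at hq
  have h1 : 2 ∣ 2 ^ (m : ℕ) := dvd_pow_self 2 m.ne_zero
  omega

theorem three_lt_card [Finite K] (hq : Nat.card K % 4 = 1) : 3 < Nat.card K := by
  have := Finite.one_lt_card (α := K)
  omega

theorem two_ne_zero_of_odd_char {p : ℕ} [CharP K p] (hp : p.Prime) (hp2 : Odd p) : (2 : K) ≠ 0 := by
  intro h
  have h1 : ((2 : ℕ) : K) = 0 := by exact_mod_cast h
  rw [CharP.cast_eq_zero_iff K p, Nat.prime_dvd_prime_iff_eq hp Nat.prime_two] at h1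
  subst h1
  exact absurd hp2 (by decide)

end Characters

/-! ### Matrices and degree of the odd part -/

section Reductions

variable {n : ℕ} {K : Type*} [Field K] [Fintype K] [DecidableEq K] {R : Type*} [CommRing R]
  {F : Type*} [Field F] {d : ℕ} {r : Fin d → Fin n → K} {ψ : AddChar K R}
  {P : Sp n K →* Matrix (Fin n → K) (Fin n → K) R}

theorem baseChangeRep_oddRep (φ : R →+* F) (hr : IsHalfSystem r) (hP : IsWeil ψ P) (g : Sp n K) :
    baseChangeRep φ (oddRep hr hP) g = toLin' (oddMat r (mapRep φ P g)) := by
  rw [baseChangeRep_apply]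
  congr 1
  ext i j
  simp [oddRep_apply, oddMat, mapRep_apply]

theorem exists_isHalfSystem_pi (h2 : (2 : K) ≠ 0) :
    ∃ r : Fin ((Nat.card K ^ n - 1) / 2) → Fin n → K, IsHalfSystem r := by
  have hV : ∀ v : Fin n → K, v = -v → v = 0 := fun v hv => funext fun i => by
    have h3 : v i = -v i := congrFun hv i
    have h4 : 2 * v i = 0 := by linear_combination h3
    exact (mul_eq_zero.1 h4).resolve_left h2
  have h := exists_isHalfSystem hV
  rwa [Fintype.card_fun, Fintype.card_fin, ← Nat.card_eq_fintype_card] at h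

theorem half_card_pos (hn : 1 ≤ n) (hq : 3 < Nat.card K) : 0 < (Nat.card K ^ n - 1) / 2 := by
  have := Nat.le_self_pow (by omega : n ≠ 0) (Nat.card K)
  omega

end Reductions

end SpSteinberg

end

/-! ### The two Weil modules and their reductions -/

theorem mainTheorem2 (n : ℕ) (hn : 1 ≤ n) (K : Type*) [Field K] [Finite K]
    (hq : Nat.card K % 4 = 1) (p : ℕ) [CharP K p]
    (R : Subring ℂ) [IsDiscreteValuationRing R] (hζ : ∃ ζ : R, IsPrimitiveRoot ζ p)
    (F : Type*) [Field F] [CharP F 2] (φ : R →+* F)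
    (κ : ℕ) (hκ : κ = padicValNat 2 (SpSteinberg.borel n K).index) :
    ∃ W₁ W₂ : Representation ℂ (SpSteinberg.Sp n K) (Fin ((Nat.card K ^ n - 1) / 2) → ℂ),
      -- `W₁`, `W₂` are the two complex Weil modules of degree `(qⁿ - 1) / 2`
      SpSteinberg.IsSmallWeilModule W₁ ∧ SpSteinberg.IsSmallWeilModule W₂ ∧
      IsEmpty (W₁.Equiv W₂) ∧
      (∀ W : Representation ℂ (SpSteinberg.Sp n K) (Fin ((Nat.card K ^ n - 1) / 2) → ℂ),
        SpSteinberg.IsSmallWeilModule W → Nonempty (W.Equiv W₁) ∨ Nonempty (W.Equiv W₂)) ∧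
      -- they have reductions over `F`
      (∃ N₁ N₂ : Representation F (SpSteinberg.Sp n K) (Fin ((Nat.card K ^ n - 1) / 2) → F),
        SpSteinberg.IsReduction φ W₁ N₁ ∧ SpSteinberg.IsReduction φ W₂ N₂) ∧
      -- all such reductions are irreducible submodules of the layer, and the two are distinct
      ∀ N₁ N₂ : Representation F (SpSteinberg.Sp n K) (Fin ((Nat.card K ^ n - 1) / 2) → F),
        SpSteinberg.IsReduction φ W₁ N₁ → SpSteinberg.IsReduction φ W₂ N₂ →
          N₁.IsIrreducible ∧ N₂.IsIrreducible ∧ IsEmpty (N₁.Equiv N₂) ∧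
          SpSteinberg.EmbedsInLayer N₁
            (SpSteinberg.gowFiltration n K φ (κ - 1)) (SpSteinberg.gowFiltration n K φ κ) ∧
          SpSteinberg.EmbedsInLayer N₂
            (SpSteinberg.gowFiltration n K φ (κ - 1)) (SpSteinberg.gowFiltration n K φ κ) := by
  classical
  have := Fintype.ofFinite K
  subst hκ
  obtain ⟨hp, hp2⟩ := SpSteinberg.odd_char_of_card_mod_four (p := p) hq
  have h2 : (2 : K) ≠ 0 := SpSteinberg.two_ne_zero_of_odd_char hp hp2
  have hq3 := SpSteinberg.three_lt_card hq
  have hd := SpSteinberg.half_card_pos hn hq3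
  have hu : IsUnit (Fintype.card K : R) := by
    rw [← Nat.card_eq_fintype_card]
    exact SpSteinberg.isUnit_natCast_of_odd φ (Nat.odd_iff.2 (by omega))
  obtain ⟨ψ, hφψ⟩ := SpSteinberg.exists_redChar_ne_one (K := K) hp hp2 hζ φ
  have hψ := SpSteinberg.ne_one_of_redChar_ne_one hφψ
  have hψC := SpSteinberg.redChar_subtype_ne_one hψ
  -- The second module has the type `ψ` shifted by a nonsquare, which represents the other class of
  -- nontrivial characters modulo squares.
  obtain ⟨a, ha⟩ := FiniteField.exists_nonsquare (F := K) fun h =>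
    h2 (by have := ringChar.Nat.cast_ringChar (R := K); rw [h] at this; exact_mod_cast this)
  have ha0 : a ≠ 0 := fun e => ha (e ▸ IsSquare.zero)
  have hφψ' : SpSteinberg.redChar φ (AddChar.mulShift ψ a) ≠ 1 :=
    SpSteinberg.mulShift_ne_one hφψ ha0
  have hψ' := SpSteinberg.ne_one_of_redChar_ne_one hφψ'
  have hψC' := SpSteinberg.redChar_subtype_ne_one hψ'
  obtain ⟨r, hr⟩ := SpSteinberg.exists_isHalfSystem_pi (n := n) h2
  obtain ⟨P, hP⟩ := SpSteinberg.exists_isWeil (n := n) hψ h2 hu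
  obtain ⟨P', hP'⟩ := SpSteinberg.exists_isWeil (n := n) hψ' h2 hu
  have hb := SpSteinberg.baseChangeRep_oddRep φ hr hP
  have hb' := SpSteinberg.baseChangeRep_oddRep φ hr hP'
  have hirr := SpSteinberg.isIrreducible_odd hφψ h2 hq3 hr hd (hP.map φ) hb
  have hirr' := SpSteinberg.isIrreducible_odd hφψ' h2 hq3 hr hd (hP'.map φ) hb'
  have hemp := SpSteinberg.isEmpty_odd_equiv hφψ h2 hq3 hr hd (hP.map φ) hb (hP'.map φ) hb' ha
    fun t => rfl
  have hlayer := SpSteinberg.embedsInLayer_odd hφψ h2 hq hq3 hn hr (hP.map φ) hb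
  have hlayer' := SpSteinberg.embedsInLayer_odd hφψ' h2 hq hq3 hn hr (hP'.map φ) hb'
  refine ⟨_, _, SpSteinberg.isSmallWeilModule_odd hr hP hψC,
    SpSteinberg.isSmallWeilModule_odd hr hP' hψC', ⟨fun E => ?_⟩, ?_,
    ⟨_, _, ⟨_, SpSteinberg.oddRep hr hP, ⟨.refl _⟩, ⟨.refl _⟩⟩,
      ⟨_, SpSteinberg.oddRep hr hP', ⟨.refl _⟩, ⟨.refl _⟩⟩⟩, ?_⟩
  -- The complex modules are told apart by their reductions, to which an isomorphism would descend.
  · obtain ⟨E'⟩ := SpSteinberg.nonempty_equiv_of_complex φ hirr E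
    exact hemp.false E'
  · rintro W ⟨χ, hχ, P₀, hP₀, T, hT, hT'⟩
    obtain ⟨s, hs, h | h⟩ := SpSteinberg.exists_sq_shift ha hψC hχ
    · exact Or.inl (SpSteinberg.nonempty_equiv_odd hr hP h2 hq3 hψC hs h hP₀ T hT hT')
    · exact Or.inr (SpSteinberg.nonempty_equiv_odd hr hP' h2 hq3 hψC' hs h hP₀ T hT hT')
  · intro N₁ N₂ hN₁ hN₂
    obtain ⟨E₁⟩ := SpSteinberg.nonempty_equiv_of_isReduction hirr hN₁
    obtain ⟨E₂⟩ := SpSteinberg.nonempty_equiv_of_isReduction hirr' hN₂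
    exact ⟨SpSteinberg.isIrreducible_of_equiv E₁ hirr, SpSteinberg.isIrreducible_of_equiv E₂ hirr',
      ⟨fun E => hemp.false ((E₁.symm.trans E).trans E₂)⟩,
      SpSteinberg.embedsInLayer_of_equiv E₁ hlayer, SpSteinberg.embedsInLayer_of_equiv E₂ hlayer'⟩
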